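/- Let $Z$ be a (finite dimensional, Hausdorff) complex manifold, let $M\subset Z$ be a real-analytic submanifold that is generically embedded, i.e. $T_pZ=T_pM+iT_pM$ for all $p\in M$, and let $a\in M$. Let $\mathfrak{hol}(Z,a)$ be the complex Lie algebra of germs at $a$ of holomorphic vector fields on $Z$, let $\mathfrak{hol}(M,a)\subset\mathfrak{hol}(Z,a)$ be the real subalgebra of those germs that are tangent to $M$ (the germs at $a$ of real-analytic infinitesimal CR-transformations of $M$), and let $\mathrm{Aut}(M,a)$ be the group of germs of (bianalytic) CR-automorphisms of $(M,a)$. A tube realization of $(M,a)$ is a CR-isomorphism of germs $\varphi:(M,a)\to(T,c)$, where $E=V\oplus iV$ is the complexification of a finite dimensional real vector space $V$, $T=V+iF\subset E$ for a connected, locally closed real-analytic submanifold $F\subset V$, and $c\in T$. Two tube realizations $\varphi:(M,a)\to(T,c)$ and $\varphi':(M,a)\to(T',c')$ with $T\subset E$, $T'\subset E'$ are affinely equivalent if some complex affine isomorphism $\lambda:E\to E'$ maps the germ $(T,c)$ onto the germ $(T',c')$. Subsets $\mathfrak v,\mathfrak v'\subset\mathfrak{hol}(M,a)$ are conjugate under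 $\mathrm{Aut}(M,a)$ if $\mathfrak v'=g_*(\mathfrak v)$ for some $g\in\mathrm{Aut}(M,a)$. Call an abelian real Lie subalgebra $\mathfrak v\subset\mathfrak{hol}(M,a)$ admissible if (i) $\mathfrak v$ is totally real in $\mathfrak{hol}(Z,a)$, i.e. $\mathfrak v\cap i\mathfrak v=0$, and (ii) $\mathfrak e:=\mathfrak v\oplus i\mathfrak v$ spans the full tangent space $T_aZ$, i.e. $\{\xi_a:\xi\in\mathfrak e\}=T_aZ$. Then affine equivalence and conjugacy are equivalence relations, and the following hold. For every tube realization $\varphi:(M,a)\to(T,c)$ the pull backs to $M$ of the constant vector fields $v\,\partial/\partial z$, $v\in V$, form a unique admissible subalgebra $\{\varphi^*(v\,\partial/\partial z):v\in V\}$, and assigning it to $\varphi$ induces a well-defined bijection from the set of affine equivalence classes of tube realizations of $(M,a)$ onto the set of $\mathrm{Aut}(M,a)$-conjugacy classes of admissible subalgebras $\mathfrak v\subset\mathfrak{hol}(M,a)$. Conversely, for every admissible $\mathfrak v$ the map $\psi(\xi):=\exp(\xi)(a)$ is a biholomorphic map from an open neighbourhood of $0$ in the complex vector space $E:=\mathfrak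 e$ onto an open neighbourhood of $a$ in $Z$ on which all germs in $\mathfrak e$ have holomorphic representatives, where $\exp(\xi)(a)$ is the value at time $1$ of the integral curve of $\xi$ starting at $a$; and $\varphi:=\psi^{-1}$ restricts to a tube realization $(M,a)\to(T,0)$, $T=V+iF\subset E$ with $V:=\mathfrak v$, such that $\mathfrak v=\{\varphi^*(v\,\partial/\partial z):v\in V\}$. -/

import Mathlib

open scoped Manifold ContDiff Topology
open Set Filter

universe u v w u' v'

noncomputable section

namespace CRTube

/-! ### The complex Lie algebra of germs of holomorphic vector fields

Complex manifolds are modelled on a finite dimensional complex normed space `E`. -/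

section Germs

variable (E : Type v) [NormedAddCommGroup E] [NormedSpace ℂ E] [FiniteDimensional ℂ E]
  {Z : Type u} [TopologicalSpace Z] [ChartedSpace E Z] [IsManifold 𝓘(ℂ, E) ω Z]

/-- Vector fields on `Z` that are holomorphic in some neighbourhood of `a`. -/
def holAt (a : Z) : Submodule ℂ (Π p : Z, TangentSpace 𝓘(ℂ, E) p) where
  carrier := {X | ∀ᶠ p in 𝓝 a, ContMDiffAt 𝓘(ℂ, E) 𝓘(ℂ, E).tangent ω (T% X) p}
  add_mem' {X Y} hX hY := by
    filter_upwards [hX, hY] with p h1 h2 using h1.add_section h2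
  zero_mem' := Eventually.of_forall fun p => (Bundle.contMDiff_zeroSection ℂ _).contMDiffAt
  smul_mem' c X hX := by
    filter_upwards [hX] with p h1 using h1.const_smul_section

/-- The fields vanishing identically near `a`. -/
def vanishAt (a : Z) : Submodule ℂ (holAt E a) where
  carrier := {X | ∀ᶠ p in 𝓝 a, X.1 p = 0}
  add_mem' {X Y} hX hY := by
    filter_upwards [hX, hY] with p h1 h2
    simp [h1, h2]
  zero_mem' := Eventually.of_forall fun p => rfl
  smul_mem' c X hX := by
    filter_upwards [hX] with p h1
    simp [h1]

/-- `𝔥𝔬𝔩(Z,a)`: germs at `a` of holomorphic vector fields on `Z`. -/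
def HolGerm (a : Z) : Type (max u v) := holAt E a ⧸ vanishAt E a

variable {E}

instance (a : Z) : AddCommGroup (HolGerm E a) :=
  inferInstanceAs (AddCommGroup (holAt E a ⧸ vanishAt E a))

instance (a : Z) : Module ℂ (HolGerm E a) :=
  inferInstanceAs (Module ℂ (holAt E a ⧸ vanishAt E a))

/-- The germ of a field that is holomorphic near `a`. -/
def germ (a : Z) : holAt E a →ₗ[ℂ] HolGerm E a := (vanishAt E a).mkQ

/-- A vector field representing a germ. -/
def HolGerm.rep {a : Z} (ξ : HolGerm E a) : Π p : Z, TangentSpace 𝓘(ℂ, E) p :=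
  (Submodule.Quotient.mk_surjective (vanishAt E a) ξ).choose.1

theorem HolGerm.rep_mem {a : Z} (ξ : HolGerm E a) : ξ.rep ∈ holAt E a :=
  (Submodule.Quotient.mk_surjective (vanishAt E a) ξ).choose.2

theorem HolGerm.germ_rep {a : Z} (ξ : HolGerm E a) : germ a ⟨ξ.rep, ξ.rep_mem⟩ = ξ :=
  (Submodule.Quotient.mk_surjective (vanishAt E a) ξ).choose_spec

theorem germ_eq_iff {a : Z} (X Y : holAt E a) : germ a X = germ a Y ↔ X.1 =ᶠ[𝓝 a] Y.1 := by
  refine (Submodule.Quotient.eq (vanishAt E a)).trans ?_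
  refine eventually_congr (Eventually.of_forall fun p => ?_)
  exact sub_eq_zero

theorem rep_germ {a : Z} (X : holAt E a) : (germ a X).rep =ᶠ[𝓝 a] X.1 :=
  (germ_eq_iff ⟨_, HolGerm.rep_mem _⟩ X).1 (HolGerm.germ_rep _)

theorem HolGerm.ext_rep {a : Z} {ξ η : HolGerm E a} (h : ξ.rep =ᶠ[𝓝 a] η.rep) : ξ = η := by
  rw [← ξ.germ_rep, ← η.germ_rep]
  exact (germ_eq_iff _ _).2 h

theorem HolGerm.rep_add {a : Z} (ξ η : HolGerm E a) :
    (ξ + η).rep =ᶠ[𝓝 a] ξ.rep + η.rep := by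
  have := rep_germ (E := E) (⟨ξ.rep, ξ.rep_mem⟩ + ⟨η.rep, η.rep_mem⟩ : holAt E a)
  rwa [map_add, germ_rep, germ_rep] at this

theorem HolGerm.rep_smul {a : Z} (c : ℂ) (ξ : HolGerm E a) :
    (c • ξ).rep =ᶠ[𝓝 a] c • ξ.rep := by
  have := rep_germ (E := E) (c • ⟨ξ.rep, ξ.rep_mem⟩ : holAt E a)
  rwa [map_smul, germ_rep] at this

theorem HolGerm.rep_zero {a : Z} : (0 : HolGerm E a).rep =ᶠ[𝓝 a] 0 := by
  have := rep_germ (E := E) (0 : holAt E a)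
  rwa [map_zero] at this

theorem mlieBracket_mem_holAt {a : Z} {X Y : Π p : Z, TangentSpace 𝓘(ℂ, E) p}
    (hX : X ∈ holAt E a) (hY : Y ∈ holAt E a) :
    VectorField.mlieBracket 𝓘(ℂ, E) X Y ∈ holAt E a := by
  have : CompleteSpace E := FiniteDimensional.complete ℂ E
  have : IsManifold 𝓘(ℂ, E) (minSmoothness ℂ 2) Z := IsManifold.of_le (n := ω) le_top
  have : IsManifold 𝓘(ℂ, E) (ω + 1) Z := IsManifold.of_le (n := ω) le_top
  filter_upwards [hX, hY] with p h1 h2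
  have := ContMDiffWithinAt.mlieBracketWithin_vectorField (m := ω) (n := ω)
    h1.contMDiffWithinAt h2.contMDiffWithinAt uniqueMDiffOn_univ (mem_univ p) le_top
  simpa [contMDiffWithinAt_univ, VectorField.mlieBracketWithin_univ] using this

instance (a : Z) : Bracket (HolGerm E a) (HolGerm E a) where
  bracket ξ η := germ a ⟨VectorField.mlieBracket 𝓘(ℂ, E) ξ.rep η.rep,
    mlieBracket_mem_holAt ξ.rep_mem η.rep_mem⟩

theorem HolGerm.rep_bracket {a : Z} (ξ η : HolGerm E a) :
    ⁅ξ, η⁆.rep =ᶠ[𝓝 a] VectorField.mlieBracket 𝓘(ℂ, E) ξ.rep η.rep :=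
  rep_germ _

theorem mdiffAt_of_mem {a : Z} {X : Π p : Z, TangentSpace 𝓘(ℂ, E) p} (hX : X ∈ holAt E a) :
    ∀ᶠ p in 𝓝 a, MDifferentiableAt 𝓘(ℂ, E) 𝓘(ℂ, E).tangent (T% X) p := by
  filter_upwards [hX] with p h using h.mdifferentiableAt (by simp)

instance (a : Z) : LieRing (HolGerm E a) where
  add_lie ξ η ζ := by
    have : CompleteSpace E := FiniteDimensional.complete ℂ E
    have : IsManifold 𝓘(ℂ, E) 2 Z := IsManifold.of_le (n := ω) le_top
    refine HolGerm.ext_rep ?_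
    filter_upwards [(⁅ξ, ζ⁆).rep_add ⁅η, ζ⁆, ξ.rep_bracket ζ, η.rep_bracket ζ,
      (ξ + η).rep_bracket ζ, (ξ.rep_add η).mlieBracket_vectorField (EventuallyEq.refl _ ζ.rep),
      mdiffAt_of_mem ξ.rep_mem, mdiffAt_of_mem η.rep_mem] with p h1 h2 h3 h4 h5 h6 h7
    rw [h1, Pi.add_apply, h2, h3, h4, h5, VectorField.mlieBracket_add_left h6 h7]
  lie_add ξ η ζ := by
    have : CompleteSpace E := FiniteDimensional.complete ℂ E
    have : IsManifold 𝓘(ℂ, E) 2 Z := IsManifold.of_le (n := ω) le_top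
    refine HolGerm.ext_rep ?_
    filter_upwards [(⁅ξ, η⁆).rep_add ⁅ξ, ζ⁆, ξ.rep_bracket η, ξ.rep_bracket ζ,
      ξ.rep_bracket (η + ζ), (EventuallyEq.refl _ ξ.rep).mlieBracket_vectorField (η.rep_add ζ),
      mdiffAt_of_mem η.rep_mem, mdiffAt_of_mem ζ.rep_mem] with p h1 h2 h3 h4 h5 h6 h7
    rw [h1, Pi.add_apply, h2, h3, h4, h5, VectorField.mlieBracket_add_right h6 h7]
  lie_self ξ := by
    refine HolGerm.ext_rep ?_
    filter_upwards [ξ.rep_bracket ξ, HolGerm.rep_zero (E := E) (a := a)] with p h1 h2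
    rw [h1, h2, VectorField.mlieBracket_self]
    rfl
  leibniz_lie ξ η ζ := by
    have : CompleteSpace E := FiniteDimensional.complete ℂ E
    have : IsManifold 𝓘(ℂ, E) (minSmoothness ℂ 3) Z := IsManifold.of_le (n := ω) le_top
    refine HolGerm.ext_rep ?_
    filter_upwards [(⁅⁅ξ, η⁆, ζ⁆).rep_add ⁅η, ⁅ξ, ζ⁆⁆, ξ.rep_bracket ⁅η, ζ⁆,
      (⁅ξ, η⁆).rep_bracket ζ, η.rep_bracket ⁅ξ, ζ⁆,
      (EventuallyEq.refl _ ξ.rep).mlieBracket_vectorField (η.rep_bracket ζ),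
      (ξ.rep_bracket η).mlieBracket_vectorField (EventuallyEq.refl _ ζ.rep),
      (EventuallyEq.refl _ η.rep).mlieBracket_vectorField (ξ.rep_bracket ζ),
      ξ.rep_mem, η.rep_mem, ζ.rep_mem] with p h1 h2 h3 h4 h5 h6 h7 hX hY hZ
    rw [h1, Pi.add_apply, h2, h3, h4, h5, h6, h7]
    exact VectorField.leibniz_identity_mlieBracket_apply (hX.of_le le_top) (hY.of_le le_top)
      (hZ.of_le le_top)

theorem HolGerm.lie_smul_complex {a : Z} (c : ℂ) (ξ η : HolGerm E a) :
    ⁅ξ, c • η⁆ = c • ⁅ξ, η⁆ := by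
  have : CompleteSpace E := FiniteDimensional.complete ℂ E
  have : IsManifold 𝓘(ℂ, E) 2 Z := IsManifold.of_le (n := ω) le_top
  refine HolGerm.ext_rep ?_
  filter_upwards [(⁅ξ, η⁆).rep_smul c, ξ.rep_bracket η, ξ.rep_bracket (c • η),
    (EventuallyEq.refl _ ξ.rep).mlieBracket_vectorField (η.rep_smul c),
    mdiffAt_of_mem η.rep_mem] with p h1 h2 h3 h4 h5
  rw [h1, Pi.smul_apply, h2, h3, h4, VectorField.mlieBracket_const_smul_right h5]

instance (a : Z) : LieAlgebra ℂ (HolGerm E a) where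
  lie_smul c ξ η := ξ.lie_smul_complex c η

/-- `𝔥𝔬𝔩(Z,a)` as a real Lie algebra. -/
instance (a : Z) : LieAlgebra ℝ (HolGerm E a) where
  lie_smul c ξ η := ξ.lie_smul_complex (c : ℂ) η

/-- The evaluation `ξ ↦ ξ_a` on `𝔥𝔬𝔩(Z,a)`. -/
def evalAt (a : Z) : HolGerm E a →ₗ[ℂ] TangentSpace 𝓘(ℂ, E) a where
  toFun ξ := ξ.rep a
  map_add' ξ η := (ξ.rep_add η).self_of_nhds
  map_smul' c ξ := (ξ.rep_smul c).self_of_nhds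

end Germs

/-! ### Real-analytic submanifolds, CR structure, germs of CR maps -/

/-- `S` is an (embedded, hence locally closed) real-analytic submanifold of the real-analytic
manifold `X`: near each of its points some real-analytic chart of `X` maps it onto an open piece
of a linear subspace. -/
def IsAnalyticSubmanifold (W : Type v) [NormedAddCommGroup W] [NormedSpace ℝ W]
    {X : Type u} [TopologicalSpace X] [ChartedSpace W X] (S : Set X) : Prop :=
  ∀ p ∈ S, ∃ Φ ∈ IsManifold.maximalAtlas 𝓘(ℝ, W) ω X, p ∈ Φ.source ∧
    ∃ L : Submodule ℝ W, ∀ x ∈ Φ.source, x ∈ S ↔ Φ x ∈ L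

section CR

variable (E : Type v) [NormedAddCommGroup E] [NormedSpace ℂ E]
  {Z : Type u} [TopologicalSpace Z] [ChartedSpace E Z]
  (E' : Type v') [NormedAddCommGroup E'] [NormedSpace ℂ E']
  {Z' : Type u'} [TopologicalSpace Z'] [ChartedSpace E' Z']

/-- The real tangent space `T_pM` of a submanifold `M ⊆ Z`, as a real subspace of the complex
vector space `T_pZ`: it consists of the velocities at `p` of curves in `M`. -/
def tangentAt (M : Set Z) (p : Z) : Submodule ℝ (TangentSpace 𝓘(ℂ, E) p) :=
  Submodule.span ℝ {v | ∃ γ : ℝ → Z, γ 0 = p ∧ (∀ᶠ t in 𝓝 0, γ t ∈ M) ∧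
    HasMFDerivAt 𝓘(ℝ, ℝ) 𝓘(ℝ, E) γ 0 ((1 : ℝ →L[ℝ] ℝ).smulRight (v : E))}

/-- The holomorphic tangent space `H_pM = T_pM ∩ i T_pM`. -/
def holTangentAt (M : Set Z) (p : Z) : Set (TangentSpace 𝓘(ℂ, E) p) :=
  {v | v ∈ tangentAt E M p ∧ Complex.I • v ∈ tangentAt E M p}

/-- `M` is a real-analytic submanifold of the complex manifold `Z`, generically embedded, i.e.
`T_pZ = T_pM + i T_pM` for all `p ∈ M`. -/
structure IsGenericSubmanifold (M : Set Z) : Prop where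
  submanifold : IsAnalyticSubmanifold E M
  generic : ∀ p ∈ M,
    Submodule.span ℂ (tangentAt E M p : Set (TangentSpace 𝓘(ℂ, E) p)) = ⊤

/-- The real differential `T_pZ → T_{f(p)}Z'` of a map between complex manifolds. -/
def realDeriv (f : Z → Z') (p : Z) :
    TangentSpace 𝓘(ℂ, E) p →L[ℝ] TangentSpace 𝓘(ℂ, E') (f p) :=
  mfderiv 𝓘(ℝ, E) 𝓘(ℝ, E') f p

/-- `f` represents a germ at `a` of a real-analytic CR map `M → N`. Germs along `M` of
real-analytic maps are restrictions to `M` of real-analytic maps defined near `a` in `Z`;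
accordingly `f` is a map on `Z`, real-analytic near `a`, of which only the restriction to `M` near
`a` matters (`f` itself need not be holomorphic). -/
structure IsCRMapGerm (M : Set Z) (a : Z) (N : Set Z') (f : Z → Z') : Prop where
  analytic : ContMDiffAt 𝓘(ℝ, E) 𝓘(ℝ, E') ω f a
  mapsTo : ∀ᶠ p in 𝓝[M] a, f p ∈ N
  cr : ∀ᶠ p in 𝓝[M] a, ∀ v ∈ holTangentAt E M p,
    realDeriv E E' f p v ∈ holTangentAt E' N (f p) ∧
      realDeriv E E' f p (Complex.I • v) = Complex.I • realDeriv E E' f p v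

/-- `f` represents an isomorphism of CR-manifold germs `(M,a) → (N,b)`, bianalytic. -/
def IsCRIsoGerm (M : Set Z) (a : Z) (N : Set Z') (b : Z') (f : Z → Z') : Prop :=
  f a = b ∧ IsCRMapGerm E E' M a N f ∧ ∃ g : Z' → Z, IsCRMapGerm E' E N b M g ∧
    (∀ᶠ p in 𝓝[M] a, g (f p) = p) ∧ ∀ᶠ q in 𝓝[N] b, f (g q) = q

end CR

/-! ### `𝔥𝔬𝔩(M,a)`, the admissible abelian subalgebras and their conjugacy -/

section Subalgebras

variable {E : Type v} [NormedAddCommGroup E] [NormedSpace ℂ E] [FiniteDimensional ℂ E]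
  {Z : Type u} [TopologicalSpace Z] [ChartedSpace E Z] [IsManifold 𝓘(ℂ, E) ω Z]

/-- `𝔥𝔬𝔩(M,a)` as a real subspace of `𝔥𝔬𝔩(Z,a)`, for `M` generic in `Z`: the germs of real-analytic
infinitesimal CR transformations of `M` are the germs of holomorphic vector fields on `Z` that are
tangent to `M`. -/
def holM (M : Set Z) (a : Z) : Submodule ℝ (HolGerm E a) where
  carrier := {ξ | ∀ᶠ p in 𝓝[M] a, ξ.rep p ∈ tangentAt E M p}
  add_mem' {ξ η} hξ hη := by
    filter_upwards [hξ, hη, (ξ.rep_add η).filter_mono nhdsWithin_le_nhds] with p h1 h2 h3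
    rw [h3]
    exact add_mem h1 h2
  zero_mem' := by
    filter_upwards [(HolGerm.rep_zero (E := E) (a := a)).filter_mono nhdsWithin_le_nhds] with p h
    rw [h]
    exact zero_mem _
  smul_mem' c ξ hξ := by
    filter_upwards [hξ, (ξ.rep_smul (c : ℂ)).filter_mono nhdsWithin_le_nhds] with p h1 h2
    have h3 : (c • ξ).rep p = (c : ℂ) • ξ.rep p := h2
    rw [h3]
    exact Submodule.smul_mem _ c h1

/-- Abelian Lie subalgebras `𝔳 ⊆ 𝔥𝔬𝔩(M,a)` such that (i) `𝔳` is totally real in `𝔥𝔬𝔩(Z,a)`, and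
(ii) `𝔳 ⊕ i𝔳` spans `T_aZ`. -/
structure IsAdmissible (M : Set Z) (a : Z) (𝔳 : LieSubalgebra ℝ (HolGerm E a)) : Prop where
  le_holM : 𝔳.toSubmodule ≤ holM M a
  abelian : IsLieAbelian 𝔳
  totallyReal : ∀ ξ ∈ 𝔳, Complex.I • ξ ∈ 𝔳 → ξ = 0
  spans : (Submodule.span ℂ (𝔳 : Set (HolGerm E a))).map (evalAt a) = ⊤

variable (E) in
/-- The set of all admissible subalgebras. -/
abbrev Admissible (M : Set Z) (a : Z) : Type (max u v) :=
  {𝔳 : LieSubalgebra ℝ (HolGerm E a) // IsAdmissible M a 𝔳}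

/-- `g_* ξ = η` along `M`, for `g` a germ of a self-map of `(M,a)`. -/
def Pushes (M : Set Z) (a : Z) (g : Z → Z) (ξ η : HolGerm E a) : Prop :=
  ∀ᶠ p in 𝓝[M] a, realDeriv E E g p (ξ.rep p) = η.rep (g p)

/-- Conjugacy under the stability group: `𝔴 = g_*(𝔳)` for some `g ∈ Aut(M,a)`. -/
def Conjugate (M : Set Z) (a : Z) (𝔳 𝔴 : Admissible E M a) : Prop :=
  ∃ g : Z → Z, IsCRIsoGerm E E M a M a g ∧
    (∀ ξ ∈ 𝔳.1, ∃ η ∈ 𝔴.1, Pushes M a g ξ η) ∧ ∀ η ∈ 𝔴.1, ∃ ξ ∈ 𝔳.1, Pushes M a g ξ η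

end Subalgebras

/-! ### Tube realizations -/

/-- The tube `V + iF` over the base `F ⊆ V`. -/
def tube {C : Type w} [AddCommGroup C] [Module ℂ C] (V : Submodule ℝ C) (F : Set V) : Set C :=
  {z | ∃ x : V, ∃ y ∈ F, z = (x : C) + Complex.I • (y : C)}

/-- A tube realization of the germ `(M,a)`: a CR isomorphism `φ : (M,a) → (T,c)`, where
`T = V + iF ⊆ C = V ⊕ iV` is the tube over a connected real-analytic submanifold `F` of the finite
dimensional real vector space `V`. -/
structure TubeRealization (E : Type v) [NormedAddCommGroup E] [NormedSpace ℂ E]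
    {Z : Type u} [TopologicalSpace Z] [ChartedSpace E Z] (M : Set Z) (a : Z) where
  C : Type w
  [instNorm : NormedAddCommGroup C]
  [instSpace : NormedSpace ℂ C]
  [instFin : FiniteDimensional ℂ C]
  V : Submodule ℝ C
  realForm : ∀ z : C, ∃! q : V × V, (q.1 : C) + Complex.I • (q.2 : C) = z
  F : Set V
  submanifold : IsAnalyticSubmanifold V F
  connected : IsConnected F
  c : C
  c_mem : c ∈ tube V F
  φ : Z → C
  isCRIso : IsCRIsoGerm E C M a (tube V F) c φ

attribute [instance] TubeRealization.instNorm TubeRealization.instSpace TubeRealization.instFin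

section Realizations

variable {E : Type v} [NormedAddCommGroup E] [NormedSpace ℂ E]
  {Z : Type u} [TopologicalSpace Z] [ChartedSpace E Z]
  {M : Set Z} {a : Z}

/-- The tube `T`. -/
def TubeRealization.T (R : TubeRealization.{u, v, w} E M a) : Set R.C := tube R.V R.F

variable (E M a) in
/-- Affine equivalence: the tube germs `(T,c)`, `(T',c')` correspond under an affine isomorphism of
the ambient complex vector spaces. -/
def AffEquiv (R R' : TubeRealization.{u, v, w} E M a) : Prop :=
  ∃ l : R.C ≃ᵃ[ℂ] R'.C, l R.c = R'.c ∧ ∀ᶠ z in 𝓝 R.c, z ∈ R.T ↔ l z ∈ R'.T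

variable [FiniteDimensional ℂ E] [IsManifold 𝓘(ℂ, E) ω Z]

/-- `𝔳 = {φ^*(x ∂/∂z) : x ∈ V}`. -/
def TubeRealization.Induces (R : TubeRealization.{u, v, w} E M a) (𝔳 : Admissible E M a) : Prop :=
  (∀ ξ ∈ 𝔳.1, ∃ x ∈ R.V, ∀ᶠ p in 𝓝[M] a, realDeriv E R.C R.φ p (ξ.rep p) = x) ∧
    ∀ x ∈ R.V, ∃ ξ ∈ 𝔳.1, ∀ᶠ p in 𝓝[M] a, realDeriv E R.C R.φ p (ξ.rep p) = x

/-- The realization `R` is the one obtained by inverting `ξ ↦ exp(ξ)(a)` on `𝔢 = 𝔳 ⊕ i𝔳`: there is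
a complex linear isomorphism `L : C ≅ 𝔢` with `L(V) = 𝔳`, and a biholomorphic map `ψ` from an open
neighbourhood of `0 ∈ C` onto an open neighbourhood `ψ.target` of `a ∈ Z`, such that `c = 0`, the
germs in `𝔢` have holomorphic representatives `X z` on `ψ.target` (linear in `z`),
`ψ(z) = exp(X z)(a)`, i.e. `ψ(z)` is the value at time `1` of an integral curve of `X z` starting at
`a`, and `φ` is the restriction of `ψ⁻¹` to `M` near `a`. -/
def TubeRealization.IsExp (R : TubeRealization.{u, v, w} E M a) (𝔳 : Admissible E M a) : Prop :=
  R.c = 0 ∧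
  ∃ (L : R.C ≃ₗ[ℂ] Submodule.span ℂ (𝔳.1 : Set (HolGerm E a)))
    (X : R.C →ₗ[ℂ] Π p : Z, TangentSpace 𝓘(ℂ, E) p) (ψ : OpenPartialHomeomorph R.C Z),
    (∀ z, z ∈ R.V ↔ (L z : HolGerm E a) ∈ 𝔳.1) ∧
    (∀ z, (L z : HolGerm E a).rep =ᶠ[𝓝 a] X z) ∧
    (∀ z, ∀ p ∈ ψ.target, ContMDiffAt 𝓘(ℂ, E) 𝓘(ℂ, E).tangent ω (T% (X z)) p) ∧
    0 ∈ ψ.source ∧ ψ 0 = a ∧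
    ContMDiffOn 𝓘(ℂ, R.C) 𝓘(ℂ, E) ω ψ ψ.source ∧
    ContMDiffOn 𝓘(ℂ, E) 𝓘(ℂ, R.C) ω ψ.symm ψ.target ∧
    (∀ z ∈ ψ.source, ∃ γ : ℝ → Z, γ 0 = a ∧ γ 1 = ψ z ∧ (∀ t ∈ Icc (0 : ℝ) 1, γ t ∈ ψ.target) ∧
      IsMIntegralCurveOn (I := 𝓘(ℝ, E)) γ (fun p => (X z p : E)) (Icc 0 1)) ∧
    ∀ᶠ p in 𝓝[M] a, R.φ p = ψ.symm p

end Realizations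

end CRTube

end

/-!
Along a generic submanifold a holomorphic map is determined by its restriction, and a real-analytic
CR map is the restriction of a holomorphic map: complexify a local parametrization `σ` of `M`, so
that the holomorphic extension of `f ∘ σ` factors through that of `σ`, a submersion onto a
neighbourhood of `a`.

In particular, the constant fields on a tube pull back to germs of holomorphic fields. If two
realizations induce conjugate subalgebras, the holomorphic extension of the transition map between
the tubes has constant derivative along `V`, hence is affine. Conversely, an affine map between tube
germs need not carry `V` to `V'`, but it can be replaced by one that does, since the germ of the
first tube is invariant under translations by `V` and by the preimage of `V'`.

If `𝔳` is admissible, evaluation at `a` is injective on `𝔢 = 𝔳 ⊕ i𝔳`: a field that commutes with a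
commuting frame and vanishes at `a` is zero. So a basis of `𝔢` is a commuting frame, which is the
inverse of a matrix of closed holomorphic one-forms. A primitive of that matrix is a chart in which
the fields in `𝔢` are constant, and there `exp(ξ)(a)` is just `ξ`. In that chart `𝔳` is a real form
`V` of the ambient space and the image of `M` is tangent to `V`, so it is invariant under
translations by `V`, that is, a tube.
-/

namespace CRTube

/-! ### Derivatives and tangent spaces in the model space -/

section ModelDeriv

variable {𝕜 : Type*} [NontriviallyNormedField 𝕜] {E E' E'' : Type*}
  [NormedAddCommGroup E] [NormedSpace 𝕜 E] [NormedAddCommGroup E'] [NormedSpace 𝕜 E']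
  [NormedAddCommGroup E''] [NormedSpace 𝕜 E'']
  {Z Z' Z'' : Type*} [TopologicalSpace Z] [ChartedSpace E Z] [TopologicalSpace Z']
  [ChartedSpace E' Z'] [TopologicalSpace Z''] [ChartedSpace E'' Z'']

variable (𝕜 E E') in
/-- The manifold derivative `mfderiv`, typed as a map between the model vector spaces: statements
about derivatives at different points can then be compared without transport between tangent
spaces. -/
noncomputable def modelDeriv (f : Z → Z') (p : Z) : E →L[𝕜] E' := mfderiv 𝓘(𝕜, E) 𝓘(𝕜, E') f p

theorem hasMFDerivAt_modelDeriv {f : Z → Z'} {p : Z}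
    (hf : MDifferentiableAt 𝓘(𝕜, E) 𝓘(𝕜, E') f p) :
    HasMFDerivAt 𝓘(𝕜, E) 𝓘(𝕜, E') f p (modelDeriv 𝕜 E E' f p) := hf.hasMFDerivAt

theorem modelDeriv_eq {f : Z → Z'} {p : Z} {f' : E →L[𝕜] E'}
    (h : HasMFDerivAt 𝓘(𝕜, E) 𝓘(𝕜, E') f p f') : modelDeriv 𝕜 E E' f p = f' := h.mfderiv

theorem modelDeriv_comp {f : Z → Z'} {g : Z' → Z''} {p : Z}
    (hf : MDifferentiableAt 𝓘(𝕜, E) 𝓘(𝕜, E') f p)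
    (hg : MDifferentiableAt 𝓘(𝕜, E') 𝓘(𝕜, E'') g (f p)) :
    modelDeriv 𝕜 E E'' (fun q => g (f q)) p =
      (modelDeriv 𝕜 E' E'' g (f p)).comp (modelDeriv 𝕜 E E' f p) :=
  modelDeriv_eq (hg.hasMFDerivAt.comp p hf.hasMFDerivAt)

theorem modelDeriv_congr {f g : Z → Z'} {p : Z} (h : f =ᶠ[𝓝 p] g) :
    modelDeriv 𝕜 E E' f p = modelDeriv 𝕜 E E' g p := h.mfderiv_eq

theorem modelDeriv_id (p : Z) :
    modelDeriv 𝕜 E E (fun q : Z => q) p = ContinuousLinearMap.id 𝕜 E :=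
  modelDeriv_eq (hasMFDerivAt_id p)

theorem modelDeriv_eq_fderiv (f : E → E') (x : E) : modelDeriv 𝕜 E E' f x = fderiv 𝕜 f x :=
  mfderiv_eq_fderiv

theorem modelDeriv_left_inverse {f : Z → Z'} {g : Z' → Z} {p : Z}
    (hf : MDifferentiableAt 𝓘(𝕜, E) 𝓘(𝕜, E') f p)
    (hg : MDifferentiableAt 𝓘(𝕜, E') 𝓘(𝕜, E) g (f p)) (hgf : ∀ᶠ q in 𝓝 p, g (f q) = q) (v : E) :
    modelDeriv 𝕜 E' E g (f p) (modelDeriv 𝕜 E E' f p v) = v := by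
  rw [← ContinuousLinearMap.comp_apply, ← modelDeriv_comp hf hg, modelDeriv_congr hgf,
    modelDeriv_id, ContinuousLinearMap.id_apply]

theorem eventually_contMDiffAt [IsManifold 𝓘(𝕜, E) ω Z] [IsManifold 𝓘(𝕜, E') ω Z'] {f : Z → Z'}
    {p : Z} (hf : ContMDiffAt 𝓘(𝕜, E) 𝓘(𝕜, E') ω f p) :
    ∀ᶠ q in 𝓝 p, ContMDiffAt 𝓘(𝕜, E) 𝓘(𝕜, E') ω f q :=
  (contMDiffAt_iff_contMDiffAt_nhds (by simp)).1 hf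

theorem eventually_mdifferentiableAt [IsManifold 𝓘(𝕜, E) ω Z] [IsManifold 𝓘(𝕜, E') ω Z']
    {f : Z → Z'} {p : Z} (hf : ContMDiffAt 𝓘(𝕜, E) 𝓘(𝕜, E') ω f p) :
    ∀ᶠ q in 𝓝 p, MDifferentiableAt 𝓘(𝕜, E) 𝓘(𝕜, E') f q := by
  filter_upwards [eventually_contMDiffAt hf] with q hq using hq.mdifferentiableAt (by simp)

end ModelDeriv

section Curves

variable {E E' : Type*} [NormedAddCommGroup E] [NormedSpace ℝ E] [NormedAddCommGroup E']
  [NormedSpace ℝ E'] {Z Z' : Type*} [TopologicalSpace Z] [ChartedSpace E Z] [TopologicalSpace Z']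
  [ChartedSpace E' Z']

theorem hasMFDerivAt_curve_iff {γ : ℝ → E} {v : E} {t : ℝ} :
    HasMFDerivAt 𝓘(ℝ, ℝ) 𝓘(ℝ, E) γ t ((1 : ℝ →L[ℝ] ℝ).smulRight v) ↔ HasDerivAt γ v t := by
  have h : ContinuousLinearMap.toSpanSingleton ℝ v = (1 : ℝ →L[ℝ] ℝ).smulRight v := by
    ext
    simp
  rw [hasDerivAt_iff_hasFDerivAt, h]
  exact hasMFDerivAt_iff_hasFDerivAt

theorem hasMFDerivAt_comp_curve {f : Z → Z'} {γ : ℝ → Z} {t : ℝ} {p : Z} {v : E}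
    (hf : MDifferentiableAt 𝓘(ℝ, E) 𝓘(ℝ, E') f p) (ht : γ t = p)
    (hγ : HasMFDerivAt 𝓘(ℝ, ℝ) 𝓘(ℝ, E) γ t ((1 : ℝ →L[ℝ] ℝ).smulRight v)) :
    HasMFDerivAt 𝓘(ℝ, ℝ) 𝓘(ℝ, E') (fun s => f (γ s)) t
      ((1 : ℝ →L[ℝ] ℝ).smulRight (modelDeriv ℝ E E' f p v)) := by
  subst ht
  have hcomp : (modelDeriv ℝ E E' f (γ t)).comp ((1 : ℝ →L[ℝ] ℝ).smulRight v) =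
      (1 : ℝ →L[ℝ] ℝ).smulRight (modelDeriv ℝ E E' f (γ t) v) := by
    ext
    simp
  exact ((hasMFDerivAt_modelDeriv hf).comp t hγ).congr_mfderiv hcomp

end Curves

section RestrictScalars

variable {E : Type v} [NormedAddCommGroup E] [NormedSpace ℂ E]
  {Z : Type u} [TopologicalSpace Z] [ChartedSpace E Z]
  {E' : Type v'} [NormedAddCommGroup E'] [NormedSpace ℂ E']
  {Z' : Type u'} [TopologicalSpace Z'] [ChartedSpace E' Z'] {n : ℕ∞ω} {f : Z → Z'} {p : Z}

theorem isManifold_real [IsManifold 𝓘(ℂ, E) n Z] : IsManifold 𝓘(ℝ, E) n Z := by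
  refine isManifold_of_contDiffOn _ _ _ fun e e' he he' => ?_
  have h := mem_groupoid_of_pregroupoid.1 ((contDiffGroupoid n 𝓘(ℂ, E)).compatible he he')
  exact ContDiffOn.restrict_scalars ℝ h.1

theorem contMDiffAt_real (h : ContMDiffAt 𝓘(ℂ, E) 𝓘(ℂ, E') n f p) :
    ContMDiffAt 𝓘(ℝ, E) 𝓘(ℝ, E') n f p := by
  rw [contMDiffAt_iff] at h ⊢
  exact ⟨h.1, h.2.restrict_scalars ℝ⟩

theorem hasMFDerivAt_real {f' : E →L[ℂ] E'} (h : HasMFDerivAt 𝓘(ℂ, E) 𝓘(ℂ, E') f p f') :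
    HasMFDerivAt 𝓘(ℝ, E) 𝓘(ℝ, E') f p (f'.restrictScalars ℝ) :=
  ⟨h.1, HasFDerivWithinAt.restrictScalars ℝ h.2⟩

theorem mdifferentiableAt_real (h : MDifferentiableAt 𝓘(ℂ, E) 𝓘(ℂ, E') f p) :
    MDifferentiableAt 𝓘(ℝ, E) 𝓘(ℝ, E') f p :=
  (hasMFDerivAt_real h.hasMFDerivAt).mdifferentiableAt

theorem modelDeriv_real (h : MDifferentiableAt 𝓘(ℂ, E) 𝓘(ℂ, E') f p) :
    modelDeriv ℝ E E' f p = (modelDeriv ℂ E E' f p).restrictScalars ℝ :=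
  modelDeriv_eq (hasMFDerivAt_real h.hasMFDerivAt)

theorem modelDeriv_real_apply (h : MDifferentiableAt 𝓘(ℂ, E) 𝓘(ℂ, E') f p) (v : E) :
    modelDeriv ℝ E E' f p v = modelDeriv ℂ E E' f p v := by
  rw [modelDeriv_real h, ContinuousLinearMap.coe_restrictScalars']

end RestrictScalars

section Tangent

variable {E : Type v} [NormedAddCommGroup E] [NormedSpace ℂ E]
  {Z : Type u} [TopologicalSpace Z] [ChartedSpace E Z]
  {E' : Type v'} [NormedAddCommGroup E'] [NormedSpace ℂ E']
  {Z' : Type u'} [TopologicalSpace Z'] [ChartedSpace E' Z']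
  {P : Type*} [NormedAddCommGroup P] [NormedSpace ℝ P] {Y : Type*} [TopologicalSpace Y]
  [ChartedSpace P Y] {M : Set Z} {p : Z}

variable (E) in
/-- The tangent space `tangentAt E M p`, as a subspace of the model vector space. -/
noncomputable def modelTangent (M : Set Z) (p : Z) : Submodule ℝ E := tangentAt E M p

theorem mem_modelTangent_of_curve {γ : ℝ → Z} {v : E} (h0 : γ 0 = p)
    (hM : ∀ᶠ t in 𝓝 0, γ t ∈ M)
    (h : HasMFDerivAt 𝓘(ℝ, ℝ) 𝓘(ℝ, E) γ 0 ((1 : ℝ →L[ℝ] ℝ).smulRight v)) :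
    v ∈ modelTangent E M p :=
  Submodule.subset_span (R := ℝ) (M := E) ⟨γ, h0, hM, h⟩

theorem modelTangent_le {S : Submodule ℝ E}
    (h : ∀ (v : E) (γ : ℝ → Z), γ 0 = p → Tendsto γ (𝓝 0) (𝓝[M] p) →
      HasMFDerivAt 𝓘(ℝ, ℝ) 𝓘(ℝ, E) γ 0 ((1 : ℝ →L[ℝ] ℝ).smulRight v) → v ∈ S) :
    modelTangent E M p ≤ S := by
  refine Submodule.span_le.2 ?_
  rintro v ⟨γ, h0, hM, hγ⟩
  exact h v γ h0 (tendsto_nhdsWithin_iff.2 ⟨h0 ▸ hγ.continuousAt, hM⟩) hγ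

theorem modelDeriv_congr_of_mem_modelTangent {f g : Z → Y}
    (hf : MDifferentiableAt 𝓘(ℝ, E) 𝓘(ℝ, P) f p) (hg : MDifferentiableAt 𝓘(ℝ, E) 𝓘(ℝ, P) g p)
    (hfg : ∀ᶠ q in 𝓝[M] p, f q = g q) {v : E} (hv : v ∈ modelTangent E M p) :
    modelDeriv ℝ E P f p v = modelDeriv ℝ E P g p v := by
  suffices h : modelTangent E M p ≤
      LinearMap.ker ((modelDeriv ℝ E P f p - modelDeriv ℝ E P g p : E →L[ℝ] P) : E →ₗ[ℝ] P) from
    sub_eq_zero.1 (h hv)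
  refine modelTangent_le fun w γ hγ0 hγM hγ => sub_eq_zero.2 ?_
  have hfγ := hasMFDerivAt_comp_curve hf hγ0 hγ
  have hgγ := hasMFDerivAt_comp_curve hg hγ0 hγ
  have heq := hasMFDerivAt_unique (hgγ.congr_of_eventuallyEq (hγM.eventually hfg)) hfγ
  have h1 : (1 : ℝ) • modelDeriv ℝ E P f p w = (1 : ℝ) • modelDeriv ℝ E P g p w :=
    congrArg (fun l : ℝ →L[ℝ] P => l 1) heq.symm
  rwa [one_smul, one_smul] at h1

theorem modelDeriv_mem_modelTangent {N : Set Z'} {f : Z → Z'}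
    (hf : MDifferentiableAt 𝓘(ℝ, E) 𝓘(ℝ, E') f p)
    (hfN : ∀ᶠ q in 𝓝[M] p, f q ∈ N) {v : E} (hv : v ∈ modelTangent E M p) :
    modelDeriv ℝ E E' f p v ∈ modelTangent E' N (f p) := by
  suffices h : modelTangent E M p ≤
      (modelTangent E' N (f p)).comap (modelDeriv ℝ E E' f p : E →ₗ[ℝ] E') from h hv
  exact modelTangent_le fun w γ hγ0 hγM hγ => mem_modelTangent_of_curve (congrArg f hγ0)
    (hγM.eventually hfN) (hasMFDerivAt_comp_curve hf hγ0 hγ)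

theorem span_modelTangent_eq_top_of_surjective {N : Set Z'} {f : Z → Z'}
    (hf : MDifferentiableAt 𝓘(ℂ, E) 𝓘(ℂ, E') f p)
    (hsurj : Function.Surjective (modelDeriv ℂ E E' f p)) (hfN : ∀ᶠ q in 𝓝[M] p, f q ∈ N)
    (hspan : Submodule.span ℂ (modelTangent E M p : Set E) = ⊤) :
    Submodule.span ℂ (modelTangent E' N (f p) : Set E') = ⊤ := by
  have hle : Submodule.span ℂ (modelTangent E M p : Set E) ≤
      (Submodule.span ℂ (modelTangent E' N (f p) : Set E')).comap
        (modelDeriv ℂ E E' f p : E →ₗ[ℂ] E') := by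
    refine Submodule.span_le.2 fun v hv => Submodule.subset_span ?_
    have := modelDeriv_mem_modelTangent (mdifferentiableAt_real hf) hfN hv
    rwa [modelDeriv_real_apply hf] at this
  refine eq_top_iff.2 fun e _ => ?_
  obtain ⟨v, rfl⟩ := hsurj e
  exact hle (hspan ▸ Submodule.mem_top)

theorem modelDeriv_left_inverse_of_mem_modelTangent {f : Z → Y} {g : Y → Z}
    (hf : MDifferentiableAt 𝓘(ℝ, E) 𝓘(ℝ, P) f p)
    (hg : MDifferentiableAt 𝓘(ℝ, P) 𝓘(ℝ, E) g (f p))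
    (hgf : ∀ᶠ q in 𝓝[M] p, g (f q) = q) {v : E} (hv : v ∈ modelTangent E M p) :
    modelDeriv ℝ P E g (f p) (modelDeriv ℝ E P f p v) = v := by
  rw [← ContinuousLinearMap.comp_apply, ← modelDeriv_comp hf hg,
    modelDeriv_congr_of_mem_modelTangent (f := fun q => g (f q)) (g := fun q => q)
      (hg.comp p hf) mdifferentiableAt_id hgf hv, modelDeriv_id, ContinuousLinearMap.id_apply]

theorem modelDeriv_param_mem_modelTangent {σ : P → Z} {x : P}
    (hσ : MDifferentiableAt 𝓘(ℝ, P) 𝓘(ℝ, E) σ x)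
    (hM : ∀ᶠ y in 𝓝 x, σ y ∈ M) (u : P) : modelDeriv ℝ P E σ x u ∈ modelTangent E M (σ x) := by
  have hx : x + (0 : ℝ) • u = x := by simp
  have hline : HasDerivAt (fun t : ℝ => x + t • u) u 0 := by
    simpa using ((hasDerivAt_id (0 : ℝ)).smul_const u).const_add x
  have hlim : Tendsto (fun t : ℝ => x + t • u) (𝓝 0) (𝓝 x) := by
    simpa using hline.continuousAt.tendsto
  exact mem_modelTangent_of_curve (congrArg σ hx) (hlim.eventually hM)
    (hasMFDerivAt_comp_curve hσ hx (hasMFDerivAt_curve_iff.2 hline))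

end Tangent

/-! ### Complexification and the identity principle -/

theorem radius_pos_of_norm_le_mul_pow {𝕜 E G : Type*} [NontriviallyNormedField 𝕜]
    [NormedAddCommGroup E] [NormedSpace 𝕜 E] [NormedAddCommGroup G] [NormedSpace 𝕜 G]
    {q : FormalMultilinearSeries 𝕜 E G} {C r : ℝ} (hr : 0 < r) (hq : ∀ n, ‖q n‖ ≤ C * r ^ n) :
    0 < q.radius := by
  lift r to NNReal using hr.le
  have hr' : (0 : NNReal) < r⁻¹ := inv_pos.2 (by exact_mod_cast hr)
  refine lt_of_lt_of_le (by exact_mod_cast hr') (q.le_radius_of_bound (r := r⁻¹) C fun n => ?_)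
  calc ‖q n‖ * ((r⁻¹ : NNReal) : ℝ) ^ n ≤ C * (r : ℝ) ^ n * ((r⁻¹ : NNReal) : ℝ) ^ n := by
        gcongr
        exact hq n
    _ = C := by
        rw [NNReal.coe_inv, inv_pow, mul_assoc, mul_inv_cancel₀ (pow_ne_zero n hr.ne'), mul_one]

section Complexification

variable {m : ℕ} {G : Type*} [NormedAddCommGroup G] [NormedSpace ℂ G]

/-- The inclusion `ℝᵐ → ℂᵐ`. -/
noncomputable def ofRealPi (m : ℕ) : (Fin m → ℝ) →L[ℝ] (Fin m → ℂ) :=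
  ContinuousLinearMap.pi fun i => Complex.ofRealCLM.comp (ContinuousLinearMap.proj i)

@[simp] theorem ofRealPi_apply (x : Fin m → ℝ) (i : Fin m) : ofRealPi m x i = (x i : ℂ) := rfl

theorem exists_ofRealPi_add (z : Fin m → ℂ) :
    ∃ x y, z = ofRealPi m x + Complex.I • ofRealPi m y :=
  ⟨fun i => (z i).re, fun i => (z i).im, by
    ext i; simp [mul_comm Complex.I, Complex.re_add_im]⟩

/-- The `ℂ`-multilinear extension to `ℂᵐ` of a real multilinear map on `ℝᵐ`, given by its values on
the standard basis. -/
noncomputable def complexifyMultilinear {n : ℕ}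
    (p : ContinuousMultilinearMap ℝ (fun _ : Fin n => Fin m → ℝ) G) :
    ContinuousMultilinearMap ℂ (fun _ : Fin n => Fin m → ℂ) G :=
  ∑ s : Fin n → Fin m, ((ContinuousMultilinearMap.mkPiAlgebra ℂ (Fin n) ℂ).compContinuousLinearMap
    fun k => ContinuousLinearMap.proj (s k)).smulRight (p fun k => Pi.single (s k) 1)

theorem complexifyMultilinear_apply {n : ℕ}
    (p : ContinuousMultilinearMap ℝ (fun _ : Fin n => Fin m → ℝ) G) (z : Fin n → Fin m → ℂ) :
    complexifyMultilinear p z =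
      ∑ s : Fin n → Fin m, (∏ k, z k (s k)) • p fun k => Pi.single (s k) 1 := by
  simp [complexifyMultilinear, _root_.sum_apply]

theorem complexifyMultilinear_ofRealPi {n : ℕ}
    (p : ContinuousMultilinearMap ℝ (fun _ : Fin n => Fin m → ℝ) G) (x : Fin n → Fin m → ℝ) :
    (complexifyMultilinear p fun k => ofRealPi m (x k)) = p x := by
  have hx : x = fun k => ∑ i, x k i • (Pi.single i 1 : Fin m → ℝ) := by
    ext k j
    simp [Finset.sum_apply, Pi.single_apply]
  conv_rhs => rw [hx, ContinuousMultilinearMap.map_sum]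
  rw [complexifyMultilinear_apply]
  refine Finset.sum_congr rfl fun s _ => ?_
  rw [ContinuousMultilinearMap.map_smul_univ]
  simp only [ofRealPi_apply, ← Complex.ofReal_prod, Complex.coe_smul]

theorem norm_complexifyMultilinear_le {n : ℕ}
    (p : ContinuousMultilinearMap ℝ (fun _ : Fin n => Fin m → ℝ) G) :
    ‖complexifyMultilinear p‖ ≤ (m : ℝ) ^ n * ‖p‖ := by
  refine ContinuousMultilinearMap.opNorm_le_bound (by positivity) fun z => ?_
  rw [complexifyMultilinear_apply]
  have hterm : ∀ s ∈ (Finset.univ : Finset (Fin n → Fin m)),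
      ‖(∏ k, z k (s k)) • p fun k => Pi.single (s k) 1‖ ≤ ‖p‖ * ∏ k, ‖z k‖ := fun s _ => by
    rw [norm_smul, mul_comm, norm_prod]
    gcongr
    · exact p.unit_le_opNorm <| (pi_norm_le_iff_of_nonneg zero_le_one).2 fun k => by
        rw [Pi.norm_single, norm_one]
    · exact norm_le_pi_norm _ _
  refine (norm_sum_le_of_le _ hterm).trans_eq ?_
  simp [mul_assoc]

theorem exists_complexification [CompleteSpace G] {h : (Fin m → ℝ) → G} (hh : ContDiffAt ℝ ω h 0) :
    ∃ H : (Fin m → ℂ) → G, ContDiffAt ℂ ω H 0 ∧ ∀ᶠ x in 𝓝 0, H (ofRealPi m x) = h x := by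
  obtain ⟨p, r, hp⟩ := hh.analyticAt
  let q : FormalMultilinearSeries ℂ (Fin m → ℂ) G := fun n => complexifyMultilinear (p n)
  have hrad : 0 < q.radius := by
    obtain ⟨C, ρ, -, hρ, hpn⟩ := p.le_mul_pow_of_radius_pos (hp.r_pos.trans_le hp.r_le)
    refine radius_pos_of_norm_le_mul_pow (C := C) (r := (m + 1) * ρ) (by positivity) fun n => ?_
    calc ‖q n‖ ≤ (m : ℝ) ^ n * ‖p n‖ := norm_complexifyMultilinear_le (p n)
      _ ≤ (m + 1 : ℝ) ^ n * (C * ρ ^ n) := by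
          gcongr
          · linarith
          · exact hpn n
      _ = C * ((m + 1) * ρ) ^ n := by rw [mul_pow]; ring
  refine ⟨q.sum, (q.hasFPowerSeriesOnBall hrad).analyticAt.contDiffAt, ?_⟩
  filter_upwards [Metric.eball_mem_nhds (0 : Fin m → ℝ) hp.r_pos] with x hx
  have hsum := hp.hasSum hx
  simp_rw [zero_add, ← complexifyMultilinear_ofRealPi] at hsum
  exact hsum.tsum_eq

theorem tendsto_ofRealPi_zero : Tendsto (ofRealPi m) (𝓝 0) (𝓝 0) := by
  simpa using (ofRealPi m).continuous.tendsto 0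

theorem fderiv_comp_ofRealPi {h : (Fin m → ℝ) → G} {H : (Fin m → ℂ) → G} {x : Fin m → ℝ}
    (hH : DifferentiableAt ℂ H (ofRealPi m x)) (hh : ∀ᶠ y in 𝓝 x, H (ofRealPi m y) = h y)
    (u : Fin m → ℝ) : fderiv ℝ h x u = fderiv ℂ H (ofRealPi m x) (ofRealPi m u) := by
  have hcomp := (hH.hasFDerivAt.restrictScalars ℝ).comp x (ofRealPi m).hasFDerivAt
  rw [(hcomp.congr_of_eventuallyEq (EventuallyEq.symm hh)).fderiv]
  rfl

end Complexification

section IdentityPrinciple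

variable {E G : Type*} [NormedAddCommGroup E] [NormedSpace ℂ E] [NormedAddCommGroup G]
  [NormedSpace ℂ G]

theorem fderiv_eq_zero_of_span_modelTangent {S : Set E} {p : E} {U : E → G}
    (hS : Submodule.span ℂ (modelTangent E S p : Set E) = ⊤) (hU : DifferentiableAt ℂ U p)
    (h0 : ∀ᶠ x in 𝓝[S] p, U x = 0) : fderiv ℂ U p = 0 := by
  have hUr : MDifferentiableAt 𝓘(ℝ, E) 𝓘(ℝ, G) U p :=
    (hU.restrictScalars ℝ).mdifferentiableAt
  refine ContinuousLinearMap.coe_injective (LinearMap.ext_on hS fun v hv => ?_)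
  have hv0 := modelDeriv_congr_of_mem_modelTangent (P := G) hUr
    (mdifferentiableAt_const (c := (0 : G))) h0 hv
  rw [modelDeriv_eq_fderiv, modelDeriv_eq_fderiv, hU.fderiv_restrictScalars ℝ] at hv0
  simpa using hv0

theorem eventually_eq_zero_of_span_modelTangent [CompleteSpace E] [CompleteSpace G] {S : Set E}
    {a : E} {U : E → G} (ha : a ∈ S)
    (hS : ∀ᶠ p in 𝓝[S] a, Submodule.span ℂ (modelTangent E S p : Set E) = ⊤)
    (hU : ContDiffAt ℂ ω U a) (h0 : ∀ᶠ x in 𝓝[S] a, U x = 0) : ∀ᶠ x in 𝓝 a, U x = 0 := by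
  have han : ∀ᶠ p in 𝓝[S] a, ContDiffAt ℂ ω U p :=
    (hU.eventually (by simp)).filter_mono nhdsWithin_le_nhds
  have hderiv : ∀ n, ∀ᶠ x in 𝓝[S] a, iteratedFDeriv ℂ n U x = 0 := by
    intro n
    induction n with
    | zero =>
      filter_upwards [h0] with x hx
      ext v
      simp [hx]
    | succ n ih =>
      filter_upwards [eventually_eventually_nhdsWithin.2 ih, hS, han] with p hp hSp hUp
      have hdiff : DifferentiableAt ℂ (iteratedFDeriv ℂ n U) p :=
        hUp.differentiableAt_iteratedFDeriv (WithTop.coe_lt_top _)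
      ext v
      rw [iteratedFDeriv_succ_apply_left, fderiv_eq_zero_of_span_modelTangent hSp hdiff hp]
      simp
  obtain ⟨p, r, hp⟩ := hU.analyticAt
  filter_upwards [Metric.eball_mem_nhds a hp.r_pos] with x hx
  have hsum := hp.hasSum_iteratedFDeriv (y := x - a) (by
    simpa [Metric.mem_eball, edist_eq_enorm_sub] using hx)
  simp only [(hderiv _).self_of_nhdsWithin ha, add_sub_cancel] at hsum
  exact hsum.unique (by simp)

theorem span_modelTangent_range_ofRealPi {m : ℕ} (x : Fin m → ℝ) :
    Submodule.span ℂ (modelTangent (Fin m → ℂ) (range (ofRealPi m)) (ofRealPi m x) :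
      Set (Fin m → ℂ)) = ⊤ := by
  have hmem : ∀ y, ofRealPi m y ∈ Submodule.span ℂ (modelTangent (Fin m → ℂ) (range (ofRealPi m))
      (ofRealPi m x) : Set (Fin m → ℂ)) := fun y => Submodule.subset_span <| by
    have hy := modelDeriv_param_mem_modelTangent (x := x)
      (ofRealPi m).differentiableAt.mdifferentiableAt
      (Eventually.of_forall fun y => mem_range_self y) y
    rwa [modelDeriv_eq_fderiv, (ofRealPi m).fderiv] at hy
  refine eq_top_iff.2 fun z _ => ?_
  obtain ⟨x', y', rfl⟩ := exists_ofRealPi_add z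
  exact add_mem (hmem _) (Submodule.smul_mem _ _ (hmem _))

theorem eventually_eq_zero_of_real [CompleteSpace G] {m : ℕ} {U : (Fin m → ℂ) → G}
    (hU : ContDiffAt ℂ ω U 0) (h0 : ∀ᶠ x in 𝓝 0, U (ofRealPi m x) = 0) : ∀ᶠ z in 𝓝 0, U z = 0 := by
  have hre : Tendsto (fun (z : Fin m → ℂ) i => (z i).re) (𝓝 0) (𝓝 0) :=
    Continuous.tendsto' (by fun_prop) _ _ rfl
  refine eventually_eq_zero_of_span_modelTangent (S := range (ofRealPi m)) ⟨0, map_zero _⟩ ?_ hU ?_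
  · refine eventually_nhdsWithin_of_forall ?_
    rintro _ ⟨x, rfl⟩
    exact span_modelTangent_range_ofRealPi x
  · filter_upwards [(hre.eventually h0).filter_mono nhdsWithin_le_nhds, self_mem_nhdsWithin]
    rintro _ hz ⟨x, rfl⟩
    exact hz

end IdentityPrinciple

/-! ### Factorization through a submersion -/

section Submersion

variable {𝕜 : Type*} [RCLike 𝕜] {W E G : Type*} [NormedAddCommGroup W] [NormedSpace 𝕜 W]
  [FiniteDimensional 𝕜 W] [NormedAddCommGroup E] [NormedSpace 𝕜 E] [FiniteDimensional 𝕜 E]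
  [NormedAddCommGroup G] [NormedSpace 𝕜 G] {S : W → E} {H : W → G} {w₀ : W}

theorem exists_fiber_coordinate (hS : ContDiffAt 𝕜 ω S w₀) (hsurj : (fderiv 𝕜 S w₀).range = ⊤) :
    ∃ (c : W → (fderiv 𝕜 S w₀).ker) (g : E × (fderiv 𝕜 S w₀).ker → W), c w₀ = 0 ∧
      ContDiffAt 𝕜 ω c w₀ ∧ ContDiffAt 𝕜 ω g (S w₀, 0) ∧
      (∀ᶠ w in 𝓝 w₀, g (S w, c w) = w) ∧ ∀ᶠ y in 𝓝 (S w₀, 0), S (g y) = y.1 := by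
  have : CompleteSpace W := FiniteDimensional.complete 𝕜 W
  have : CompleteSpace E := FiniteDimensional.complete 𝕜 E
  have hcompl : (fderiv 𝕜 S w₀).ker.ClosedComplemented :=
    .of_finiteDimensional_quotient (Submodule.closed_of_finiteDimensional _)
  let φ := (hS.hasStrictFDerivAt (by simp)).implicitFunctionDataOfComplemented S _ hsurj hcompl
  have hc0 : φ.rightFun w₀ = 0 := by
    change hcompl.choose (w₀ - w₀) = 0
    rw [sub_self, map_zero]
  have hc : ContDiffAt 𝕜 ω φ.rightFun w₀ :=
    (ContinuousLinearMap.contDiff _).contDiffAt.comp w₀ (contDiffAt_id.sub contDiffAt_const)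
  have hpt : φ.prodFun w₀ = (S w₀, 0) := Prod.ext rfl hc0
  refine ⟨φ.rightFun, φ.implicitFunction.uncurry, hc0, hc, ?_, ?_, ?_⟩
  · rw [← hpt]
    exact φ.contDiffAt_implicitFunction hS hc (by simp)
  · exact φ.implicitFunction_apply_image
  · rw [← hpt]
    exact φ.leftFun_implicitFunction

theorem exists_contDiffAt_range_eq_ker (hS : ContDiffAt 𝕜 ω S w₀)
    (hsurj : (fderiv 𝕜 S w₀).range = ⊤) :
    ∃ N : W → (fderiv 𝕜 S w₀).ker →L[𝕜] W, ContDiffAt 𝕜 ω N w₀ ∧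
      ∀ᶠ w in 𝓝 w₀, (N w).range = (fderiv 𝕜 S w).ker := by
  obtain ⟨c, g, hc0, hc, hg, hgS, hSg⟩ := exists_fiber_coordinate hS hsurj
  have hΦ : ContDiffAt 𝕜 ω (fun w => (S w, c w)) w₀ := hS.prodMk hc
  have hΦlim : Tendsto (fun w => (S w, c w)) (𝓝 w₀) (𝓝 (S w₀, 0)) := by
    simpa only [hc0] using hΦ.continuousAt.tendsto
  rw [← hc0] at hg
  refine ⟨fun w => (fderiv 𝕜 g (S w, c w)).comp (.inr 𝕜 E _),
    (ContDiffAt.comp w₀ (hg.fderiv_right (m := ω) le_top) hΦ).clm_comp contDiffAt_const, ?_⟩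
  rw [hc0] at hg
  filter_upwards [hΦlim.eventually (hg.eventually (by simp)), hS.eventually (by simp),
    hc.eventually (by simp), hgS.eventually_nhds, hΦlim.eventually hSg.eventually_nhds]
    with w hgw hSw hcw hgSw hSgw
  have hg' := (hgw.differentiableAt (by simp)).hasFDerivAt
  have hS' := (hSw.differentiableAt (by simp)).hasFDerivAt
  have hc' := (hcw.differentiableAt (by simp)).hasFDerivAt
  have hid := (hg'.comp w (hS'.prodMk hc')).unique
    ((hasFDerivAt_id w).congr_of_eventuallyEq hgSw)
  have hfst := (HasFDerivAt.comp (S w, c w) (hgSw.self_of_nhds.symm ▸ hS') hg').unique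
    (hasFDerivAt_fst.congr_of_eventuallyEq hSgw)
  ext v
  constructor
  · rintro ⟨q, rfl⟩
    simpa [hgSw.self_of_nhds] using congrArg (fun l : E × _ →L[𝕜] E => l (0, q)) hfst
  · intro hv
    have hv' := congrArg (fun l : W →L[𝕜] W => l v) hid
    refine ⟨fderiv 𝕜 c w v, ?_⟩
    simpa [show fderiv 𝕜 S w v = 0 from hv] using hv'

theorem eventually_eq_fst_of_fderiv_comp_inr_eq_zero {E₁ E₂ : Type*} [NormedAddCommGroup E₁]
    [NormedSpace 𝕜 E₁] [NormedAddCommGroup E₂] [NormedSpace 𝕜 E₂] {k : E₁ × E₂ → G} {e : E₁}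
    {q : E₂}
    (hk : ∀ᶠ y in 𝓝 (e, q), DifferentiableAt 𝕜 k y ∧ (fderiv 𝕜 k y).comp (.inr 𝕜 E₁ E₂) = 0) :
    ∀ᶠ y in 𝓝 (e, q), k y = k (y.1, q) := by
  let : NormedSpace ℝ E₂ := NormedSpace.restrictScalars ℝ 𝕜 E₂
  obtain ⟨ρ, hρ, hball⟩ := Metric.eventually_nhds_iff_ball.1 hk
  simp only [← ball_prod_same] at hball
  filter_upwards [Metric.ball_mem_nhds (e, q) hρ]
  rintro ⟨e', q'⟩ h
  rw [← ball_prod_same] at h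
  have hderiv : ∀ x ∈ Metric.ball q ρ, HasFDerivAt (fun x => k (e', x)) (0 : E₂ →L[𝕜] G) x := by
    intro x hx
    obtain ⟨hdiff, hzero⟩ := hball (e', x) ⟨h.1, hx⟩
    rw [← hzero]
    exact hdiff.hasFDerivAt.comp x (hasFDerivAt_prodMk_right e' x)
  exact (convex_ball q ρ).is_const_of_fderivWithin_eq_zero (𝕜 := 𝕜)
    (fun x hx => (hderiv x hx).differentiableAt.differentiableWithinAt)
    (fun x hx => by rw [fderivWithin_of_isOpen Metric.isOpen_ball hx, (hderiv x hx).fderiv])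
    h.2 (Metric.mem_ball_self hρ)

theorem exists_factorization_of_ker_le (hS : ContDiffAt 𝕜 ω S w₀)
    (hsurj : (fderiv 𝕜 S w₀).range = ⊤) (hH : ContDiffAt 𝕜 ω H w₀)
    (hker : ∀ᶠ w in 𝓝 w₀, (fderiv 𝕜 S w).ker ≤ (fderiv 𝕜 H w).ker) :
    ∃ F : E → G, ContDiffAt 𝕜 ω F (S w₀) ∧ ∀ᶠ w in 𝓝 w₀, F (S w) = H w := by
  obtain ⟨c, g, hc0, hc, hg, hgS, hSg⟩ := exists_fiber_coordinate hS hsurj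
  have hg0 : g (S w₀, 0) = w₀ := by simpa only [hc0] using hgS.self_of_nhds
  have hglim : Tendsto g (𝓝 (S w₀, 0)) (𝓝 w₀) := by
    simpa only [hg0] using hg.continuousAt.tendsto
  have hk : ∀ᶠ y in 𝓝 (S w₀, 0), DifferentiableAt 𝕜 (fun y => H (g y)) y ∧
      (fderiv 𝕜 (fun y => H (g y)) y).comp (.inr 𝕜 E _) = 0 := by
    filter_upwards [hg.eventually (by simp), hglim.eventually (hS.eventually (by simp)),
      hglim.eventually (hH.eventually (by simp)), hglim.eventually hker, hSg.eventually_nhds]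
      with y hgy hSy hHy hkery hSgy
    have hg' := (hgy.differentiableAt (by simp)).hasFDerivAt
    have hH' : HasFDerivAt (fun y => H (g y)) _ y :=
      (hHy.differentiableAt (by simp)).hasFDerivAt.comp y hg'
    have hfst := ((hSy.differentiableAt (by simp)).hasFDerivAt.comp y hg').unique
      (hasFDerivAt_fst.congr_of_eventuallyEq hSgy)
    refine ⟨hH'.differentiableAt, ContinuousLinearMap.ext fun q => ?_⟩
    have hq : fderiv 𝕜 g y (0, q) ∈ (fderiv 𝕜 S (g y)).ker := by
      simpa using congrArg (fun l : E × _ →L[𝕜] E => l (0, q)) hfst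
    rw [hH'.fderiv]
    exact hkery hq
  refine ⟨fun e => H (g (e, 0)), ?_, ?_⟩
  · rw [← hg0] at hH
    exact ContDiffAt.comp (g := fun y => H (g y)) (S w₀) (ContDiffAt.comp (S w₀, 0) hH hg)
      (contDiffAt_id.prodMk contDiffAt_const)
  · have hΦlim : Tendsto (fun w => (S w, c w)) (𝓝 w₀) (𝓝 (S w₀, 0)) := by
      simpa only [hc0] using (hS.prodMk hc).continuousAt.tendsto
    filter_upwards [hgS, hΦlim.eventually (eventually_eq_fst_of_fderiv_comp_inr_eq_zero hk)]
      with w hw hkw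
    rw [← hkw, hw]

end Submersion

/-! ### Holomorphic extension of real-analytic CR maps -/

section Extension

variable {m : ℕ} {E G : Type*} [NormedAddCommGroup E] [NormedSpace ℂ E] [FiniteDimensional ℂ E]
  [NormedAddCommGroup G] [NormedSpace ℂ G] [CompleteSpace G]

theorem eventually_ker_le_of_real {S : (Fin m → ℂ) → E} {H : (Fin m → ℂ) → G}
    (hS : ContDiffAt ℂ ω S 0) (hsurj : (fderiv ℂ S 0).range = ⊤) (hH : ContDiffAt ℂ ω H 0)
    (hker : ∀ᶠ x in 𝓝 0,
      (fderiv ℂ S (ofRealPi m x)).ker ≤ (fderiv ℂ H (ofRealPi m x)).ker) :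
    ∀ᶠ w in 𝓝 0, (fderiv ℂ S w).ker ≤ (fderiv ℂ H w).ker := by
  obtain ⟨N, hN, hNker⟩ := exists_contDiffAt_range_eq_ker hS hsurj
  have hzero := eventually_eq_zero_of_real
    (U := fun w => (fderiv ℂ H w).comp (N w)) ((hH.fderiv_right (m := ω) le_top).clm_comp hN) (by
      filter_upwards [hker, tendsto_ofRealPi_zero.eventually hNker] with x hx hNx
      exact ContinuousLinearMap.ext fun q => hx (hNx ▸ LinearMap.mem_range_self _ q))
  filter_upwards [hzero, hNker] with w hw hNw
  rw [← hNw]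
  rintro _ ⟨q, rfl⟩
  exact congrArg (fun l : _ →L[ℂ] G => l q) hw

theorem exists_holomorphic_extension {σ : (Fin m → ℝ) → E} {h : (Fin m → ℝ) → G}
    (hσ : ContDiffAt ℝ ω σ 0) (hh : ContDiffAt ℝ ω h 0)
    (hspan : Submodule.span ℂ (range (fderiv ℝ σ 0)) = ⊤)
    (hcr : ∀ᶠ x in 𝓝 0, ∀ u v, fderiv ℝ σ x u + Complex.I • fderiv ℝ σ x v = 0 →
      fderiv ℝ h x u + Complex.I • fderiv ℝ h x v = 0) :
    ∃ F : E → G, ContDiffAt ℂ ω F (σ 0) ∧ ∀ᶠ x in 𝓝 0, F (σ x) = h x := by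
  have : CompleteSpace E := FiniteDimensional.complete ℂ E
  obtain ⟨S, hS, hSσ⟩ := exists_complexification hσ
  obtain ⟨H, hH, hHh⟩ := exists_complexification hh
  have hS0 : S 0 = σ 0 := by simpa using hSσ.self_of_nhds
  have hsurj : (fderiv ℂ S 0).range = ⊤ := by
    rw [eq_top_iff, ← hspan, Submodule.span_le]
    rintro _ ⟨u, rfl⟩
    have hS0' : DifferentiableAt ℂ S (ofRealPi m 0) := by
      simpa using hS.differentiableAt (by simp)
    rw [fderiv_comp_ofRealPi hS0' hSσ, map_zero]
    exact ⟨_, rfl⟩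
  have hker : ∀ᶠ x in 𝓝 0,
      (fderiv ℂ S (ofRealPi m x)).ker ≤ (fderiv ℂ H (ofRealPi m x)).ker := by
    filter_upwards [tendsto_ofRealPi_zero.eventually (hS.eventually (by simp)),
      tendsto_ofRealPi_zero.eventually (hH.eventually (by simp)), hSσ.eventually_nhds,
      hHh.eventually_nhds, hcr] with x hSx hHx hSσx hHhx hcrx z hz
    obtain ⟨u, v, rfl⟩ := exists_ofRealPi_add z
    rw [LinearMap.mem_ker, ContinuousLinearMap.coe_coe, map_add, map_smul] at hz ⊢
    rw [← fderiv_comp_ofRealPi (hSx.differentiableAt (by simp)) hSσx,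
      ← fderiv_comp_ofRealPi (hSx.differentiableAt (by simp)) hSσx] at hz
    rw [← fderiv_comp_ofRealPi (hHx.differentiableAt (by simp)) hHhx,
      ← fderiv_comp_ofRealPi (hHx.differentiableAt (by simp)) hHhx]
    exact hcrx u v hz
  obtain ⟨F, hF, hFS⟩ :=
    exists_factorization_of_ker_le hS hsurj hH (eventually_ker_le_of_real hS hsurj hH hker)
  refine ⟨F, hS0 ▸ hF, ?_⟩
  filter_upwards [tendsto_ofRealPi_zero.eventually hFS, hSσ, hHh] with x hx hSx hHx
  rw [← hSx, hx, hHx]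

end Extension

/-! ### Local parametrizations of submanifolds -/

/-- `σ` parametrizes `S` near `a` with left inverse `c`, both real-analytic. -/
structure IsParam (W : Type*) [NormedAddCommGroup W] [NormedSpace ℝ W] {X : Type*}
    [TopologicalSpace X] [ChartedSpace W X] (S : Set X) (a : X) {P : Type*}
    [NormedAddCommGroup P] [NormedSpace ℝ P] (σ : P → X) (c : X → P) : Prop where
  smooth : ContMDiffAt 𝓘(ℝ, P) 𝓘(ℝ, W) ω σ 0
  map_zero : σ 0 = a
  mem : ∀ᶠ x in 𝓝 0, σ x ∈ S
  smooth_inv : ContMDiffAt 𝓘(ℝ, W) 𝓘(ℝ, P) ω c a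
  inv_base : c a = 0
  right_inv : ∀ᶠ p in 𝓝[S] a, σ (c p) = p
  left_inv : ∀ᶠ x in 𝓝 0, c (σ x) = x

section Param

variable {W : Type*} [NormedAddCommGroup W] [NormedSpace ℝ W] {X : Type*}
    [TopologicalSpace X] [ChartedSpace W X] {S : Set X} {a : X}

theorem IsAnalyticSubmanifold.exists_isParam [FiniteDimensional ℝ W] [IsManifold 𝓘(ℝ, W) ω X]
    (hS : IsAnalyticSubmanifold W S) (ha : a ∈ S) :
    ∃ (L : Submodule ℝ W) (σ : L → X) (c : X → L), IsParam W S a σ c := by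
  have : CompleteSpace W := FiniteDimensional.complete ℝ W
  obtain ⟨Φ, hΦ, haΦ, L, hL⟩ := hS a ha
  obtain ⟨π, hπ⟩ := Submodule.ClosedComplemented.of_finiteDimensional_quotient (𝕜 := ℝ)
    (p := L) (Submodule.closed_of_finiteDimensional _)
  have haL : Φ a ∈ L := (hL a haΦ).1 ha
  have hi : ContDiff ℝ ω (fun l : L => Φ a + l) :=
    contDiff_const.add L.subtypeL.contDiff
  have hi0 : Φ a + ((0 : L) : W) = Φ a := by simp
  have ht : ∀ᶠ l : L in 𝓝 0, Φ a + l ∈ Φ.target := by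
    have : Φ.target ∈ 𝓝 (Φ a + ((0 : L) : W)) := by
      rw [hi0]; exact Φ.open_target.mem_nhds (Φ.map_source haΦ)
    exact hi.continuous.continuousAt.eventually this
  have hs : ∀ᶠ p in 𝓝 a, p ∈ Φ.source := Φ.open_source.mem_nhds haΦ
  refine ⟨L, fun l => Φ.symm (Φ a + l), fun p => π (Φ p - Φ a), ?_, ?_, ?_, ?_, ?_, ?_, ?_⟩
  · refine ContMDiffAt.comp (0 : L) (I' := 𝓘(ℝ, W)) ?_ hi.contMDiff.contMDiffAt
    rw [hi0]
    exact contMDiffAt_symm_of_mem_maximalAtlas hΦ (Φ.map_source haΦ)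
  · simp [haΦ]
  · filter_upwards [ht] with l hl
    rw [hL _ (Φ.map_target hl), Φ.right_inv hl]
    exact add_mem haL l.2
  · have h1 : ContDiff ℝ ω fun y : W => π (y - Φ a) :=
      π.contDiff.comp (contDiff_id.sub contDiff_const)
    exact ContMDiffAt.comp (g := fun y : W => π (y - Φ a)) a (I' := 𝓘(ℝ, W))
      h1.contMDiff.contMDiffAt (contMDiffAt_of_mem_maximalAtlas hΦ haΦ)
  · simp
  · filter_upwards [hs.filter_mono nhdsWithin_le_nhds, self_mem_nhdsWithin] with p hp hpS
    have h1 : Φ p - Φ a ∈ L := sub_mem ((hL p hp).1 hpS) haL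
    have h2 : ((π (Φ p - Φ a) : L) : W) = Φ p - Φ a := congrArg Subtype.val (hπ ⟨_, h1⟩)
    rw [h2, add_sub_cancel, Φ.left_inv hp]
  · filter_upwards [ht] with l hl
    rw [Φ.right_inv hl, add_sub_cancel_left, hπ]

variable {P P' : Type*} [NormedAddCommGroup P] [NormedSpace ℝ P] [NormedAddCommGroup P']
  [NormedSpace ℝ P'] {σ : P → X} {c : X → P}

theorem IsParam.reparam (h : IsParam W S a σ c) (e : P' ≃L[ℝ] P) :
    IsParam W S a (fun x => σ (e x)) (fun p => e.symm (c p)) where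
  smooth := by
    refine ContMDiffAt.comp (0 : P') (I' := 𝓘(ℝ, P)) ?_ e.contDiff.contMDiff.contMDiffAt
    rw [_root_.map_zero]; exact h.smooth
  map_zero := by rw [_root_.map_zero, h.map_zero]
  mem := by
    have : Tendsto e (𝓝 0) (𝓝 0) := by simpa using e.continuous.tendsto 0
    exact this.eventually h.mem
  smooth_inv := ContMDiffAt.comp a (I' := 𝓘(ℝ, P)) e.symm.contDiff.contMDiff.contMDiffAt
    h.smooth_inv
  inv_base := by rw [h.inv_base, _root_.map_zero]
  right_inv := by
    filter_upwards [h.right_inv] with p hp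
    simpa using hp
  left_inv := by
    have : Tendsto e (𝓝 0) (𝓝 0) := by simpa using e.continuous.tendsto 0
    filter_upwards [this.eventually h.left_inv] with x hx
    rw [hx, e.symm_apply_apply]

theorem IsParam.exists_fin [FiniteDimensional ℝ P] (h : IsParam W S a σ c) :
    ∃ (m : ℕ) (σ : (Fin m → ℝ) → X) (c : X → (Fin m → ℝ)), IsParam W S a σ c :=
  ⟨_, _, _, h.reparam (ContinuousLinearEquiv.ofFinrankEq
    (by simp) : (Fin (Module.finrank ℝ P) → ℝ) ≃L[ℝ] P)⟩

theorem IsParam.tendsto (h : IsParam W S a σ c) : Tendsto σ (𝓝 0) (𝓝[S] a) :=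
  tendsto_nhdsWithin_iff.2 ⟨h.map_zero ▸ h.smooth.continuousAt, h.mem⟩

end Param

section Chart

variable {E : Type v} [NormedAddCommGroup E] [NormedSpace ℂ E]
  {Z : Type u} [TopologicalSpace Z] [ChartedSpace E Z] [IsManifold 𝓘(ℂ, E) ω Z]

theorem contMDiffAt_chart (a : Z) {p : Z} (hp : p ∈ (chartAt E a).source) :
    ContMDiffAt 𝓘(ℂ, E) 𝓘(ℂ, E) ω (chartAt E a) p :=
  contMDiffOn_chart.contMDiffAt ((chartAt E a).open_source.mem_nhds hp)

theorem contMDiffAt_chart_symm (a : Z) {e : E} (he : e ∈ (chartAt E a).target) :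
    ContMDiffAt 𝓘(ℂ, E) 𝓘(ℂ, E) ω (chartAt E a).symm e :=
  contMDiffOn_chart_symm.contMDiffAt ((chartAt E a).open_target.mem_nhds he)

/-- The derivative at `p` of the chart at `a`, as an isomorphism. -/
noncomputable def chartDeriv (a p : Z) (hp : p ∈ (chartAt E a).source) : E ≃L[ℂ] E :=
  ContinuousLinearEquiv.equivOfInverse (modelDeriv ℂ E E (chartAt E a) p)
    (modelDeriv ℂ E E (chartAt E a).symm (chartAt E a p))
    (modelDeriv_left_inverse ((contMDiffAt_chart a hp).mdifferentiableAt (by simp))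
      ((contMDiffAt_chart_symm a ((chartAt E a).map_source hp)).mdifferentiableAt (by simp))
      (by filter_upwards [(chartAt E a).open_source.mem_nhds hp] with q hq
          using (chartAt E a).left_inv hq))
    (fun v => by
      have h := (chartAt E a).map_source hp
      have := modelDeriv_left_inverse (g := chartAt E a)
        ((contMDiffAt_chart_symm a h).mdifferentiableAt (by simp))
        (by rw [(chartAt E a).left_inv hp]
            exact (contMDiffAt_chart a hp).mdifferentiableAt (by simp))
        (by filter_upwards [(chartAt E a).open_target.mem_nhds h] with q hq
            using (chartAt E a).right_inv hq) v
      rwa [(chartAt E a).left_inv hp] at this)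

theorem modelDeriv_chart (a : Z) {p : Z} (hp : p ∈ (chartAt E a).source) :
    modelDeriv ℂ E E (chartAt E a) p = chartDeriv a p hp := rfl

theorem mdifferentiableAt_chart (a : Z) {p : Z} (hp : p ∈ (chartAt E a).source) :
    MDifferentiableAt 𝓘(ℂ, E) 𝓘(ℂ, E) (chartAt E a) p :=
  (contMDiffAt_chart a hp).mdifferentiableAt (by simp)

end Chart

section ChartDeriv

variable {E : Type v} [NormedAddCommGroup E] [NormedSpace ℂ E]
  {Z : Type u} [TopologicalSpace Z] [ChartedSpace E Z] [IsManifold 𝓘(ℂ, E) ω Z]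
  {P : Type*} [NormedAddCommGroup P] [NormedSpace ℝ P] {f : P → Z} {x : P}

theorem contDiffAt_chart_comp (a : Z) (hf : ContMDiffAt 𝓘(ℝ, P) 𝓘(ℝ, E) ω f x)
    (hx : f x ∈ (chartAt E a).source) : ContDiffAt ℝ ω (fun y => chartAt E a (f y)) x :=
  contMDiffAt_iff_contDiffAt.1
    (ContMDiffAt.comp (g := chartAt E a) x (contMDiffAt_real (contMDiffAt_chart a hx)) hf)

theorem fderiv_chart_comp (a : Z) (hf : MDifferentiableAt 𝓘(ℝ, P) 𝓘(ℝ, E) f x)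
    (hx : f x ∈ (chartAt E a).source) (u : P) :
    fderiv ℝ (fun y => chartAt E a (f y)) x u =
      chartDeriv a (f x) hx (modelDeriv ℝ P E f x u) := by
  have hκ := mdifferentiableAt_chart a hx
  rw [← modelDeriv_eq_fderiv, modelDeriv_comp hf (mdifferentiableAt_real hκ),
    modelDeriv_real hκ, modelDeriv_chart a hx]
  rfl

end ChartDeriv

section Extension

variable {E : Type v} [NormedAddCommGroup E] [NormedSpace ℂ E]
  {Z : Type u} [TopologicalSpace Z] [ChartedSpace E Z]
  {E' : Type v'} [NormedAddCommGroup E'] [NormedSpace ℂ E']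
  {Z' : Type u'} [TopologicalSpace Z'] [ChartedSpace E' Z']
  {P : Type*} [NormedAddCommGroup P] [NormedSpace ℝ P] {M : Set Z} {a : Z} {σ : P → Z} {c : Z → P}

theorem IsParam.modelDeriv_right_inverse (h : IsParam E M a σ c) {v : E}
    (hv : v ∈ modelTangent E M a) : modelDeriv ℝ P E σ 0 (modelDeriv ℝ E P c a v) = v := by
  have hσ : MDifferentiableAt 𝓘(ℝ, P) 𝓘(ℝ, E) σ (c a) := by
    rw [h.inv_base]
    exact h.smooth.mdifferentiableAt (by simp)
  rw [← h.inv_base]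
  exact modelDeriv_left_inverse_of_mem_modelTangent
    (h.smooth_inv.mdifferentiableAt (by simp)) hσ h.right_inv hv

variable [IsManifold 𝓘(ℂ, E) ω Z] [IsManifold 𝓘(ℂ, E') ω Z']

theorem IsParam.span_range_fderiv_chart (h : IsParam E M a σ c)
    (hspan : Submodule.span ℂ (modelTangent E M a : Set E) = ⊤) :
    Submodule.span ℂ (range (fderiv ℝ (fun x => chartAt E a (σ x)) 0)) = ⊤ := by
  obtain rfl := h.map_zero
  have h0 := mem_chart_source E (σ 0)
  have hle : Submodule.span ℂ (modelTangent E M (σ 0) : Set E) ≤ (Submodule.span ℂ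
      (range (fderiv ℝ (fun x => chartAt E (σ 0) (σ x)) 0))).comap
        ((chartDeriv (σ 0) (σ 0) h0).toLinearEquiv : E →ₗ[ℂ] E) := by
    refine Submodule.span_le.2 fun v hv =>
      Submodule.subset_span ⟨modelDeriv ℝ E P c (σ 0) v, ?_⟩
    rw [fderiv_chart_comp _ (h.smooth.mdifferentiableAt (by simp)) h0,
      h.modelDeriv_right_inverse hv]
    rfl
  refine eq_top_iff.2 fun e _ => ?_
  simpa using hle (hspan ▸ Submodule.mem_top : (chartDeriv (σ 0) (σ 0) h0).symm e ∈ _)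

theorem map_add_I_smul_map_eq_zero {T : Submodule ℝ E} {L : E →L[ℝ] E'}
    (hL : ∀ v ∈ T, Complex.I • v ∈ T → L (Complex.I • v) = Complex.I • L v) {u v : E}
    (hu : u ∈ T) (hv : v ∈ T) (huv : u + Complex.I • v = 0) : L u + Complex.I • L v = 0 := by
  obtain rfl := eq_neg_of_add_eq_zero_left huv
  rw [map_neg, hL v hv (neg_mem_iff.1 hu), neg_add_cancel]

theorem IsCRMapGerm.fderiv_chart_param [FiniteDimensional ℂ E] [FiniteDimensional ℂ E']
    [FiniteDimensional ℝ P]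
    (h : IsParam E M a σ c) {N : Set Z'} {f : Z → Z'} (hf : IsCRMapGerm E E' M a N f) :
    ∀ᶠ x in 𝓝 0, ∀ u v, fderiv ℝ (fun x => chartAt E a (σ x)) x u +
        Complex.I • fderiv ℝ (fun x => chartAt E a (σ x)) x v = 0 →
      fderiv ℝ (fun x => chartAt E' (f a) (f (σ x))) x u +
        Complex.I • fderiv ℝ (fun x => chartAt E' (f a) (f (σ x))) x v = 0 := by
  have : IsManifold 𝓘(ℝ, E) ω Z := isManifold_real
  have : IsManifold 𝓘(ℝ, E') ω Z' := isManifold_real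
  obtain rfl := h.map_zero
  have hσ := h.smooth.continuousAt
  filter_upwards [hσ.eventually ((chartAt E (σ 0)).open_source.mem_nhds (mem_chart_source E _)),
    (hf.analytic.continuousAt.comp (f := σ) hσ).eventually
      ((chartAt E' (f (σ 0))).open_source.mem_nhds (mem_chart_source E' _)),
    hσ.eventually (eventually_mdifferentiableAt hf.analytic),
    eventually_mdifferentiableAt h.smooth, h.tendsto.eventually hf.cr,
    eventually_eventually_nhds.2 h.mem] with x hxκ hxκ' hfx hσx hcr hM u v huv
  rw [fderiv_chart_comp _ hσx hxκ, fderiv_chart_comp _ hσx hxκ, ← map_smul, ← map_add,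
    EmbeddingLike.map_eq_zero_iff] at huv
  have hfσx : MDifferentiableAt 𝓘(ℝ, P) 𝓘(ℝ, E') (fun x => f (σ x)) x := hfx.comp x hσx
  rw [fderiv_chart_comp _ hfσx hxκ', fderiv_chart_comp _ hfσx hxκ', ← map_smul, ← map_add,
    EmbeddingLike.map_eq_zero_iff, modelDeriv_comp hσx hfx]
  exact map_add_I_smul_map_eq_zero (E := E) (E' := E') (T := modelTangent E M (σ x))
    (L := modelDeriv ℝ E E' f (σ x)) (fun w hw hIw => (hcr w ⟨hw, hIw⟩).2)
    (modelDeriv_param_mem_modelTangent hσx hM u) (modelDeriv_param_mem_modelTangent hσx hM v) huv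

theorem IsCRMapGerm.exists_extension [FiniteDimensional ℂ E] [FiniteDimensional ℂ E']
    [FiniteDimensional ℝ P] (h : IsParam E M a σ c)
    (hspan : Submodule.span ℂ (modelTangent E M a : Set E) = ⊤)
    {N : Set Z'} {f : Z → Z'} (hf : IsCRMapGerm E E' M a N f) :
    ∃ F : Z → Z', ContMDiffAt 𝓘(ℂ, E) 𝓘(ℂ, E') ω F a ∧ F a = f a ∧
      ∀ᶠ p in 𝓝[M] a, F p = f p := by
  obtain ⟨m, σ, c, h⟩ := h.exists_fin
  obtain rfl := h.map_zero
  have : CompleteSpace E' := FiniteDimensional.complete ℂ E'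
  let κ := chartAt E (σ 0)
  let κ' := chartAt E' (f (σ 0))
  have haκ : σ 0 ∈ κ.source := mem_chart_source E (σ 0)
  have haκ' : f (σ 0) ∈ κ'.source := mem_chart_source E' (f (σ 0))
  obtain ⟨F, hF, hFσ⟩ := exists_holomorphic_extension (contDiffAt_chart_comp (σ 0) h.smooth haκ)
    (contDiffAt_chart_comp (f := fun x => f (σ x)) _ (hf.analytic.comp 0 h.smooth) haκ')
    (h.span_range_fderiv_chart hspan) (hf.fderiv_chart_param h)
  have hF0 : F (κ (σ 0)) = κ' (f (σ 0)) := hFσ.self_of_nhds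
  refine ⟨fun p => κ'.symm (F (κ p)), ?_, ?_, ?_⟩
  · refine ContMDiffAt.comp (g := κ'.symm) (σ 0) (I' := 𝓘(ℂ, E'))
      (contMDiffAt_chart_symm (f (σ 0)) ?_) (hF.contMDiffAt.comp (σ 0) (contMDiffAt_chart _ haκ))
    rw [hF0]
    exact κ'.map_source haκ'
  · simp only [hF0, κ'.left_inv haκ']
  · have hc : Tendsto c (𝓝[M] σ 0) (𝓝 0) := by
      have := h.smooth_inv.continuousAt.tendsto
      rw [h.inv_base] at this
      exact this.mono_left nhdsWithin_le_nhds
    have hfκ' : ∀ᶠ p in 𝓝[M] σ 0, f p ∈ κ'.source :=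
      (hf.analytic.continuousAt.eventually (κ'.open_source.mem_nhds haκ')).filter_mono
        nhdsWithin_le_nhds
    filter_upwards [hc.eventually hFσ, h.right_inv, hfκ'] with p hFp hσp hfp
    rw [hσp] at hFp
    rw [hFp, κ'.left_inv hfp]

end Extension

section Local

variable {E : Type v} [NormedAddCommGroup E] [NormedSpace ℂ E]
  {Z : Type u} [TopologicalSpace Z] [ChartedSpace E Z] [IsManifold 𝓘(ℂ, E) ω Z]

/-- The value of a vector field, as an element of the model vector space. -/
def modelValue (X : Π p : Z, TangentSpace 𝓘(ℂ, E) p) (p : Z) : E := X p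

/-- A vector field in the chart at `a`. -/
noncomputable def chartField (a : Z) (X : Π p : Z, TangentSpace 𝓘(ℂ, E) p) : E → E :=
  VectorField.mpullback 𝓘(ℂ, E) 𝓘(ℂ, E) (chartAt E a).symm X

theorem inverse_modelDeriv_chart_symm (a : Z) {p : Z} (hp : p ∈ (chartAt E a).source) :
    (modelDeriv ℂ E E (chartAt E a).symm (chartAt E a p)).inverse = chartDeriv a p hp := by
  have : modelDeriv ℂ E E (chartAt E a).symm (chartAt E a p) = (chartDeriv a p hp).symm := rfl
  rw [this, ContinuousLinearMap.inverse_equiv]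
  simp

theorem chartField_apply (a : Z) (X : Π p : Z, TangentSpace 𝓘(ℂ, E) p) {p : Z}
    (hp : p ∈ (chartAt E a).source) :
    chartField a X (chartAt E a p) = chartDeriv a p hp (modelValue X p) := by
  have hpull : chartField a X (chartAt E a p) =
      (modelDeriv ℂ E E (chartAt E a).symm (chartAt E a p)).inverse
        (modelValue X ((chartAt E a).symm (chartAt E a p))) := rfl
  rw [hpull, inverse_modelDeriv_chart_symm a hp, (chartAt E a).left_inv hp]
  rfl

theorem mlieBracket_vectorSpace (V W : E → E) (e : E) :
    (VectorField.mlieBracket 𝓘(ℂ, E) (V : Π x : E, TangentSpace 𝓘(ℂ, E) x) W e : E) =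
      VectorField.lieBracket ℂ V W e :=
  (congrFun VectorField.mlieBracketWithin_univ e).symm.trans
    ((congrFun VectorField.mlieBracketWithin_eq_lieBracketWithin e).trans
      (congrFun VectorField.lieBracketWithin_univ e))

variable [FiniteDimensional ℂ E]

theorem contDiffAt_chartField {a : Z} {X : Π p : Z, TangentSpace 𝓘(ℂ, E) p} (hX : X ∈ holAt E a) :
    ContDiffAt ℂ ω (chartField a X) (chartAt E a a) := by
  have : CompleteSpace E := FiniteDimensional.complete ℂ E
  have : IsManifold 𝓘(ℂ, E) 1 Z := IsManifold.of_le (n := ω) le_top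
  have ha := mem_chart_source E a
  have h0 := (chartAt E a).map_source ha
  refine contMDiffAt_vectorSpace_iff_contDiffAt.1 ?_
  refine ContMDiffAt.mpullback_vectorField_preimage (n := ω) ?_ (contMDiffAt_chart_symm a h0) ?_
    le_top
  · rw [(chartAt E a).left_inv ha]
    exact hX.self_of_nhds
  · exact ⟨(chartDeriv a a ha).symm, rfl⟩

theorem eventually_chartField_mlieBracket {a : Z} {X Y : Π p : Z, TangentSpace 𝓘(ℂ, E) p}
    (hX : X ∈ holAt E a) (hY : Y ∈ holAt E a) : ∀ᶠ e in 𝓝 (chartAt E a a),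
      chartField a (VectorField.mlieBracket 𝓘(ℂ, E) X Y) e =
        VectorField.lieBracket ℂ (chartField a X) (chartField a Y) e := by
  have : CompleteSpace E := FiniteDimensional.complete ℂ E
  have : IsManifold 𝓘(ℂ, E) (minSmoothness ℂ 2) Z := IsManifold.of_le (n := ω) le_top
  have : IsManifold 𝓘(ℂ, E) (minSmoothness ℂ 3) Z := IsManifold.of_le (n := ω) le_top
  have h0 := mem_chart_target E a
  have ht : Tendsto (chartAt E a).symm (𝓝 (chartAt E a a)) (𝓝 a) := by
    have := (chartAt E a).continuousAt_symm h0
    rwa [ContinuousAt, (chartAt E a).left_inv (mem_chart_source E a)] at this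
  filter_upwards [ht.eventually (mdiffAt_of_mem hX), ht.eventually (mdiffAt_of_mem hY),
    (chartAt E a).open_target.mem_nhds h0] with e h1 h2 h3
  have h4 := VectorField.mpullback_mlieBracket h1 h2 (contMDiffAt_chart_symm a h3) le_top
  exact h4.trans (mlieBracket_vectorSpace _ _ e)

theorem eventually_eq_zero_of_generic {M : Set Z} {a : Z} (ha : a ∈ M)
    (hspan : ∀ᶠ p in 𝓝[M] a, Submodule.span ℂ (modelTangent E M p : Set E) = ⊤)
    {X : Π p : Z, TangentSpace 𝓘(ℂ, E) p} (hX : X ∈ holAt E a)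
    (h0 : ∀ᶠ p in 𝓝[M] a, modelValue X p = 0) : ∀ᶠ p in 𝓝 a, modelValue X p = 0 := by
  have : CompleteSpace E := FiniteDimensional.complete ℂ E
  let κ := chartAt E a
  let S : Set E := κ.target ∩ κ.symm ⁻¹' M
  have haκ : a ∈ κ.source := mem_chart_source E a
  have hlim : Tendsto κ.symm (𝓝[S] κ a) (𝓝[M] a) := by
    refine tendsto_nhdsWithin_iff.2 ⟨?_, eventually_nhdsWithin_of_forall fun e he => he.2⟩
    have := κ.continuousAt_symm (κ.map_source haκ)
    rw [ContinuousAt, κ.left_inv haκ] at this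
    exact this.mono_left nhdsWithin_le_nhds
  have hS : ∀ᶠ e in 𝓝[S] κ a, Submodule.span ℂ (modelTangent E S e : Set E) = ⊤ := by
    filter_upwards [hlim.eventually hspan, self_mem_nhdsWithin] with e he heS
    have hp : κ.symm e ∈ κ.source := κ.map_target heS.1
    rw [← κ.right_inv heS.1]
    refine span_modelTangent_eq_top_of_surjective (mdifferentiableAt_chart a hp)
      (by rw [modelDeriv_chart a hp]; exact (chartDeriv a _ hp).surjective) ?_ he
    filter_upwards [self_mem_nhdsWithin, mem_nhdsWithin_of_mem_nhds (κ.open_source.mem_nhds hp)]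
      with q hqM hqκ
    exact ⟨κ.map_source hqκ, by rwa [mem_preimage, κ.left_inv hqκ]⟩
  have hzero : ∀ᶠ e in 𝓝[S] κ a, chartField a X e = 0 := by
    filter_upwards [hlim.eventually h0, self_mem_nhdsWithin] with e he heS
    rw [← κ.right_inv heS.1, chartField_apply a X (κ.map_target heS.1), he, map_zero]
  have haS : κ a ∈ S := ⟨κ.map_source haκ, by rwa [mem_preimage, κ.left_inv haκ]⟩
  filter_upwards [(κ.continuousAt haκ).eventually
      (eventually_eq_zero_of_span_modelTangent haS hS (contDiffAt_chartField hX) hzero),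
    κ.open_source.mem_nhds haκ] with p hp hpκ
  rwa [chartField_apply a X hpκ, EmbeddingLike.map_eq_zero_iff] at hp

theorem HolGerm.ext_of_generic {M : Set Z} {a : Z} (ha : a ∈ M)
    (hspan : ∀ᶠ p in 𝓝[M] a, Submodule.span ℂ (modelTangent E M p : Set E) = ⊤)
    {ξ η : HolGerm E a} (h : ∀ᶠ p in 𝓝[M] a, modelValue ξ.rep p = modelValue η.rep p) :
    ξ = η := by
  have hsub := eventually_eq_zero_of_generic ha hspan
    (X := ξ.rep - η.rep) (sub_mem ξ.rep_mem η.rep_mem)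
    (by filter_upwards [h] with p hp using sub_eq_zero.2 hp)
  refine HolGerm.ext_rep ?_
  filter_upwards [hsub] with p hp using sub_eq_zero.1 hp

end Local

section RealForm

variable {C : Type*} [NormedAddCommGroup C] [NormedSpace ℂ C]

/-- `V` is a real form of the complex vector space `C`, i.e. `C = V ⊕ iV`. -/
def IsRealForm (V : Submodule ℝ C) : Prop := ∀ z : C, ∃! q : V × V,
  (q.1 : C) + Complex.I • (q.2 : C) = z

variable {V : Submodule ℝ C}

theorem IsRealForm.exists_eq (hV : IsRealForm V) (z : C) :
    ∃ x ∈ V, ∃ y ∈ V, z = x + Complex.I • y := by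
  obtain ⟨q, hq, -⟩ := hV z
  exact ⟨q.1, q.1.2, q.2, q.2.2, hq.symm⟩

theorem IsRealForm.eq_zero (hV : IsRealForm V) {x y : C} (hx : x ∈ V) (hy : y ∈ V)
    (h : x + Complex.I • y = 0) : x = 0 ∧ y = 0 := by
  have := (hV 0).unique (y₁ := (⟨x, hx⟩, ⟨y, hy⟩)) (y₂ := (0, 0)) h (by simp)
  rw [Prod.ext_iff] at this
  exact ⟨congrArg Subtype.val this.1, congrArg Subtype.val this.2⟩

theorem IsRealForm.span_eq_top (hV : IsRealForm V) : Submodule.span ℂ (V : Set C) = ⊤ := by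
  rw [eq_top_iff]
  intro z _
  obtain ⟨x, hx, y, hy, rfl⟩ := hV.exists_eq z
  exact add_mem (Submodule.subset_span hx) (Submodule.smul_mem _ _ (Submodule.subset_span hy))

theorem add_mem_tube (F : Set V) {z x : C} (hz : z ∈ tube V F) (hx : x ∈ V) :
    z + x ∈ tube V F := by
  obtain ⟨x', y, hy, rfl⟩ := hz
  exact ⟨x' + ⟨x, hx⟩, y, hy, by simp; abel⟩

theorem mem_modelTangent_tube {F : Set V} {z x : C} (hz : z ∈ tube V F) (hx : x ∈ V) :
    x ∈ modelTangent C (tube V F) z := by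
  have h0 : HasDerivAt (fun t : ℝ => z + t • x) x 0 := by
    simpa using ((hasDerivAt_id (0 : ℝ)).smul_const x).const_add z
  exact mem_modelTangent_of_curve (by simp)
    (Eventually.of_forall fun t => add_mem_tube F hz (V.smul_mem t hx))
    (hasMFDerivAt_curve_iff.2 h0)

theorem span_modelTangent_tube (hV : IsRealForm V) {F : Set V} {z : C} (hz : z ∈ tube V F) :
    Submodule.span ℂ (modelTangent C (tube V F) z : Set C) = ⊤ := by
  rw [eq_top_iff, ← hV.span_eq_top]
  exact Submodule.span_mono fun x hx => mem_modelTangent_tube hz hx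

variable [FiniteDimensional ℂ C]

/-- The isomorphism `x + iy ↦ (x, y)` onto real and imaginary parts with respect to a real form. -/
noncomputable def reIm (hV : IsRealForm V) : C ≃L[ℝ] V × V :=
  (LinearEquiv.ofBijective
    ({ toFun := fun q => (q.1 : C) + Complex.I • (q.2 : C)
       map_add' := fun p q => by
        simp only [Prod.fst_add, Prod.snd_add, Submodule.coe_add, smul_add]; abel
       map_smul' := fun r q => by
        simp only [Prod.smul_fst, Prod.smul_snd, Submodule.coe_smul, RingHom.id_apply, smul_add]
        rw [smul_comm] } : V × V →ₗ[ℝ] C)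
    ⟨fun p q h => (hV _).unique h rfl, fun z => (hV z).exists⟩).symm.toContinuousLinearEquiv

theorem reIm_symm_apply (hV : IsRealForm V) (q : V × V) :
    (reIm hV).symm q = (q.1 : C) + Complex.I • (q.2 : C) := rfl

theorem re_add_im (hV : IsRealForm V) (z : C) :
    ((reIm hV z).1 : C) + Complex.I • ((reIm hV z).2 : C) = z := by
  rw [← reIm_symm_apply hV, ContinuousLinearEquiv.symm_apply_apply]

theorem reIm_add (hV : IsRealForm V) (x y : V) :
    reIm hV ((x : C) + Complex.I • (y : C)) = (x, y) := by
  rw [← reIm_symm_apply hV (x, y), ContinuousLinearEquiv.apply_symm_apply]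

theorem reIm_coe (hV : IsRealForm V) (x : V) : reIm hV (x : C) = (x, 0) := by
  simpa using reIm_add hV x 0

theorem mem_tube_iff (hV : IsRealForm V) {F : Set V} {z : C} :
    z ∈ tube V F ↔ (reIm hV z).2 ∈ F := by
  constructor
  · rintro ⟨x, y, hy, rfl⟩
    rw [reIm_add]; exact hy
  · intro h
    exact ⟨_, _, h, (re_add_im hV z).symm⟩

theorem tendsto_im_tube (hV : IsRealForm V) (F : Set V) (c : C) :
    Tendsto (fun z => (reIm hV z).2) (𝓝[tube V F] c) (𝓝[F] (reIm hV c).2) :=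
  tendsto_nhdsWithin_iff.2
    ⟨((reIm hV).continuous.snd.tendsto c).mono_left nhdsWithin_le_nhds,
      eventually_nhdsWithin_of_forall fun _ hz => (mem_tube_iff hV).1 hz⟩

theorem exists_isParam_tube (hV : IsRealForm V) {F : Set V} (hF : IsAnalyticSubmanifold V F)
    {c : C} (hc : c ∈ tube V F) :
    ∃ (L : Submodule ℝ V) (σ : V × L → C) (r : C → V × L), IsParam C (tube V F) c σ r := by
  obtain ⟨L, σ, r, h⟩ := hF.exists_isParam ((mem_tube_iff hV).1 hc)
  have hsnd : Tendsto (fun q : V × L => q.2) (𝓝 0) (𝓝 0) := continuous_snd.tendsto 0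
  refine ⟨L, fun q => (reIm hV).symm ((reIm hV c).1 + q.1, σ q.2),
    fun z => ((reIm hV z).1 - (reIm hV c).1, r (reIm hV z).2), ?_, ?_, ?_, ?_, ?_, ?_, ?_⟩
  · rw [contMDiffAt_iff_contDiffAt]
    exact (reIm hV).symm.contDiff.contDiffAt.comp _ ((contDiffAt_const.add contDiffAt_fst).prodMk
      (ContDiffAt.comp (g := σ) _ h.smooth.contDiffAt contDiffAt_snd))
  · simp [h.map_zero]
  · filter_upwards [hsnd.eventually h.mem] with q hq
    rwa [mem_tube_iff hV, ContinuousLinearEquiv.apply_symm_apply]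
  · rw [contMDiffAt_iff_contDiffAt]
    have hreIm : ContDiffAt ℝ ω (fun z => reIm hV z) c := (reIm hV).contDiff.contDiffAt
    exact (hreIm.fst.sub contDiffAt_const).prodMk
      (ContDiffAt.comp (g := r) c h.smooth_inv.contDiffAt hreIm.snd)
  · simp [h.inv_base]
  · filter_upwards [(tendsto_im_tube hV F c).eventually h.right_inv] with z hz
    simp [hz]
  · filter_upwards [hsnd.eventually h.left_inv] with q hq
    simp [hq]

end RealForm

section CRMaps

variable {E : Type v} [NormedAddCommGroup E] [NormedSpace ℂ E]
  {Z : Type u} [TopologicalSpace Z] [ChartedSpace E Z]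
  {E' : Type v'} [NormedAddCommGroup E'] [NormedSpace ℂ E']
  {Z' : Type u'} [TopologicalSpace Z'] [ChartedSpace E' Z']
  {M : Set Z} {a : Z} {N : Set Z'} {b : Z'}

theorem IsCRMapGerm.tendsto {f : Z → Z'} (hf : IsCRMapGerm E E' M a N f) (hb : f a = b) :
    Tendsto f (𝓝[M] a) (𝓝[N] b) :=
  tendsto_nhdsWithin_iff.2
    ⟨hb ▸ hf.analytic.continuousAt.tendsto.mono_left nhdsWithin_le_nhds, hf.mapsTo⟩

theorem IsCRMapGerm.eventually_map_I_smul {f : Z → Z'} (hf : IsCRMapGerm E E' M a N f) :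
    ∀ᶠ p in 𝓝[M] a, ∀ v ∈ modelTangent E M p, Complex.I • v ∈ modelTangent E M p →
      modelDeriv ℝ E E' f p (Complex.I • v) = Complex.I • modelDeriv ℝ E E' f p v := by
  filter_upwards [hf.cr] with p hp v hv hIv using (hp v ⟨hv, hIv⟩).2

theorem IsCRIsoGerm.exists_symm {f : Z → Z'} (hf : IsCRIsoGerm E E' M a N b f) (ha : a ∈ M) :
    ∃ g, IsCRIsoGerm E' E N b M a g ∧ (∀ᶠ p in 𝓝[M] a, g (f p) = p) ∧
      ∀ᶠ q in 𝓝[N] b, f (g q) = q := by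
  obtain ⟨hfb, hf, g, hg, hgf, hfg⟩ := hf
  exact ⟨g, ⟨by rw [← hfb]; exact hgf.self_of_nhdsWithin ha, hg, f, hf, hfg, hgf⟩, hgf, hfg⟩

theorem IsCRIsoGerm.map {f : Z → Z'} (hf : IsCRIsoGerm E E' M a N b f) :
    IsCRMapGerm E E' M a N f := hf.2.1

theorem IsCRIsoGerm.tendsto {f : Z → Z'} (hf : IsCRIsoGerm E E' M a N b f) :
    Tendsto f (𝓝[M] a) (𝓝[N] b) := hf.map.tendsto hf.1

variable [IsManifold 𝓘(ℂ, E) ω Z] [IsManifold 𝓘(ℂ, E') ω Z']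
  {E'' : Type*} [NormedAddCommGroup E''] [NormedSpace ℂ E'']
  {Z'' : Type*} [TopologicalSpace Z''] [ChartedSpace E'' Z''] [IsManifold 𝓘(ℂ, E'') ω Z'']
  {K : Set Z''} {d : Z''}

theorem IsCRMapGerm.eventually_mdifferentiableAt {f : Z → Z'} (hf : IsCRMapGerm E E' M a N f) :
    ∀ᶠ p in 𝓝[M] a, MDifferentiableAt 𝓘(ℝ, E) 𝓘(ℝ, E') f p := by
  have : IsManifold 𝓘(ℝ, E) ω Z := isManifold_real
  have : IsManifold 𝓘(ℝ, E') ω Z' := isManifold_real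
  exact (CRTube.eventually_mdifferentiableAt hf.analytic).filter_mono nhdsWithin_le_nhds

theorem IsCRMapGerm.eventually_modelDeriv_mem {f : Z → Z'} (hf : IsCRMapGerm E E' M a N f) :
    ∀ᶠ p in 𝓝[M] a, ∀ v ∈ modelTangent E M p,
      modelDeriv ℝ E E' f p v ∈ modelTangent E' N (f p) := by
  filter_upwards [hf.eventually_mdifferentiableAt, eventually_eventually_nhdsWithin.2 hf.mapsTo]
    with p hfp hfN v hv
  exact modelDeriv_mem_modelTangent hfp hfN hv

theorem isCRMapGerm_of_map_I_smul {f : Z → Z'} (hf : ContMDiffAt 𝓘(ℝ, E) 𝓘(ℝ, E') ω f a)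
    (hfN : ∀ᶠ p in 𝓝[M] a, f p ∈ N)
    (hfI : ∀ᶠ p in 𝓝[M] a, ∀ v ∈ modelTangent E M p, Complex.I • v ∈ modelTangent E M p →
      modelDeriv ℝ E E' f p (Complex.I • v) = Complex.I • modelDeriv ℝ E E' f p v) :
    IsCRMapGerm E E' M a N f where
  analytic := hf
  mapsTo := hfN
  cr := by
    have : IsManifold 𝓘(ℝ, E) ω Z := isManifold_real
    have : IsManifold 𝓘(ℝ, E') ω Z' := isManifold_real
    filter_upwards [hfI, eventually_eventually_nhdsWithin.2 hfN,
      (CRTube.eventually_mdifferentiableAt hf).filter_mono nhdsWithin_le_nhds]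
      with p hpI hpN hfp
    rintro v ⟨hv, hIv⟩
    exact ⟨⟨modelDeriv_mem_modelTangent hfp hpN hv,
      (congrArg (· ∈ modelTangent E' N (f p)) (hpI v hv hIv)).mp
        (modelDeriv_mem_modelTangent hfp hpN hIv)⟩, hpI v hv hIv⟩

theorem IsCRMapGerm.comp {f : Z → Z'} {g : Z' → Z''} (hg : IsCRMapGerm E' E'' N b K g)
    (hf : IsCRMapGerm E E' M a N f) (hb : f a = b) :
    IsCRMapGerm E E'' M a K (fun p => g (f p)) := by
  refine isCRMapGerm_of_map_I_smul
    (ContMDiffAt.comp a (by rw [hb]; exact hg.analytic) hf.analytic)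
    ((hf.tendsto hb).eventually hg.mapsTo) ?_
  filter_upwards [hf.eventually_map_I_smul, hf.eventually_modelDeriv_mem,
    hf.eventually_mdifferentiableAt, (hf.tendsto hb).eventually hg.eventually_map_I_smul,
    (hf.tendsto hb).eventually hg.eventually_mdifferentiableAt]
    with p hfI hfN hfp hgI hgp v hv hIv
  have hmem := hfN _ hIv
  rw [hfI v hv hIv] at hmem
  rw [modelDeriv_comp hfp hgp, ContinuousLinearMap.comp_apply, ContinuousLinearMap.comp_apply,
    hfI v hv hIv, hgI _ (hfN v hv) hmem]

theorem isCRMapGerm_of_holomorphic {f : Z → Z'} (hf : ContMDiffAt 𝓘(ℂ, E) 𝓘(ℂ, E') ω f a)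
    (hN : ∀ᶠ p in 𝓝[M] a, f p ∈ N) : IsCRMapGerm E E' M a N f := by
  refine isCRMapGerm_of_map_I_smul (contMDiffAt_real hf) hN ?_
  filter_upwards [(CRTube.eventually_mdifferentiableAt hf).filter_mono nhdsWithin_le_nhds]
    with p hfp v _ _
  rw [modelDeriv_real_apply hfp, modelDeriv_real_apply hfp, map_smul]

theorem isCRIsoGerm_id : IsCRIsoGerm E E M a M a (fun p => p) :=
  have h : IsCRMapGerm E E M a M (fun p => p) :=
    isCRMapGerm_of_holomorphic contMDiffAt_id self_mem_nhdsWithin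
  ⟨rfl, h, _, h, Eventually.of_forall fun _ => rfl, Eventually.of_forall fun _ => rfl⟩

theorem IsCRIsoGerm.comp {f : Z → Z'} {g : Z' → Z''} (hg : IsCRIsoGerm E' E'' N b K d g)
    (hf : IsCRIsoGerm E E' M a N b f) (hb : b ∈ N) :
    IsCRIsoGerm E E'' M a K d (fun p => g (f p)) := by
  obtain ⟨hfb, hf, f', hf', hf'f, hff'⟩ := hf
  obtain ⟨hgd, hg, g', hg', hg'g, hgg'⟩ := hg
  have hg'b : g' d = b := by rw [← hgd]; exact hg'g.self_of_nhdsWithin hb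
  refine ⟨(congrArg g hfb).trans hgd, hg.comp hf hfb, _, hf'.comp hg' hg'b, ?_, ?_⟩
  · filter_upwards [hf'f, (hf.tendsto hfb).eventually hg'g] with p hp hfp
    rw [hfp, hp]
  · filter_upwards [hgg', (hg'.tendsto hg'b).eventually hff'] with q hq hg'q
    rw [hg'q, hq]

theorem IsCRMapGerm.eventually_modelDeriv_left_inverse {f : Z → Z'} {g : Z' → Z}
    (hf : IsCRMapGerm E E' M a N f) (hg : IsCRMapGerm E' E N b M g) (hb : f a = b)
    (hgf : ∀ᶠ p in 𝓝[M] a, g (f p) = p) :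
    ∀ᶠ p in 𝓝[M] a, ∀ v ∈ modelTangent E M p,
      modelDeriv ℝ E' E g (f p) (modelDeriv ℝ E E' f p v) = v := by
  filter_upwards [hf.eventually_mdifferentiableAt,
    (hf.tendsto hb).eventually hg.eventually_mdifferentiableAt,
    eventually_eventually_nhdsWithin.2 hgf] with p hfp hgp hgfp v hv
  exact modelDeriv_left_inverse_of_mem_modelTangent hfp hgp hgfp hv

end CRMaps

section Equivalences

variable {E : Type v} [NormedAddCommGroup E] [NormedSpace ℂ E]
  {Z : Type u} [TopologicalSpace Z] [ChartedSpace E Z] [IsManifold 𝓘(ℂ, E) ω Z]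
  {M : Set Z} {a : Z}

theorem pushes_iff {g : Z → Z} {ξ η : HolGerm E a} :
    Pushes M a g ξ η ↔ ∀ᶠ p in 𝓝[M] a,
      modelDeriv ℝ E E g p (modelValue ξ.rep p) = modelValue η.rep (g p) := Iff.rfl

theorem pushes_id (ξ : HolGerm E a) : Pushes M a (fun p => p) ξ ξ := by
  refine pushes_iff.2 (Eventually.of_forall fun p => ?_)
  rw [modelDeriv_id, ContinuousLinearMap.id_apply]

theorem Pushes.comp {f g : Z → Z} {ξ η ζ : HolGerm E a} (hg : IsCRIsoGerm E E M a M a g)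
    (hgη : Pushes M a g η ζ) (hf : IsCRIsoGerm E E M a M a f) (hfξ : Pushes M a f ξ η) :
    Pushes M a (fun p => g (f p)) ξ ζ := by
  rw [pushes_iff] at *
  filter_upwards [hfξ, hf.tendsto.eventually hgη, hf.map.eventually_mdifferentiableAt,
    hf.tendsto.eventually hg.map.eventually_mdifferentiableAt] with p hξp hηp hfp hgp
  rw [modelDeriv_comp hfp hgp, ContinuousLinearMap.comp_apply, hξp, hηp]

theorem Pushes.symm {f g : Z → Z} {ξ η : HolGerm E a} (h : Pushes M a f ξ η)
    (hf : IsCRIsoGerm E E M a M a f) (hg : IsCRIsoGerm E E M a M a g)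
    (hgf : ∀ᶠ p in 𝓝[M] a, g (f p) = p) (hfg : ∀ᶠ p in 𝓝[M] a, f (g p) = p)
    (hξ : ∀ᶠ p in 𝓝[M] a, modelValue ξ.rep p ∈ modelTangent E M p) : Pushes M a g η ξ := by
  rw [pushes_iff] at h ⊢
  filter_upwards [hg.tendsto.eventually h, hfg, hg.tendsto.eventually hξ,
    hg.tendsto.eventually (hf.map.eventually_modelDeriv_left_inverse hg.map hf.1 hgf)]
    with q hq hfgq hξq hleft
  have := hleft _ hξq
  rwa [hq, hfgq] at this

variable [FiniteDimensional ℂ E]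

theorem IsAdmissible.mem_modelTangent {𝔳 : LieSubalgebra ℝ (HolGerm E a)} (h : IsAdmissible M a 𝔳)
    {ξ : HolGerm E a} (hξ : ξ ∈ 𝔳) :
    ∀ᶠ p in 𝓝[M] a, modelValue ξ.rep p ∈ modelTangent E M p := h.le_holM hξ

theorem equivalence_conjugate (ha : a ∈ M) : Equivalence (Conjugate (E := E) M a) where
  refl 𝔳 := ⟨_, isCRIsoGerm_id, fun ξ hξ => ⟨ξ, hξ, pushes_id ξ⟩, fun ξ hξ => ⟨ξ, hξ, pushes_id ξ⟩⟩
  symm {𝔳 𝔴} := by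
    rintro ⟨f, hf, h𝔳, h𝔴⟩
    obtain ⟨g, hg, hgf, hfg⟩ := hf.exists_symm ha
    refine ⟨g, hg, fun η hη => ?_, fun ξ hξ => ?_⟩
    · obtain ⟨ξ, hξ, h⟩ := h𝔴 η hη
      exact ⟨ξ, hξ, h.symm hf hg hgf hfg (𝔳.2.mem_modelTangent hξ)⟩
    · obtain ⟨η, hη, h⟩ := h𝔳 ξ hξ
      exact ⟨η, hη, h.symm hf hg hgf hfg (𝔳.2.mem_modelTangent hξ)⟩
  trans {𝔳 𝔴 𝔵} := by
    rintro ⟨f, hf, hf𝔳, hf𝔴⟩ ⟨g, hg, hg𝔴, hg𝔵⟩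
    refine ⟨_, hg.comp hf ha, fun ξ hξ => ?_, fun ζ hζ => ?_⟩
    · obtain ⟨η, hη, hfξ⟩ := hf𝔳 ξ hξ
      obtain ⟨ζ, hζ, hgη⟩ := hg𝔴 η hη
      exact ⟨ζ, hζ, .comp hg hgη hf hfξ⟩
    · obtain ⟨η, hη, hgη⟩ := hg𝔵 ζ hζ
      obtain ⟨ξ, hξ, hfξ⟩ := hf𝔴 η hη
      exact ⟨ξ, hξ, .comp hg hgη hf hfξ⟩

end Equivalences

section AffineEquivalence

theorem affineEquiv_tendsto {C C' : Type*} [NormedAddCommGroup C] [NormedSpace ℂ C]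
    [FiniteDimensional ℂ C] [NormedAddCommGroup C'] [NormedSpace ℂ C'] (l : C ≃ᵃ[ℂ] C')
    {c : C} {c' : C'} (h : l c = c') : Tendsto l (𝓝 c) (𝓝 c') := by
  rw [← h]
  exact (AffineMap.continuous_of_finiteDimensional (l : C →ᵃ[ℂ] C')).tendsto c

variable {E : Type v} [NormedAddCommGroup E] [NormedSpace ℂ E]
  {Z : Type u} [TopologicalSpace Z] [ChartedSpace E Z] {M : Set Z} {a : Z}

theorem equivalence_affEquiv : Equivalence (AffEquiv.{u, v, w} E M a) where
  refl R := ⟨AffineEquiv.refl ℂ R.C, rfl, Eventually.of_forall fun _ => Iff.rfl⟩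
  symm {R R'} h := by
    obtain ⟨l, h1, h2⟩ := h
    have h3 : l.symm R'.c = R.c := by rw [← h1, AffineEquiv.symm_apply_apply]
    refine ⟨l.symm, h3, ?_⟩
    filter_upwards [(affineEquiv_tendsto l.symm h3).eventually h2] with z hz
    rw [hz, AffineEquiv.apply_symm_apply]
  trans {R R' R''} h k := by
    obtain ⟨l, h1, h2⟩ := h
    obtain ⟨k, k1, k2⟩ := k
    refine ⟨l.trans k, by simp [h1, k1], ?_⟩
    filter_upwards [h2, (affineEquiv_tendsto l h1).eventually k2] with z hz hz'
    rw [hz, hz']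
    rfl

end AffineEquivalence

/-! ### Generic germs and holomorphic extensions of CR isomorphisms -/

/-- The germ at `a` of a real-analytically parametrized, generically embedded subset `M`: a
germ-level form of `IsGenericSubmanifold`, which is all that the local theory at `a` requires. -/
structure IsGenericAt (E : Type*) [NormedAddCommGroup E] [NormedSpace ℂ E]
    {Z : Type*} [TopologicalSpace Z] [ChartedSpace E Z] (M : Set Z) (a : Z) : Prop where
  mem : a ∈ M
  param : ∃ (m : ℕ) (σ : (Fin m → ℝ) → Z) (c : Z → (Fin m → ℝ)), IsParam E M a σ c
  eventually_span : ∀ᶠ p in 𝓝[M] a, Submodule.span ℂ (modelTangent E M p : Set E) = ⊤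

section Generic

variable {E : Type v} [NormedAddCommGroup E] [NormedSpace ℂ E]
  {Z : Type u} [TopologicalSpace Z] [ChartedSpace E Z] {M : Set Z} {a : Z}

theorem IsGenericAt.span (hM : IsGenericAt E M a) :
    Submodule.span ℂ (modelTangent E M a : Set E) = ⊤ :=
  hM.eventually_span.self_of_nhdsWithin hM.mem

theorem IsGenericSubmanifold.isGenericAt [FiniteDimensional ℂ E] [IsManifold 𝓘(ℂ, E) ω Z]
    (hM : IsGenericSubmanifold E M) (ha : a ∈ M) : IsGenericAt E M a where
  mem := ha
  param := by
    have : IsManifold 𝓘(ℝ, E) ω Z := isManifold_real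
    obtain ⟨L, σ, c, h⟩ := hM.submanifold.exists_isParam ha
    exact h.exists_fin
  eventually_span := eventually_nhdsWithin_of_forall hM.generic

theorem isGenericAt_tube {C : Type*} [NormedAddCommGroup C] [NormedSpace ℂ C]
    [FiniteDimensional ℂ C] {V : Submodule ℝ C} (hV : IsRealForm V) {F : Set V}
    (hF : IsAnalyticSubmanifold V F) {c : C} (hc : c ∈ tube V F) :
    IsGenericAt C (tube V F) c where
  mem := hc
  param := by
    obtain ⟨L, σ, r, h⟩ := exists_isParam_tube hV hF hc
    exact h.exists_fin
  eventually_span := eventually_nhdsWithin_of_forall fun _ hz => span_modelTangent_tube hV hz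

theorem eq_id_of_span {S : Submodule ℝ E} (hS : Submodule.span ℂ (S : Set E) = ⊤)
    {A : E →L[ℂ] E} (h : ∀ v ∈ S, A v = v) (v : E) : A v = v := by
  have hle : Submodule.span ℂ (S : Set E) ≤ LinearMap.eqLocus (A : E →ₗ[ℂ] E) LinearMap.id :=
    Submodule.span_le.2 h
  rw [hS] at hle
  exact hle (Submodule.mem_top (x := v))

variable [IsManifold 𝓘(ℂ, E) ω Z]
  {E' : Type v'} [NormedAddCommGroup E'] [NormedSpace ℂ E']
  {Z' : Type u'} [TopologicalSpace Z'] [ChartedSpace E' Z'] [IsManifold 𝓘(ℂ, E') ω Z']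
  {N : Set Z'} {b : Z'} {f F : Z → Z'} {g G : Z' → Z}

theorem IsCRMapGerm.eventually_modelDeriv_eq (hf : IsCRMapGerm E E' M a N f)
    (hF : ContMDiffAt 𝓘(ℂ, E) 𝓘(ℂ, E') ω F a) (hFf : ∀ᶠ p in 𝓝[M] a, F p = f p) :
    ∀ᶠ p in 𝓝[M] a, ∀ v ∈ modelTangent E M p,
      modelDeriv ℂ E E' F p v = modelDeriv ℝ E E' f p v := by
  filter_upwards [eventually_eventually_nhdsWithin.2 hFf,
    (CRTube.eventually_mdifferentiableAt hF).filter_mono nhdsWithin_le_nhds,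
    hf.eventually_mdifferentiableAt] with p hFfp hFp hfp v hv
  rw [← modelDeriv_real_apply hFp]
  exact modelDeriv_congr_of_mem_modelTangent (mdifferentiableAt_real hFp) hfp hFfp hv

theorem IsCRMapGerm.modelDeriv_extension_left_inverse (hM : IsGenericAt E M a) (hb : b ∈ N)
    (hf : IsCRMapGerm E E' M a N f) (hg : IsCRMapGerm E' E N b M g) (hfa : f a = b)
    (hgf : ∀ᶠ p in 𝓝[M] a, g (f p) = p)
    (hF : ContMDiffAt 𝓘(ℂ, E) 𝓘(ℂ, E') ω F a) (hFf : ∀ᶠ p in 𝓝[M] a, F p = f p)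
    (hG : ContMDiffAt 𝓘(ℂ, E') 𝓘(ℂ, E) ω G b) (hGg : ∀ᶠ q in 𝓝[N] b, G q = g q) (v : E) :
    modelDeriv ℂ E' E G b (modelDeriv ℂ E E' F a v) = v := by
  refine eq_id_of_span (A := (modelDeriv ℂ E' E G b).comp (modelDeriv ℂ E E' F a)) hM.span
    (fun v hv => ?_) v
  have hFv := (hf.eventually_modelDeriv_eq hF hFf).self_of_nhdsWithin hM.mem v hv
  have hfv := hf.eventually_modelDeriv_mem.self_of_nhdsWithin hM.mem v hv
  have hgfv := (hf.eventually_modelDeriv_left_inverse hg hfa hgf).self_of_nhdsWithin hM.mem v hv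
  rw [hfa] at hfv hgfv
  have hGfv := (hg.eventually_modelDeriv_eq hG hGg).self_of_nhdsWithin hb _ hfv
  rw [ContinuousLinearMap.comp_apply, hFv, hGfv, hgfv]

theorem IsCRIsoGerm.exists_extension [FiniteDimensional ℂ E] [FiniteDimensional ℂ E']
    (hM : IsGenericAt E M a) (hN : IsGenericAt E' N b) (hf : IsCRIsoGerm E E' M a N b f) :
    ∃ F : Z → Z', ContMDiffAt 𝓘(ℂ, E) 𝓘(ℂ, E') ω F a ∧ F a = b ∧ (∀ᶠ p in 𝓝[M] a, F p = f p) ∧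
      (modelDeriv ℂ E E' F a).IsInvertible := by
  obtain ⟨g, hg, hgf, hfg⟩ := hf.exists_symm hM.mem
  obtain ⟨m, σ, c, hσ⟩ := hM.param
  obtain ⟨n, τ, d, hτ⟩ := hN.param
  obtain ⟨F, hF, hFa, hFf⟩ := hf.map.exists_extension hσ hM.span
  obtain ⟨G, hG, -, hGg⟩ := hg.map.exists_extension hτ hN.span
  refine ⟨F, hF, hFa.trans hf.1, hFf, .equivOfInverse (modelDeriv ℂ E E' F a)
    (modelDeriv ℂ E' E G b) ?_ ?_, rfl⟩
  · exact hf.map.modelDeriv_extension_left_inverse hM hN.mem hg.map hf.1 hgf hF hFf hG hGg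
  · exact hg.map.modelDeriv_extension_left_inverse hN hM.mem hf.map hg.1 hfg hG hGg hF hFf

end Generic

/-! ### Pull backs of constant fields -/

section Pull

variable {E : Type v} [NormedAddCommGroup E] [NormedSpace ℂ E]
  {Z : Type u} [TopologicalSpace Z] [ChartedSpace E Z]
  {C : Type w} [NormedAddCommGroup C] [NormedSpace ℂ C]
  {M : Set Z} {a : Z}

/-- The constant field `x ∂/∂z`. -/
def constField (x : C) : Π z : C, TangentSpace 𝓘(ℂ, C) z := fun _ => x

/-- The pull back `F^*(x ∂/∂z)` of a constant field. -/
noncomputable def pull (F : Z → C) (x : C) : Π p : Z, TangentSpace 𝓘(ℂ, E) p :=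
  VectorField.mpullback 𝓘(ℂ, E) 𝓘(ℂ, C) F (constField x)

theorem modelValue_pull (F : Z → C) (x : C) (p : Z) :
    modelValue (E := E) (pull F x) p = (modelDeriv ℂ E C F p).inverse x := rfl

theorem modelDeriv_modelValue_pull {F : Z → C} {p : Z} (h : (modelDeriv ℂ E C F p).IsInvertible)
    (x : C) : modelDeriv ℂ E C F p (modelValue (pull F x) p) = x := by
  obtain ⟨D, hD⟩ := h
  rw [modelValue_pull, ← hD, ContinuousLinearMap.inverse_equiv]
  exact D.apply_symm_apply x

theorem injective_of_isInvertible {A : E →L[ℂ] C} (h : A.IsInvertible) : Function.Injective A := by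
  obtain ⟨D, rfl⟩ := h
  exact D.injective

theorem contMDiffAt_constField (x : C) (c : C) : ContMDiffAt 𝓘(ℂ, C) 𝓘(ℂ, C).tangent ω
    (T% (constField x)) c :=
  contMDiffAt_vectorSpace_iff_contDiffAt.2 contDiffAt_const

theorem mlieBracket_constField (x y : C) (c : C) :
    VectorField.mlieBracket 𝓘(ℂ, C) (constField x) (constField y) c = 0 := by
  refine (mlieBracket_vectorSpace _ _ _).trans ?_
  change fderiv ℂ (fun _ : C => y) c x - fderiv ℂ (fun _ : C => x) c y = 0
  simp

variable [IsManifold 𝓘(ℂ, E) ω Z]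

theorem fderiv_comp_chart_symm {F : Z → C} (a : Z) {p : Z} (hp : p ∈ (chartAt E a).source)
    (hF : MDifferentiableAt 𝓘(ℂ, E) 𝓘(ℂ, C) F p) :
    fderiv ℂ (fun e => F ((chartAt E a).symm e)) (chartAt E a p) =
      (modelDeriv ℂ E C F p).comp ((chartDeriv a p hp).symm : E →L[ℂ] E) := by
  have hsymm := contMDiffAt_chart_symm a ((chartAt E a).map_source hp)
  have hleft := (chartAt E a).left_inv hp
  rw [← modelDeriv_eq_fderiv,
    modelDeriv_comp (hsymm.mdifferentiableAt (by simp)) (by rwa [hleft]), hleft]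
  rfl

theorem eventually_isInvertible [CompleteSpace E] [CompleteSpace C] {F : Z → C}
    (hF : ContMDiffAt 𝓘(ℂ, E) 𝓘(ℂ, C) ω F a) (hF' : (modelDeriv ℂ E C F a).IsInvertible) :
    ∀ᶠ p in 𝓝 a, (modelDeriv ℂ E C F p).IsInvertible := by
  have ha := mem_chart_source E a
  have hlocal : ContDiffAt ℂ ω (fun e => F ((chartAt E a).symm e)) (chartAt E a a) := by
    rw [← contMDiffAt_iff_contDiffAt]
    refine ContMDiffAt.comp (g := F) _ ?_ (contMDiffAt_chart_symm a (mem_chart_target E a))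
    rwa [(chartAt E a).left_inv ha]
  have hcont : ContinuousAt (fderiv ℂ fun e => F ((chartAt E a).symm e)) (chartAt E a a) :=
    (hlocal.fderiv_right (m := ω) le_top).continuousAt
  obtain ⟨D, hD⟩ := hF'
  have hrange : range ((↑) : (E ≃L[ℂ] C) → E →L[ℂ] C) ∈
      𝓝 (fderiv ℂ (fun e => F ((chartAt E a).symm e)) (chartAt E a a)) := by
    rw [fderiv_comp_chart_symm a ha (hF.mdifferentiableAt (by simp)), ← hD]
    exact ContinuousLinearEquiv.nhds ((chartDeriv a a ha).symm.trans D)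
  filter_upwards [((chartAt E a).continuousAt ha).eventually (hcont.eventually hrange),
    (chartAt E a).open_source.mem_nhds ha, eventually_mdifferentiableAt hF] with p ⟨B, hB⟩ hp hFp
  refine ⟨(chartDeriv a p hp).trans B, ContinuousLinearMap.ext fun v => ?_⟩
  have hBv := DFunLike.congr_fun (hB.trans (fderiv_comp_chart_symm a hp hFp)) (chartDeriv a p hp v)
  simpa using hBv

variable [FiniteDimensional ℂ E] [FiniteDimensional ℂ C]

theorem pull_mem_holAt {F : Z → C} (hF : ContMDiffAt 𝓘(ℂ, E) 𝓘(ℂ, C) ω F a)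
    (hF' : (modelDeriv ℂ E C F a).IsInvertible) (x : C) : pull F x ∈ holAt E a := by
  have : CompleteSpace E := FiniteDimensional.complete ℂ E
  have : CompleteSpace C := FiniteDimensional.complete ℂ C
  have : IsManifold 𝓘(ℂ, E) 1 Z := IsManifold.of_le (n := ω) le_top
  filter_upwards [eventually_isInvertible hF hF', eventually_contMDiffAt hF] with p hinv hFp
  exact ContMDiffAt.mpullback_vectorField_preimage (n := ω) (contMDiffAt_constField x _) hFp hinv
    le_top

/-- The germ at `a` of the pull back of a constant field, depending linearly on the field. -/
noncomputable def pullGerm {F : Z → C} (hF : ContMDiffAt 𝓘(ℂ, E) 𝓘(ℂ, C) ω F a)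
    (hF' : (modelDeriv ℂ E C F a).IsInvertible) : C →ₗ[ℂ] HolGerm E a :=
  (germ a).comp
    ({ toFun := fun x => ⟨pull F x, pull_mem_holAt hF hF' x⟩
       map_add' := fun x y => Subtype.ext <| funext fun p =>
        map_add ((modelDeriv ℂ E C F p).inverse) x y
       map_smul' := fun r x => Subtype.ext <| funext fun p =>
        map_smul ((modelDeriv ℂ E C F p).inverse) r x } : C →ₗ[ℂ] holAt E a)

variable {F : Z → C} (hF : ContMDiffAt 𝓘(ℂ, E) 𝓘(ℂ, C) ω F a)
  (hF' : (modelDeriv ℂ E C F a).IsInvertible)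

theorem rep_pullGerm (x : C) : (pullGerm hF hF' x).rep =ᶠ[𝓝 a] pull F x :=
  rep_germ (⟨pull F x, pull_mem_holAt hF hF' x⟩ : holAt E a)

theorem modelDeriv_modelValue_pullGerm (x : C) :
    ∀ᶠ p in 𝓝 a, modelDeriv ℂ E C F p (modelValue (pullGerm hF hF' x).rep p) = x := by
  have : CompleteSpace E := FiniteDimensional.complete ℂ E
  have : CompleteSpace C := FiniteDimensional.complete ℂ C
  filter_upwards [rep_pullGerm hF hF' x, eventually_isInvertible hF hF'] with p hrep hinv
  have hvalue : modelValue (pullGerm hF hF' x).rep p = modelValue (pull F x) p := hrep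
  rw [hvalue, modelDeriv_modelValue_pull hinv]

theorem pullGerm_injective : Function.Injective (pullGerm hF hF') := by
  intro x y h
  rw [← (modelDeriv_modelValue_pullGerm hF hF' x).self_of_nhds, h,
    (modelDeriv_modelValue_pullGerm hF hF' y).self_of_nhds]

theorem lie_pullGerm (x y : C) : ⁅pullGerm hF hF' x, pullGerm hF hF' y⁆ = 0 := by
  have : CompleteSpace E := FiniteDimensional.complete ℂ E
  have : CompleteSpace C := FiniteDimensional.complete ℂ C
  have : IsManifold 𝓘(ℂ, E) (minSmoothness ℂ 2) Z := IsManifold.of_le (n := ω) le_top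
  have : IsManifold 𝓘(ℂ, E) (minSmoothness ℂ 3) Z := IsManifold.of_le (n := ω) le_top
  refine HolGerm.ext_rep ?_
  filter_upwards [HolGerm.rep_bracket (pullGerm hF hF' x) (pullGerm hF hF' y),
    (rep_pullGerm hF hF' x).mlieBracket_vectorField (rep_pullGerm hF hF' y),
    HolGerm.rep_zero (E := E) (a := a), eventually_contMDiffAt hF]
    with p hbracket hpull hzero hFp
  rw [hbracket, hpull, hzero]
  refine (VectorField.mpullback_mlieBracket
    ((contMDiffAt_constField x (F p)).mdifferentiableAt (by simp))
    ((contMDiffAt_constField y (F p)).mdifferentiableAt (by simp)) hFp le_top).symm.trans ?_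
  exact (congrArg (modelDeriv ℂ E C F p).inverse (mlieBracket_constField x y (F p))).trans
    (map_zero _)

end Pull

section PullSubalgebra

variable {E : Type v} [NormedAddCommGroup E] [NormedSpace ℂ E] [FiniteDimensional ℂ E]
  {Z : Type u} [TopologicalSpace Z] [ChartedSpace E Z] [IsManifold 𝓘(ℂ, E) ω Z]
  {C : Type w} [NormedAddCommGroup C] [NormedSpace ℂ C] [FiniteDimensional ℂ C]
  {M : Set Z} {a : Z} {F φ : Z → C} {V : Submodule ℝ C} {B : Set V} {c : C}
  (hF : ContMDiffAt 𝓘(ℂ, E) 𝓘(ℂ, C) ω F a) (hF' : (modelDeriv ℂ E C F a).IsInvertible)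

/-- The abelian real Lie algebra of the germs `F^*(x ∂/∂z)` with `x ∈ V`. -/
noncomputable def pullSubalgebra (V : Submodule ℝ C) : LieSubalgebra ℝ (HolGerm E a) where
  toSubmodule := V.map ((pullGerm hF hF').restrictScalars ℝ)
  lie_mem' := by
    rintro _ _ ⟨x, -, rfl⟩ ⟨y, -, rfl⟩
    exact (lie_pullGerm hF hF' x y).symm ▸ zero_mem (V.map ((pullGerm hF hF').restrictScalars ℝ))

theorem mem_pullSubalgebra {ξ : HolGerm E a} :
    ξ ∈ pullSubalgebra hF hF' V ↔ ∃ x ∈ V, pullGerm hF hF' x = ξ := Iff.rfl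

theorem eventually_pullGerm_mem_modelTangent (hφ : IsCRIsoGerm E C M a (tube V B) c φ)
    (hFφ : ∀ᶠ p in 𝓝[M] a, F p = φ p) (ha : a ∈ M) {x : C} (hx : x ∈ V) :
    ∀ᶠ p in 𝓝[M] a, modelValue (pullGerm hF hF' x).rep p ∈ modelTangent E M p := by
  have : CompleteSpace E := FiniteDimensional.complete ℂ E
  have : CompleteSpace C := FiniteDimensional.complete ℂ C
  obtain ⟨g, hg, hgφ, hφg⟩ := hφ.exists_symm ha
  filter_upwards [hφ.map.eventually_modelDeriv_eq hF hFφ,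
    (modelDeriv_modelValue_pullGerm hF hF' x).filter_mono nhdsWithin_le_nhds, hgφ,
    hφ.tendsto.eventually self_mem_nhdsWithin,
    hφ.tendsto.eventually hg.map.eventually_modelDeriv_mem,
    hφ.tendsto.eventually (hg.map.eventually_modelDeriv_left_inverse hφ.map hg.1 hφg),
    (eventually_isInvertible hF hF').filter_mono nhdsWithin_le_nhds]
    with p hFφp hpull hgφp hφp hgmem hφgx hinv
  have hxT := mem_modelTangent_tube hφp hx
  have hgx := hgmem x hxT
  have hFgx := hφgx x hxT
  rw [hgφp] at hgx hFgx
  rw [← hFφp _ hgx, ← hpull] at hFgx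
  rw [← injective_of_isInvertible hinv hFgx, hpull]
  exact hgx

theorem eventually_modelDeriv_pullGerm (hφ : IsCRIsoGerm E C M a (tube V B) c φ)
    (hFφ : ∀ᶠ p in 𝓝[M] a, F p = φ p) (ha : a ∈ M) {x : C} (hx : x ∈ V) :
    ∀ᶠ p in 𝓝[M] a, modelDeriv ℝ E C φ p (modelValue (pullGerm hF hF' x).rep p) = x := by
  filter_upwards [hφ.map.eventually_modelDeriv_eq hF hFφ,
    eventually_pullGerm_mem_modelTangent hF hF' hφ hFφ ha hx,
    (modelDeriv_modelValue_pullGerm hF hF' x).filter_mono nhdsWithin_le_nhds]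
    with p hFφp hmem hpull
  rw [← hFφp _ hmem, hpull]

theorem map_evalAt_span_pullSubalgebra (hV : IsRealForm V) :
    (Submodule.span ℂ (pullSubalgebra hF hF' V : Set (HolGerm E a))).map (evalAt a) = ⊤ := by
  refine eq_top_iff.2 fun e _ => ⟨pullGerm hF hF' (modelDeriv ℂ E C F a e), ?_, ?_⟩
  · have hle : (⊤ : Submodule ℂ C) ≤
        (Submodule.span ℂ (pullSubalgebra hF hF' V : Set (HolGerm E a))).comap
          (pullGerm hF hF') := by
      rw [← hV.span_eq_top, Submodule.span_le]
      exact fun x hx => Submodule.subset_span ((mem_pullSubalgebra hF hF').2 ⟨x, hx, rfl⟩)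
    exact hle Submodule.mem_top
  · exact injective_of_isInvertible hF' (modelDeriv_modelValue_pullGerm hF hF' _).self_of_nhds

theorem isAdmissible_pullSubalgebra (hV : IsRealForm V)
    (hφ : IsCRIsoGerm E C M a (tube V B) c φ) (hFφ : ∀ᶠ p in 𝓝[M] a, F p = φ p) (ha : a ∈ M) :
    IsAdmissible M a (pullSubalgebra hF hF' V) where
  le_holM := by
    rintro _ ⟨x, hx, rfl⟩
    exact eventually_pullGerm_mem_modelTangent hF hF' hφ hFφ ha hx
  abelian := by
    constructor
    rintro ⟨_, x, hx, rfl⟩ ⟨_, y, hy, rfl⟩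
    exact Subtype.ext (lie_pullGerm hF hF' x y)
  totallyReal := by
    rintro _ ⟨x, hx, rfl⟩ ⟨y, hy, hyx⟩
    have hIx : y = Complex.I • x := pullGerm_injective hF hF'
      (hyx.trans (map_smul (pullGerm hF hF') Complex.I x).symm)
    have hzero := hV.eq_zero hy (neg_mem hx) (by rw [hIx, smul_neg, add_neg_cancel])
    exact (congrArg (pullGerm hF hF') (neg_eq_zero.1 hzero.2)).trans (map_zero _)
  spans := map_evalAt_span_pullSubalgebra hF hF' hV

end PullSubalgebra

section Induces

variable {E : Type v} [NormedAddCommGroup E] [NormedSpace ℂ E]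
  {Z : Type u} [TopologicalSpace Z] [ChartedSpace E Z] {M : Set Z} {a : Z}

theorem TubeRealization.isRealForm (R : TubeRealization.{u, v, w} E M a) : IsRealForm R.V :=
  R.realForm

theorem TubeRealization.isGenericAt (R : TubeRealization.{u, v, w} E M a) :
    IsGenericAt R.C (tube R.V R.F) R.c :=
  isGenericAt_tube R.isRealForm R.submanifold R.c_mem

variable [FiniteDimensional ℂ E] [IsManifold 𝓘(ℂ, E) ω Z]

theorem TubeRealization.induces_iff {R : TubeRealization.{u, v, w} E M a} {𝔳 : Admissible E M a} :
    R.Induces 𝔳 ↔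
      (∀ ξ ∈ 𝔳.1, ∃ x ∈ R.V, ∀ᶠ p in 𝓝[M] a,
        modelDeriv ℝ E R.C R.φ p (modelValue ξ.rep p) = x) ∧
      ∀ x ∈ R.V, ∃ ξ ∈ 𝔳.1, ∀ᶠ p in 𝓝[M] a,
        modelDeriv ℝ E R.C R.φ p (modelValue ξ.rep p) = x := Iff.rfl

theorem TubeRealization.Induces.le {R : TubeRealization.{u, v, w} E M a}
    (hM : IsGenericAt E M a) {𝔳 𝔴 : Admissible E M a} (h𝔳 : R.Induces 𝔳) (h𝔴 : R.Induces 𝔴) :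
    𝔳.1 ≤ 𝔴.1 := by
  intro ξ hξ
  obtain ⟨x, hx, hφξ⟩ := (TubeRealization.induces_iff.1 h𝔳).1 ξ hξ
  obtain ⟨η, hη, hφη⟩ := (TubeRealization.induces_iff.1 h𝔴).2 x hx
  obtain ⟨g, hg, hgφ, -⟩ := R.isCRIso.exists_symm hM.mem
  suffices ξ = η by rwa [this]
  refine HolGerm.ext_of_generic hM.mem hM.eventually_span ?_
  filter_upwards [hφξ, hφη, 𝔳.2.mem_modelTangent hξ, 𝔴.2.mem_modelTangent hη,
    R.isCRIso.map.eventually_modelDeriv_left_inverse hg.map R.isCRIso.1 hgφ]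
    with p hξp hηp hξT hηT hleft
  rw [← hleft _ hξT, ← hleft _ hηT, hξp, hηp]

theorem TubeRealization.existsUnique_induces (R : TubeRealization.{u, v, w} E M a)
    (hM : IsGenericAt E M a) : ∃! 𝔳 : Admissible E M a, R.Induces 𝔳 := by
  obtain ⟨F, hF, -, hFφ, hF'⟩ := R.isCRIso.exists_extension hM R.isGenericAt
  have hinduces := fun x (hx : x ∈ R.V) =>
    eventually_modelDeriv_pullGerm hF hF' R.isCRIso hFφ hM.mem hx
  let 𝔳 : Admissible E M a :=
    ⟨_, isAdmissible_pullSubalgebra hF hF' R.isRealForm R.isCRIso hFφ hM.mem⟩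
  have h𝔳 : R.Induces 𝔳 := by
    refine TubeRealization.induces_iff.2 ⟨?_, fun x hx => ⟨_, ⟨x, hx, rfl⟩, hinduces x hx⟩⟩
    rintro _ ⟨x, hx, rfl⟩
    exact ⟨x, hx, hinduces x hx⟩
  exact ⟨𝔳, h𝔳, fun 𝔴 h𝔴 => Subtype.ext (le_antisymm (h𝔴.le hM h𝔳) (h𝔳.le hM h𝔴))⟩

end Induces

/-! ### Affine equivalence and conjugacy -/

section LinearAlgebra

theorem exists_linearEquiv_range_prod_ker {K V Q : Type*} [Field K] [AddCommGroup V] [Module K V]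
    [AddCommGroup Q] [Module K Q] (p : V →ₗ[K] Q) :
    ∃ e : V ≃ₗ[K] LinearMap.range p × LinearMap.ker p, ∀ v, ((e v).1 : Q) = p v := by
  obtain ⟨S, hS⟩ := (LinearMap.ker p).exists_isCompl
  refine ⟨LinearMap.equivProdOfSurjectiveOfIsCompl p.rangeRestrict
    ((LinearMap.ker p).projectionOnto S hS) p.range_rangeRestrict
    (Submodule.range_projectionOnto hS) ?_, fun v => rfl⟩
  rwa [LinearMap.ker_rangeRestrict, Submodule.ker_projectionOnto]

theorem exists_linearEquiv_of_range_eq {K V W Q : Type*} [Field K] [AddCommGroup V] [Module K V]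
    [AddCommGroup W] [Module K W] [AddCommGroup Q] [Module K Q] [Module.Finite K V]
    [Module.Finite K W] {p : V →ₗ[K] Q} {q : W →ₗ[K] Q}
    (hpq : LinearMap.range p = LinearMap.range q)
    (hVW : Module.finrank K V = Module.finrank K W) : ∃ e : V ≃ₗ[K] W, ∀ v, q (e v) = p v := by
  have hker : Module.finrank K (LinearMap.ker p) = Module.finrank K (LinearMap.ker q) := by
    have hp := p.finrank_range_add_finrank_ker
    have hq := q.finrank_range_add_finrank_ker
    rw [hpq] at hp
    omega
  obtain ⟨eV, heV⟩ := exists_linearEquiv_range_prod_ker p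
  obtain ⟨eW, heW⟩ := exists_linearEquiv_range_prod_ker q
  refine ⟨eV ≪≫ₗ (LinearEquiv.ofEq _ _ hpq).prodCongr (.ofFinrankEq _ _ hker) ≪≫ₗ eW.symm,
    fun v => ?_⟩
  rw [← heW, ← heV]
  simp

theorem exists_linearMap_mem_sub_mem {K U : Type*} [Field K] [AddCommGroup U] [Module K U]
    (V W : Submodule K U) : ∃ s : U →ₗ[K] U, (∀ u, s u ∈ W) ∧ ∀ u ∈ V ⊔ W, u - s u ∈ V := by
  let add : V × W →ₗ[K] U := V.subtype.coprod W.subtype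
  obtain ⟨t, ht⟩ := add.rangeRestrict.exists_rightInverse_of_surjective add.range_rangeRestrict
  obtain ⟨t', ht'⟩ := LinearMap.exists_extend t
  refine ⟨W.subtype ∘ₗ LinearMap.snd K V W ∘ₗ t', fun u => (t' u).2.2, fun u hu => ?_⟩
  have hrange : u ∈ LinearMap.range add := by
    obtain ⟨x, hx, y, hy, rfl⟩ := Submodule.mem_sup.1 hu
    exact ⟨(⟨x, hx⟩, ⟨y, hy⟩), rfl⟩
  have hext : t' u = t ⟨u, hrange⟩ := LinearMap.congr_fun ht' ⟨u, hrange⟩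
  have hsum : ((t' u).1 : U) + (t' u).2 = u := by
    rw [hext]; exact congrArg Subtype.val (LinearMap.congr_fun ht ⟨u, hrange⟩)
  change u - ((t' u).2 : U) ∈ V
  rw [← eq_sub_iff_add_eq.2 hsum]
  exact (t' u).1.2

theorem eventually_eq_top {K W α : Type*} [Field K] [AddCommGroup W] [Module K W]
    [Module.Finite K W] {l : Filter α} {S : α → Submodule K W}
    (h : ∀ w, ∀ᶠ p in l, w ∈ S p) : ∀ᶠ p in l, S p = ⊤ := by
  obtain ⟨s, hs⟩ := Module.Finite.fg_top (R := K) (M := W)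
  filter_upwards [(eventually_all_finset s).2 fun w _ => h w] with p hp
  rw [eq_top_iff, ← hs, Submodule.span_le]
  exact hp

theorem eventually_clm_eq {K C G α : Type*} [NontriviallyNormedField K] [NormedAddCommGroup C]
    [NormedSpace K C] [FiniteDimensional K C] [NormedAddCommGroup G] [NormedSpace K G]
    {l : Filter α} {f g : α → C →L[K] G} (h : ∀ x, ∀ᶠ p in l, f p x = g p x) :
    ∀ᶠ p in l, f p = g p := by
  have heq : ∀ᶠ p in l, LinearMap.eqLocus (f p : C →ₗ[K] G) (g p : C →ₗ[K] G) = ⊤ :=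
    eventually_eq_top h
  filter_upwards [heq] with p hp
  exact ContinuousLinearMap.coe_injective (LinearMap.eqLocus_eq_top.1 hp)

end LinearAlgebra

section RealForm

variable {C : Type*} [NormedAddCommGroup C] [NormedSpace ℂ C]

/-- The largest complex subspace `S ∩ iS` of a real subspace `S`, as a real subspace. -/
noncomputable def complexPart (S : Submodule ℝ C) : Submodule ℝ C :=
  S ⊓ S.comap (DistribSMul.toLinearMap ℝ C Complex.I)

theorem mem_complexPart {S : Submodule ℝ C} {x : C} :
    x ∈ complexPart S ↔ x ∈ S ∧ Complex.I • x ∈ S := Iff.rfl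

variable {V W : Submodule ℝ C}

theorem IsRealForm.map_mkQ_complexPart_le {S : Submodule ℝ C} (hV : IsRealForm V) (hVS : V ≤ S)
    (hWS : W ≤ S) : W.map (complexPart S).mkQ ≤ V.map (complexPart S).mkQ := by
  rintro _ ⟨w, hw, rfl⟩
  obtain ⟨x, hx, y, hy, rfl⟩ := hV.exists_eq w
  refine ⟨x, hx, ?_⟩
  rw [Submodule.mkQ_apply, Submodule.mkQ_apply, eq_comm, Submodule.Quotient.eq]
  refine mem_complexPart.2 ⟨sub_mem (hWS hw) (hVS hx), ?_⟩
  rw [add_sub_cancel_left, smul_smul, Complex.I_mul_I, neg_smul, one_smul]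
  exact neg_mem (hVS hy)

theorem add_mem_tube_iff (F : Set V) {z x : C} (hx : x ∈ V) : z + x ∈ tube V F ↔ z ∈ tube V F :=
  ⟨fun h => by simpa using add_mem_tube F h (neg_mem hx), fun h => add_mem_tube F h hx⟩

variable {C' : Type*} [NormedAddCommGroup C'] [NormedSpace ℂ C'] {V' : Submodule ℝ C'}

theorem IsRealForm.comap (hV' : IsRealForm V') (D : C ≃L[ℂ] C') :
    IsRealForm (V'.comap ((D : C →L[ℂ] C').restrictScalars ℝ : C →ₗ[ℝ] C')) := by
  intro z
  obtain ⟨x, hx, y, hy, hz⟩ := hV'.exists_eq (D z)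
  refine ⟨(⟨D.symm x, by simpa⟩, ⟨D.symm y, by simpa⟩), ?_, ?_⟩
  · change D.symm x + Complex.I • D.symm y = z
    rw [← map_smul, ← map_add, ← hz, D.symm_apply_apply]
  · rintro ⟨⟨x', hx'⟩, ⟨y', hy'⟩⟩ h
    have hD : D x' + Complex.I • D y' = D z := by
      rw [← map_smul, ← map_add]
      exact congrArg D h
    have hzero := hV'.eq_zero (sub_mem hx' hx) (sub_mem hy' hy)
      (by rw [smul_sub, sub_add_sub_comm, ← hz]; exact sub_eq_zero.2 hD)
    ext
    · exact (D.symm_apply_eq.2 (sub_eq_zero.1 hzero.1).symm).symm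
    · exact (D.symm_apply_eq.2 (sub_eq_zero.1 hzero.2).symm).symm

variable [FiniteDimensional ℂ C]

theorem reIm_I_smul (hV : IsRealForm V) (z : C) :
    reIm hV (Complex.I • z) = (-(reIm hV z).2, (reIm hV z).1) := by
  rw [← reIm_add hV (-(reIm hV z).2) (reIm hV z).1]
  congr 1
  conv_lhs => rw [← re_add_im hV z]
  rw [smul_add, smul_smul, Complex.I_mul_I]
  simp [add_comm]

theorem IsRealForm.mem_iff_im_eq_zero (hV : IsRealForm V) {z : C} :
    z ∈ V ↔ (reIm hV z).2 = 0 := by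
  refine ⟨fun hz => congrArg Prod.snd (reIm_coe hV ⟨z, hz⟩), fun h => ?_⟩
  rw [← re_add_im hV z, h]
  simp

theorem IsRealForm.finrank (hV : IsRealForm V) :
    Module.finrank ℝ C = Module.finrank ℝ V + Module.finrank ℝ V := by
  rw [(reIm hV).toLinearEquiv.finrank_eq, Module.finrank_prod]

/-- The complex linear extension of a real linear map. -/
noncomputable def IsRealForm.extend (hV : IsRealForm V) (f : V →ₗ[ℝ] C') : C →ₗ[ℂ] C' where
  toFun z := f (reIm hV z).1 + Complex.I • f (reIm hV z).2
  map_add' x y := by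
    simp only [map_add, Prod.fst_add, Prod.snd_add, smul_add]; abel
  map_smul' r z := by
    have hreIm : reIm hV (r • z) = r.re • reIm hV z + r.im • reIm hV (Complex.I • z) := by
      rw [← map_smul, ← map_smul, ← map_add]
      congr 1
      conv_lhs => rw [← Complex.re_add_im r, add_smul, mul_smul]
      rfl
    rw [hreIm, reIm_I_smul]
    simp only [Prod.fst_add, Prod.snd_add, Prod.smul_fst, Prod.smul_snd, map_add, map_smul, map_neg,
      RingHom.id_apply]
    conv_rhs => rw [← Complex.re_add_im r]
    simp only [← Complex.coe_smul, smul_add, smul_neg, add_smul, mul_smul]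
    rw [smul_comm Complex.I, smul_comm Complex.I (r.im : ℂ), smul_smul Complex.I Complex.I,
      Complex.I_mul_I, neg_smul, one_smul, smul_neg]
    abel

theorem IsRealForm.extend_apply (hV : IsRealForm V) (f : V →ₗ[ℝ] C') (z : C) :
    hV.extend f z = f (reIm hV z).1 + Complex.I • f (reIm hV z).2 := rfl

section

variable [FiniteDimensional ℂ C']

/-- The complex linear extension of an isomorphism between real forms. -/
noncomputable def IsRealForm.extendEquiv (hV : IsRealForm V) (hV' : IsRealForm V')
    (e : V ≃ₗ[ℝ] V') : C ≃ₗ[ℂ] C' :=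
  LinearEquiv.ofLinearMap (hV.extend (V'.subtype ∘ₗ e)) (hV'.extend (V.subtype ∘ₗ e.symm))
    (by ext z; simp [extend_apply, reIm_add, re_add_im])
    (by ext z; simp [extend_apply, reIm_add, re_add_im])

theorem IsRealForm.extendEquiv_apply (hV : IsRealForm V) (hV' : IsRealForm V') (e : V ≃ₗ[ℝ] V')
    (z : C) : hV.extendEquiv hV' e z = e (reIm hV z).1 + Complex.I • (e (reIm hV z).2 : C') := rfl

theorem IsRealForm.extendEquiv_mem_iff (hV : IsRealForm V) (hV' : IsRealForm V') (e : V ≃ₗ[ℝ] V')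
    {z : C} : hV.extendEquiv hV' e z ∈ V' ↔ z ∈ V := by
  rw [hV'.mem_iff_im_eq_zero, hV.mem_iff_im_eq_zero, extendEquiv_apply, reIm_add,
    EmbeddingLike.map_eq_zero_iff]

end

theorem IsRealForm.exists_equiv_sub_mem (hV : IsRealForm V) (hW : IsRealForm W) :
    ∃ A : C ≃ₗ[ℂ] C, (∀ z, A z ∈ W ↔ z ∈ V) ∧ ∀ z, A z - z ∈ V ⊔ W := by
  set H := complexPart (V ⊔ W)
  have hrange : LinearMap.range (H.mkQ ∘ₗ V.subtype) = LinearMap.range (H.mkQ ∘ₗ W.subtype) := by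
    rw [LinearMap.range_comp, LinearMap.range_comp, Submodule.range_subtype,
      Submodule.range_subtype]
    exact le_antisymm (hW.map_mkQ_complexPart_le le_sup_right le_sup_left)
      (hV.map_mkQ_complexPart_le le_sup_left le_sup_right)
  obtain ⟨e, he⟩ := exists_linearEquiv_of_range_eq hrange (by
    have := hV.finrank; have := hW.finrank; omega)
  have heH (x : V) : (e x : C) - x ∈ H := (Submodule.Quotient.eq H).1 (he x)
  refine ⟨hV.extendEquiv hW e, fun z => hV.extendEquiv_mem_iff hW e, fun z => ?_⟩
  have hsub : hV.extendEquiv hW e z - z = ((e (reIm hV z).1 : C) - (reIm hV z).1) +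
      Complex.I • ((e (reIm hV z).2 : C) - (reIm hV z).2) := by
    conv_lhs => rw [hV.extendEquiv_apply, ← re_add_im hV z, reIm_add]
    rw [smul_sub]
    abel
  rw [hsub]
  exact add_mem (mem_complexPart.1 (heH _)).1 (mem_complexPart.1 (heH _)).2

/-- The tube germ is invariant under `V` and under `W = D⁻¹(V')`, and `D'` is `D` composed with an
automorphism that moves `V` to `W` and is the identity modulo `V + W`. -/
theorem exists_adapted_equiv (hV : IsRealForm V) (hV' : IsRealForm V') {F : Set V} {F' : Set V'}
    {c : C} {c' : C'} (D : C ≃L[ℂ] C')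
    (h : ∀ᶠ z in 𝓝 c, z ∈ tube V F ↔ c' + D (z - c) ∈ tube V' F') :
    ∃ D' : C ≃L[ℂ] C', (∀ x, D' x ∈ V' ↔ x ∈ V) ∧
      ∀ᶠ z in 𝓝 c, z ∈ tube V F ↔ c' + D' (z - c) ∈ tube V' F' := by
  set W : Submodule ℝ C := V'.comap ((D : C →L[ℂ] C').restrictScalars ℝ : C →ₗ[ℝ] C')
  have hDW (w) : w ∈ W ↔ D w ∈ V' := Iff.rfl
  obtain ⟨A, hA, hAVW⟩ := hV.exists_equiv_sub_mem (hV'.comap D)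
  obtain ⟨s, hsW, hsV⟩ := exists_linearMap_mem_sub_mem V W
  let A' : C ≃L[ℂ] C := A.toContinuousLinearEquiv
  refine ⟨A'.trans D, fun x => (hDW (A x)).symm.trans (hA x), ?_⟩
  have hs : Continuous s := s.continuous_of_finiteDimensional
  have htranslate : Tendsto (fun z => z + s (A' (z - c) - (z - c))) (𝓝 c) (𝓝 c) := by
    have hcont : Continuous fun z => z + s (A' (z - c) - (z - c)) := by fun_prop
    simpa using hcont.tendsto c
  have hrotate : Tendsto (fun z => c + A' (z - c)) (𝓝 c) (𝓝 c) := by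
    have hcont : Continuous fun z => c + A' (z - c) := by fun_prop
    simpa using hcont.tendsto c
  filter_upwards [h, htranslate.eventually h, hrotate.eventually h] with z hz hz_translate hz_rotate
  set k := A' (z - c) - (z - c) with hk
  have hAz : c + A' (z - c) = z + s k + (k - s k) := by rw [hk]; abel
  have hDz : c' + D (z + s k - c) = c' + D (z - c) + D (s k) := by
    rw [add_assoc, ← map_add]; congr 2; abel
  calc z ∈ tube V F
      ↔ c' + D (z - c) ∈ tube V' F' := hz
    _ ↔ c' + D (z + s k - c) ∈ tube V' F' := by
        rw [hDz, add_mem_tube_iff F' ((hDW _).1 (hsW k))]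
    _ ↔ z + s k ∈ tube V F := hz_translate.symm
    _ ↔ c + A' (z - c) ∈ tube V F := by
        rw [hAz, add_mem_tube_iff F (hsV k (hAVW (z - c)))]
    _ ↔ c' + D (A' (z - c)) ∈ tube V' F' := by rw [hz_rotate, add_sub_cancel_left]

end RealForm

section AffineMaps

variable {C C' : Type*} [NormedAddCommGroup C] [NormedSpace ℂ C] [NormedAddCommGroup C']
  [NormedSpace ℂ C'] {f : C → C'} {c : C}

theorem eventually_eq_of_fderiv_eq_zero (hf : ∀ᶠ z in 𝓝 c, DifferentiableAt ℂ f z)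
    (hf' : ∀ᶠ z in 𝓝 c, fderiv ℂ f z = 0) : ∀ᶠ z in 𝓝 c, f z = f c := by
  obtain ⟨r, hr, hball⟩ := Metric.eventually_nhds_iff_ball.1 (hf.and hf')
  filter_upwards [Metric.ball_mem_nhds c hr] with z hz
  exact Metric.isOpen_ball.is_const_of_fderiv_eq_zero (𝕜 := ℂ) (convex_ball c r).isPreconnected
    (fun w hw => (hball w hw).1.differentiableWithinAt) (fun w hw => (hball w hw).2)
    hz (Metric.mem_ball_self hr)

theorem eventually_eq_affine_of_fderiv_eq (hf : ∀ᶠ z in 𝓝 c, DifferentiableAt ℂ f z)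
    (hf' : ∀ᶠ z in 𝓝 c, fderiv ℂ f z = fderiv ℂ f c) :
    ∀ᶠ z in 𝓝 c, f z = f c + fderiv ℂ f c (z - c) := by
  have hsub : ∀ᶠ z in 𝓝 c,
      HasFDerivAt (fun z => f z - fderiv ℂ f c z) (0 : C →L[ℂ] C') z := by
    filter_upwards [hf, hf'] with z hz hz'
    simpa only [hz', sub_self] using hz.hasFDerivAt.fun_sub (fderiv ℂ f c).hasFDerivAt
  filter_upwards [eventually_eq_of_fderiv_eq_zero (hsub.mono fun z hz => hz.differentiableAt)
    (hsub.mono fun z hz => hz.fderiv)] with z hz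
  rw [map_sub, eq_add_of_sub_eq hz]
  abel

variable [FiniteDimensional ℂ C] {V : Submodule ℝ C}

theorem eventually_eq_affine_of_fderiv_eqOn_tube [CompleteSpace C'] (hV : IsRealForm V)
    {F : Set V} (hc : c ∈ tube V F) (hf : ContDiffAt ℂ ω f c)
    (h : ∀ x ∈ V, ∃ y, ∀ᶠ z in 𝓝[tube V F] c, fderiv ℂ f z x = y) :
    ∀ᶠ z in 𝓝 c, f z = f c + fderiv ℂ f c (z - c) := by
  have hreal : ∀ x ∈ V, ∀ᶠ z in 𝓝 c, fderiv ℂ f z x = fderiv ℂ f c x := by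
    intro x hx
    obtain ⟨y, hy⟩ := h x hx
    have hsmooth : ContDiffAt ℂ ω (fun z => fderiv ℂ f z x - fderiv ℂ f c x) c :=
      ((hf.fderiv_right (m := ω) le_top).clm_apply contDiffAt_const).sub contDiffAt_const
    have hzero := eventually_eq_zero_of_span_modelTangent hc
      (eventually_nhdsWithin_of_forall fun p hp => span_modelTangent_tube hV hp) hsmooth
      (hy.mono fun z hz => by rw [hz, hy.self_of_nhdsWithin hc, sub_self])
    exact hzero.mono fun z hz => sub_eq_zero.1 hz
  refine eventually_eq_affine_of_fderiv_eq
    ((hf.eventually (by simp)).mono fun z hz => hz.differentiableAt (by simp))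
    (eventually_clm_eq fun w => ?_)
  obtain ⟨x, hx, y, hy, rfl⟩ := hV.exists_eq w
  filter_upwards [hreal x hx, hreal y hy] with z hzx hzy
  rw [map_add, map_add, map_smul, map_smul, hzx, hzy]

end AffineMaps

section AffineGerms

variable {C C' : Type*} [NormedAddCommGroup C] [NormedSpace ℂ C] [NormedAddCommGroup C']
  [NormedSpace ℂ C'] {T : Set C} {T' : Set C'} {c : C} {c' : C'}

theorem tendsto_affine (D : C →L[ℂ] C') (c : C) (c' : C') :
    Tendsto (fun z => c' + D (z - c)) (𝓝 c) (𝓝 c') := by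
  have hcont : Continuous fun z => c' + D (z - c) := by fun_prop
  simpa using hcont.tendsto c

theorem hasFDerivAt_affine (D : C →L[ℂ] C') (c : C) (c' : C') (z : C) :
    HasFDerivAt (fun z => c' + D (z - c)) D z :=
  (D.hasFDerivAt.comp z ((hasFDerivAt_id z).sub_const c)).const_add c'

theorem modelDeriv_affine (D : C →L[ℂ] C') (c : C) (c' : C') (z x : C) :
    modelDeriv ℝ C C' (fun z => c' + D (z - c)) z x = D x := by
  rw [modelDeriv_eq_fderiv, ((hasFDerivAt_affine D c c' z).restrictScalars ℝ).fderiv]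
  rfl

theorem isCRMapGerm_affine (D : C →L[ℂ] C') (h : ∀ᶠ z in 𝓝[T] c, c' + D (z - c) ∈ T') :
    IsCRMapGerm C C' T c T' (fun z => c' + D (z - c)) := by
  refine isCRMapGerm_of_holomorphic (contMDiffAt_iff_contDiffAt.2 ?_) h
  exact contDiffAt_const.add (D.contDiff.contDiffAt.comp c (contDiffAt_id.sub contDiffAt_const))

theorem isCRIsoGerm_affine (D : C ≃L[ℂ] C') (h : ∀ᶠ z in 𝓝 c, z ∈ T ↔ c' + D (z - c) ∈ T') :
    IsCRIsoGerm C C' T c T' c' (fun z => c' + D (z - c)) := by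
  refine ⟨by simp, isCRMapGerm_affine (D : C →L[ℂ] C') ?_, fun w => c + D.symm (w - c'),
    isCRMapGerm_affine (D.symm : C' →L[ℂ] C) ?_, Eventually.of_forall fun z => by simp,
    Eventually.of_forall fun z => by simp⟩
  · exact eventually_nhdsWithin_iff.2 (h.mono fun z hz => hz.1)
  · refine eventually_nhdsWithin_iff.2
      (((tendsto_affine (D.symm : C' →L[ℂ] C) c' c).eventually h).mono fun w hw hwT' => hw.2 ?_)
    simpa using hwT'

theorem IsCRIsoGerm.eventually_mem_iff_of_eq_affine {f : C → C'} (hc : c ∈ T)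
    (hf : IsCRIsoGerm C C' T c T' c' f) (D : C ≃L[ℂ] C')
    (hfD : ∀ᶠ z in 𝓝[T] c, f z = c' + D (z - c)) :
    ∀ᶠ z in 𝓝 c, z ∈ T ↔ c' + D (z - c) ∈ T' := by
  obtain ⟨k, hk, -, hfk⟩ := hf.exists_symm hc
  have hback : ∀ᶠ q in 𝓝[T'] c', k q ∈ T ∧ q = c' + D (k q - c) := by
    filter_upwards [hfk, hk.map.mapsTo, hk.tendsto.eventually hfD] with q hfkq hkq hfDq
    exact ⟨hkq, by rw [← hfDq, hfkq]⟩
  filter_upwards [eventually_nhdsWithin_iff.1 (hf.map.mapsTo.and hfD),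
    (tendsto_affine (D : C →L[ℂ] C') c c').eventually (eventually_nhdsWithin_iff.1 hback)]
    with z hfz hbackz
  refine ⟨fun hz => ?_, fun hz => ?_⟩
  · rw [← (hfz hz).2]
    exact (hfz hz).1
  · obtain ⟨hkz, heq⟩ := hbackz hz
    rw [ContinuousLinearEquiv.coe_coe, add_right_inj, D.injective.eq_iff, sub_left_inj] at heq
    rwa [heq]

end AffineGerms

section Classes

variable {E : Type v} [NormedAddCommGroup E] [NormedSpace ℂ E]
  {Z : Type u} [TopologicalSpace Z] [ChartedSpace E Z]
  {M : Set Z} {a : Z} {R R' : TubeRealization.{u, v, w} E M a}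

theorem affEquiv_iff : AffEquiv E M a R R' ↔ ∃ D : R.C ≃L[ℂ] R'.C,
    ∀ᶠ z in 𝓝 R.c, z ∈ tube R.V R.F ↔ R'.c + D (z - R.c) ∈ tube R'.V R'.F := by
  constructor
  · rintro ⟨l, hlc, hl⟩
    refine ⟨l.linear.toContinuousLinearEquiv, ?_⟩
    filter_upwards [hl] with z hz
    have hlz : l z = R'.c + l.linear (z - R.c) := by
      simpa [hlc, add_comm] using l.map_vadd R.c (z - R.c)
    rwa [hlz] at hz
  · rintro ⟨D, hD⟩
    let l : R.C ≃ᵃ[ℂ] R'.C :=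
      ((AffineEquiv.vaddConst ℂ R.c).symm.trans D.toLinearEquiv.toAffineEquiv).trans
        (AffineEquiv.vaddConst ℂ R'.c)
    have hl (z) : l z = R'.c + D (z - R.c) := by simp [l, add_comm]
    refine ⟨l, by simp [hl], ?_⟩
    filter_upwards [hD] with z hz
    rw [hl]
    exact hz

theorem IsCRIsoGerm.exists_eventually_eq_affine {f : R.C → R'.C}
    (hf : IsCRIsoGerm R.C R'.C (tube R.V R.F) R.c (tube R'.V R'.F) R'.c f)
    (hconst : ∀ x ∈ R.V, ∃ y, ∀ᶠ z in 𝓝[tube R.V R.F] R.c, modelDeriv ℝ R.C R'.C f z x = y) :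
    ∃ D : R.C ≃L[ℂ] R'.C, ∀ᶠ z in 𝓝[tube R.V R.F] R.c, f z = R'.c + D (z - R.c) := by
  have : CompleteSpace R'.C := FiniteDimensional.complete ℂ R'.C
  obtain ⟨G, hG, hGc, hGf, D, hD⟩ := hf.exists_extension R.isGenericAt R'.isGenericAt
  refine ⟨D, ?_⟩
  have haffine := eventually_eq_affine_of_fderiv_eqOn_tube R.isRealForm R.c_mem hG.contDiffAt
    fun x hx => by
      obtain ⟨y, hy⟩ := hconst x hx
      refine ⟨y, ?_⟩
      filter_upwards [hy, hf.map.eventually_modelDeriv_eq hG hGf, self_mem_nhdsWithin]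
        with z hyz hGz hz
      rw [← hyz, ← hGz x (mem_modelTangent_tube hz hx), modelDeriv_eq_fderiv]
  rw [hGc, ← modelDeriv_eq_fderiv, ← hD] at haffine
  filter_upwards [hGf, haffine.filter_mono nhdsWithin_le_nhds] with z hGz hz
  rw [← hGz, hz]
  rfl

variable [IsManifold 𝓘(ℂ, E) ω Z]

theorem pushes_of_affine {D : R.C ≃L[ℂ] R'.C} {ψ : R'.C → Z} (hψ : IsCRIsoGerm R'.C E
      (tube R'.V R'.F) R'.c M a ψ) (hψφ : ∀ᶠ p in 𝓝[M] a, ψ (R'.φ p) = p)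
    (hφψ : ∀ᶠ q in 𝓝[tube R'.V R'.F] R'.c, R'.φ (ψ q) = q)
    (hD : IsCRIsoGerm R.C R'.C (tube R.V R.F) R.c (tube R'.V R'.F) R'.c
      fun z => R'.c + D (z - R.c)) {ξ η : HolGerm E a}
    (hη : ∀ᶠ p in 𝓝[M] a, modelValue η.rep p ∈ modelTangent E M p) {x : R.C}
    (hξx : ∀ᶠ p in 𝓝[M] a, modelDeriv ℝ E R.C R.φ p (modelValue ξ.rep p) = x)
    (hηx : ∀ᶠ p in 𝓝[M] a, modelDeriv ℝ E R'.C R'.φ p (modelValue η.rep p) = D x) :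
    Pushes M a (fun p => ψ (R'.c + D (R.φ p - R.c))) ξ η := by
  have hDφ := hD.comp R.isCRIso R.c_mem
  have hg := (hψ.comp hDφ R'.c_mem).tendsto
  refine pushes_iff.2 ?_
  filter_upwards [hξx, hg.eventually hηx, hg.eventually hη,
    hg.eventually (R'.isCRIso.map.eventually_modelDeriv_left_inverse hψ.map R'.isCRIso.1 hψφ),
    R.isCRIso.map.eventually_mdifferentiableAt,
    R.isCRIso.tendsto.eventually hD.map.eventually_mdifferentiableAt,
    hDφ.map.eventually_mdifferentiableAt,
    hDφ.tendsto.eventually hψ.map.eventually_mdifferentiableAt, hDφ.tendsto.eventually hφψ]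
    with p hξp hηp hηmem hleft hφ_diff hD_diff hDφ_diff hψ_diff hφψp
  have hback := hleft _ hηmem
  rw [hφψp, hηp] at hback
  rw [modelDeriv_comp hDφ_diff hψ_diff, ContinuousLinearMap.comp_apply,
    modelDeriv_comp (g := fun z => R'.c + D (z - R.c)) hφ_diff hD_diff,
    ContinuousLinearMap.comp_apply, hξp]
  exact (congrArg _ (modelDeriv_affine (D : R.C →L[ℂ] R'.C) R.c R'.c _ x)).trans hback

theorem eventually_modelDeriv_comp_eq_of_pushes {g : Z → Z} {ψ : R.C → Z}
    (hg : IsCRIsoGerm E E M a M a g) (hψ : IsCRIsoGerm R.C E (tube R.V R.F) R.c M a ψ)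
    (hψφ : ∀ᶠ p in 𝓝[M] a, ψ (R.φ p) = p)
    (hφψ : ∀ᶠ z in 𝓝[tube R.V R.F] R.c, R.φ (ψ z) = z) (ha : a ∈ M) {ξ η : HolGerm E a}
    (hξ : ∀ᶠ p in 𝓝[M] a, modelValue ξ.rep p ∈ modelTangent E M p) {x : R.C} {y : R'.C}
    (hξx : ∀ᶠ p in 𝓝[M] a, modelDeriv ℝ E R.C R.φ p (modelValue ξ.rep p) = x)
    (hgξ : Pushes M a g ξ η)
    (hηy : ∀ᶠ p in 𝓝[M] a, modelDeriv ℝ E R'.C R'.φ p (modelValue η.rep p) = y) :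
    ∀ᶠ z in 𝓝[tube R.V R.F] R.c, modelDeriv ℝ R.C R'.C (fun z => R'.φ (g (ψ z))) z x = y := by
  have hgψ := hg.comp hψ ha
  filter_upwards [hψ.tendsto.eventually hξx, hψ.tendsto.eventually (pushes_iff.1 hgξ),
    hgψ.tendsto.eventually hηy, hψ.tendsto.eventually hξ,
    hψ.tendsto.eventually
      (R.isCRIso.map.eventually_modelDeriv_left_inverse hψ.map R.isCRIso.1 hψφ), hφψ,
    hψ.map.eventually_mdifferentiableAt,
    hψ.tendsto.eventually hg.map.eventually_mdifferentiableAt,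
    hgψ.tendsto.eventually R'.isCRIso.map.eventually_mdifferentiableAt,
    hgψ.map.eventually_mdifferentiableAt]
    with z hξz hgz hηz hξmem hleft hφψz hψ_diff hg_diff hφ_diff hgψ_diff
  have hψx := hleft _ hξmem
  rw [hξz, hφψz] at hψx
  rw [modelDeriv_comp (f := fun z => g (ψ z)) hgψ_diff hφ_diff, ContinuousLinearMap.comp_apply,
    modelDeriv_comp hψ_diff hg_diff, ContinuousLinearMap.comp_apply, hψx, hgz, hηz]

variable [FiniteDimensional ℂ E] {𝔳 𝔳' : Admissible E M a}

theorem AffEquiv.conjugate (ha : a ∈ M) (h : AffEquiv E M a R R') (h𝔳 : R.Induces 𝔳)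
    (h𝔳' : R'.Induces 𝔳') : Conjugate M a 𝔳 𝔳' := by
  obtain ⟨D₀, hD₀⟩ := affEquiv_iff.1 h
  obtain ⟨D, hDV, hD⟩ := exists_adapted_equiv R.isRealForm R'.isRealForm D₀ hD₀
  have hl := isCRIsoGerm_affine D hD
  obtain ⟨ψ, hψ, hψφ, hφψ⟩ := R'.isCRIso.exists_symm ha
  rw [TubeRealization.induces_iff] at h𝔳 h𝔳'
  refine ⟨_, hψ.comp (hl.comp R.isCRIso R.c_mem) R'.c_mem, fun ξ hξ => ?_, fun η hη => ?_⟩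
  · obtain ⟨x, hx, hξx⟩ := h𝔳.1 ξ hξ
    obtain ⟨η, hη, hηx⟩ := h𝔳'.2 (D x) ((hDV x).2 hx)
    exact ⟨η, hη, pushes_of_affine hψ hψφ hφψ hl (𝔳'.2.mem_modelTangent hη) hξx hηx⟩
  · obtain ⟨y, hy, hηy⟩ := h𝔳'.1 η hη
    obtain ⟨ξ, hξ, hξx⟩ := h𝔳.2 (D.symm y) ((hDV _).1 (by simpa))
    exact ⟨ξ, hξ, pushes_of_affine hψ hψφ hφψ hl (𝔳'.2.mem_modelTangent hη) hξx (by simpa)⟩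

theorem Conjugate.affEquiv (ha : a ∈ M) (h : Conjugate M a 𝔳 𝔳') (h𝔳 : R.Induces 𝔳)
    (h𝔳' : R'.Induces 𝔳') : AffEquiv E M a R R' := by
  obtain ⟨g, hg, hg𝔳, -⟩ := h
  obtain ⟨ψ, hψ, hψφ, hφψ⟩ := R.isCRIso.exists_symm ha
  have hf := R'.isCRIso.comp (hg.comp hψ ha) ha
  obtain ⟨D, hD⟩ := hf.exists_eventually_eq_affine fun x hx => by
    obtain ⟨ξ, hξ, hξx⟩ := (TubeRealization.induces_iff.1 h𝔳).2 x hx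
    obtain ⟨η, hη, hgξ⟩ := hg𝔳 ξ hξ
    obtain ⟨y, -, hηy⟩ := (TubeRealization.induces_iff.1 h𝔳').1 η hη
    exact ⟨y, eventually_modelDeriv_comp_eq_of_pushes hg hψ hψφ hφψ ha
      (𝔳.2.mem_modelTangent hξ) hξx hgξ hηy⟩
  exact affEquiv_iff.2 ⟨D, hf.eventually_mem_iff_of_eq_affine R.c_mem D hD⟩

end Classes

/-! ### Primitives of holomorphic maps -/

section Primitive

theorem hasSum_sub_of_hasDerivAt_tsum {G : Type*} [NormedAddCommGroup G] [NormedSpace ℝ G]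
    [CompleteSpace G] {g : ℝ → G} {u : ℕ → G} (hu : Summable fun n => ‖u n‖)
    (hg : ∀ t ∈ Icc (0 : ℝ) 1, HasDerivAt g (∑' n, t ^ n • u n) t) :
    HasSum (fun n : ℕ => ((n : ℝ) + 1)⁻¹ • u n) (g 1 - g 0) := by
  have hbound : ∀ n : ℕ, ∀ t ∈ Icc (0 : ℝ) 1, ‖t ^ n • u n‖ ≤ ‖u n‖ := fun n t ht => by
    rw [norm_smul, norm_pow, Real.norm_of_nonneg ht.1]
    exact mul_le_of_le_one_left (norm_nonneg _) (pow_le_one₀ ht.1 ht.2)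
  have hsum : ∀ t ∈ Icc (0 : ℝ) 1, HasSum (fun n => t ^ n • u n) (∑' n, t ^ n • u n) :=
    fun t ht => (hu.of_norm_bounded fun n => hbound n t ht).hasSum
  have hcont : ContinuousOn (fun t : ℝ => ∑' n, t ^ n • u n) (Icc 0 1) :=
    continuousOn_tsum (fun n => by fun_prop) hu hbound
  have hIcc : ∀ t ∈ uIoc (0 : ℝ) 1, t ∈ Icc (0 : ℝ) 1 := fun t ht =>
    uIcc_of_le (zero_le_one (α := ℝ)) ▸ uIoc_subset_uIcc ht
  have hint := intervalIntegral.hasSum_integral_of_dominated_convergence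
    (μ := MeasureTheory.volume) (F := fun n (t : ℝ) => t ^ n • u n) (fun n _ => ‖u n‖)
    (fun n => Continuous.aestronglyMeasurable (by fun_prop))
    (fun n => Eventually.of_forall fun t ht => hbound n t (hIcc t ht))
    (Eventually.of_forall fun _ _ => hu) intervalIntegrable_const
    (Eventually.of_forall fun t ht => hsum t (hIcc t ht))
  rw [← uIcc_of_le zero_le_one] at hg hcont
  rw [intervalIntegral.integral_eq_sub_of_hasDerivAt hg hcont.intervalIntegrable] at hint
  refine hint.congr_fun fun n => ?_
  rw [intervalIntegral.integral_smul_const, integral_pow]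
  simp

variable {E G : Type*} [NormedAddCommGroup E] [NormedSpace ℂ E] [NormedAddCommGroup G]
  [NormedSpace ℂ G]

/-- The term-by-term primitive, with constant term `b`, of a power series of one-forms. -/
noncomputable def primitiveSeries (b : G) (p : FormalMultilinearSeries ℂ E (E →L[ℂ] G)) :
    FormalMultilinearSeries ℂ E G
  | 0 => ContinuousMultilinearMap.uncurry0 ℂ E b
  | n + 1 => ((n : ℂ) + 1)⁻¹ • ContinuousMultilinearMap.uncurryRight (Ei := fun _ => E) (p n)

theorem primitiveSeries_zero_apply (b : G) (p : FormalMultilinearSeries ℂ E (E →L[ℂ] G))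
    (m : Fin 0 → E) : primitiveSeries b p 0 m = b := rfl

theorem primitiveSeries_succ_apply (b : G) (p : FormalMultilinearSeries ℂ E (E →L[ℂ] G)) (n : ℕ)
    (y : E) : primitiveSeries b p (n + 1) (fun _ => y) = ((n : ℝ) + 1)⁻¹ • p n (fun _ => y) y := by
  rw [← Complex.coe_smul]
  push_cast
  rfl

theorem norm_primitiveSeries_succ_le (b : G) (p : FormalMultilinearSeries ℂ E (E →L[ℂ] G)) (n : ℕ) :
    ‖primitiveSeries b p (n + 1)‖ ≤ ‖p n‖ := by
  rw [primitiveSeries, norm_smul, ContinuousMultilinearMap.uncurryRight_norm, norm_inv,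
    ← Nat.cast_succ, Complex.norm_natCast]
  exact mul_le_of_le_one_left (by positivity) (inv_le_one_of_one_le₀ (by simp))

theorem radius_le_radius_primitiveSeries (b : G) (p : FormalMultilinearSeries ℂ E (E →L[ℂ] G)) :
    p.radius ≤ (primitiveSeries b p).radius := by
  refine ENNReal.le_of_forall_nnreal_lt fun ρ hρ =>
    FormalMultilinearSeries.le_radius_of_summable _ ((summable_nat_add_iff 1).1 ?_)
  refine ((p.summable_norm_mul_pow hρ).mul_right (ρ : ℝ)).of_nonneg_of_le
    (fun n => by positivity) fun n => ?_
  rw [pow_succ, ← mul_assoc]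
  gcongr
  exact norm_primitiveSeries_succ_le b p n

theorem tsum_smul_apply_of_hasFPowerSeriesOnBall {f' : E → E →L[ℂ] G} {a y : E}
    {r : ENNReal} {p : FormalMultilinearSeries ℂ E (E →L[ℂ] G)}
    (hp : HasFPowerSeriesOnBall f' p a r) {t : ℝ}
    (hy : t • y ∈ Metric.eball (0 : E) r) :
    ∑' n, t ^ n • p n (fun _ => y) y = f' (a + t • y) y := by
  refine (((hp.hasSum hy).mapL (ContinuousLinearMap.apply ℂ G y)).congr_fun fun n => ?_).tsum_eq
  have := (p n).map_smul_univ (fun _ => (t : ℂ)) fun _ => y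
  simp only [Finset.prod_const, Finset.card_univ, Fintype.card_fin, Complex.coe_smul] at this
  rw [ContinuousLinearMap.apply_apply, this, ← Complex.ofReal_pow, Complex.coe_smul]
  rfl

theorem smul_mem_eball {r : ENNReal} {y : E} (hy : y ∈ Metric.eball (0 : E) r) {t : ℝ}
    (ht : t ∈ Icc (0 : ℝ) 1) : t • y ∈ Metric.eball (0 : E) r := by
  rw [Metric.mem_eball, edist_zero_right] at hy ⊢
  refine lt_of_le_of_lt ?_ hy
  rw [enorm_smul]
  refine mul_le_of_le_one_left zero_le ?_
  rw [Real.enorm_eq_ofReal ht.1]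
  exact ENNReal.ofReal_le_one.2 ht.2

theorem hasFPowerSeriesOnBall_primitiveSeries [CompleteSpace G] {f : E → G}
    {f' : E → E →L[ℂ] G} {a : E} {r : ENNReal} {p : FormalMultilinearSeries ℂ E (E →L[ℂ] G)}
    (hf : ∀ x ∈ Metric.eball a r, HasFDerivAt f (f' x) x) (hp : HasFPowerSeriesOnBall f' p a r) :
    HasFPowerSeriesOnBall f (primitiveSeries (f a) p) a r where
  r_le := hp.r_le.trans (radius_le_radius_primitiveSeries _ _)
  r_pos := hp.r_pos
  hasSum := fun {y} hy => by
    have hsummable : Summable fun n => ‖p n (fun _ => y) y‖ :=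
      ((p.summable_norm_apply (Metric.eball_subset_eball hp.r_le hy)).mul_right ‖y‖).of_nonneg_of_le
        (fun n => norm_nonneg _) fun n => (p n fun _ => y).le_opNorm y
    have hderiv : ∀ t ∈ Icc (0 : ℝ) 1, HasDerivAt (fun t : ℝ => f (a + t • y))
        (∑' n, t ^ n • p n (fun _ => y) y) t := fun t ht => by
      have hty := smul_mem_eball hy ht
      rw [tsum_smul_apply_of_hasFPowerSeriesOnBall hp hty]
      have hx := hf (a + t • y) (by simpa [edist_eq_enorm_sub] using hty)
      have hline : HasDerivAt (fun t : ℝ => a + t • y) y t := by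
        simpa using ((hasDerivAt_id t).smul_const y).const_add a
      exact (hx.restrictScalars ℝ).comp_hasDerivAt t hline
    have hsum := hasSum_sub_of_hasDerivAt_tsum hsummable hderiv
    simp only [one_smul, zero_smul, add_zero, ← primitiveSeries_succ_apply (f a) p] at hsum
    simpa [primitiveSeries_zero_apply] using
      (hasSum_nat_add_iff (f := fun n => primitiveSeries (f a) p n fun _ => y) 1).1 hsum

theorem analyticAt_of_hasFDerivAt [CompleteSpace G] {f : E → G} {f' : E → E →L[ℂ] G} {a : E}
    (hf : ∀ᶠ x in 𝓝 a, HasFDerivAt f (f' x) x) (hf' : AnalyticAt ℂ f' a) : AnalyticAt ℂ f a := by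
  obtain ⟨p, r, hp⟩ := hf'
  obtain ⟨ε, hε, hball⟩ := EMetric.mem_nhds_iff.1 hf
  exact ⟨_, _, hasFPowerSeriesOnBall_primitiveSeries
    (fun x hx => hball (Metric.eball_subset_eball (min_le_right r ε) hx))
    (hp.mono (lt_min hp.r_pos hε) (min_le_left r ε))⟩

end Primitive

/-! ### Commuting frames -/

section Frame

variable {E C : Type*} [NormedAddCommGroup E] [NormedSpace ℂ E] [NormedAddCommGroup C]
  [NormedSpace ℂ C]

theorem eventually_isInvertible_of_continuousAt [CompleteSpace C] {A : E → C →L[ℂ] E} {x : E}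
    (hA : ContinuousAt A x) (hx : (A x).IsInvertible) : ∀ᶠ e in 𝓝 x, (A e).IsInvertible := by
  obtain ⟨D, hD⟩ := hx
  exact hA.eventually (hD ▸ D.nhds)

theorem contDiffAt_inverse [CompleteSpace C] {A : E → C →L[ℂ] E} {x : E} (hA : ContDiffAt ℂ ω A x)
    (hx : (A x).IsInvertible) : ContDiffAt ℂ ω (fun e => (A e).inverse) x := by
  obtain ⟨D, hD⟩ := hx
  exact ContDiffAt.comp (g := ContinuousLinearMap.inverse) x (hD ▸ contDiffAt_map_inverse D) hA

theorem fderiv_inverse_apply [CompleteSpace C] {A : E → C →L[ℂ] E} {e : E}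
    (hA : ContDiffAt ℂ ω A e) (he : (A e).IsInvertible) (v : E) (c : C) :
    fderiv ℂ (fun e => (A e).inverse) e v (A e c) = -(A e).inverse (fderiv ℂ A e v c) := by
  have hconst : HasFDerivAt (fun e => (A e).inverse (A e c)) (0 : E →L[ℂ] C) e :=
    (hasFDerivAt_const c e).congr_of_eventuallyEq <|
      (eventually_isInvertible_of_continuousAt hA.continuousAt he).mono fun e' he' =>
        he'.inverse_apply_self c
  have hprod := ((contDiffAt_inverse hA he).differentiableAt (by simp)).hasFDerivAt.clm_apply
    ((hA.differentiableAt (by simp)).hasFDerivAt.clm_apply (hasFDerivAt_const c e))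
  rw [eq_neg_iff_add_eq_zero, add_comm]
  simpa using DFunLike.congr_fun (hprod.unique hconst) v

theorem fderiv_inverse_symmetric [CompleteSpace C] {A : E → C →L[ℂ] E} {e : E}
    (hA : ContDiffAt ℂ ω A e) (he : (A e).IsInvertible)
    (hcomm : ∀ c d, fderiv ℂ A e (A e c) d = fderiv ℂ A e (A e d) c) (v w : E) :
    fderiv ℂ (fun e => (A e).inverse) e v w = fderiv ℂ (fun e => (A e).inverse) e w v := by
  obtain ⟨c, rfl⟩ := he.bijective.surjective v
  obtain ⟨d, rfl⟩ := he.bijective.surjective w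
  rw [fderiv_inverse_apply hA he, fderiv_inverse_apply hA he, hcomm]

theorem exists_primitive_of_commuting [CompleteSpace C] {A : E → C →L[ℂ] E} {x : E}
    (hA : ContDiffAt ℂ ω A x) (hx : (A x).IsInvertible)
    (hcomm : ∀ᶠ e in 𝓝 x, ∀ c d, fderiv ℂ A e (A e c) d = fderiv ℂ A e (A e d) c) :
    ∃ w : E → C, ContDiffAt ℂ ω w x ∧ w x = 0 ∧
      ∀ᶠ e in 𝓝 x, ∃ D : C ≃L[ℂ] E, (D : C →L[ℂ] E) = A e ∧
        HasFDerivAt w (D.symm : E →L[ℂ] C) e := by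
  have hinv := eventually_isInvertible_of_continuousAt hA.continuousAt hx
  obtain ⟨ε, hε, hball⟩ := Metric.eventually_nhds_iff_ball.1
    (hcomm.and ((hA.eventually (by simp)).and hinv))
  have hreal : ∀ e ∈ Metric.ball x ε, HasFDerivAt (fun e => (A e).inverse)
      ((fderiv ℂ (fun e => (A e).inverse) e).restrictScalars ℝ) e := fun e he =>
    ((contDiffAt_inverse (hball e he).2.1 (hball e he).2.2).differentiableAt
      (by simp)).hasFDerivAt.restrictScalars ℝ
  obtain ⟨f, hf⟩ := (convex_ball x ε).exists_forall_hasFDerivAt_of_fderiv_symmetric (𝕜 := ℂ)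
    Metric.isOpen_ball (fun e he => (hreal e he).differentiableAt.differentiableWithinAt)
    (fun e he v w => by
      rw [(hreal e he).fderiv]
      exact fderiv_inverse_symmetric (hball e he).2.1 (hball e he).2.2 (hball e he).1 v w)
  have hf' : ∀ᶠ e in 𝓝 x, HasFDerivAt f (A e).inverse e :=
    eventually_of_mem (Metric.ball_mem_nhds x hε) hf
  refine ⟨fun e => f e - f x, ?_, sub_self _, ?_⟩
  · exact (analyticAt_of_hasFDerivAt hf'
      (contDiffAt_inverse hA hx).analyticAt).contDiffAt.sub contDiffAt_const
  · filter_upwards [hf', hinv] with e hfe ⟨D, hD⟩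
    rw [← hD, ContinuousLinearMap.inverse_equiv] at hfe
    exact ⟨D, hD, hfe.sub_const _⟩

end Frame

/-! ### Straightening abelian algebras of holomorphic vector fields -/

theorem contDiffAt_clm_of_apply {C D G : Type*} [NormedAddCommGroup C] [NormedSpace ℂ C]
    [FiniteDimensional ℂ C] [NormedAddCommGroup D] [NormedSpace ℂ D] [NormedAddCommGroup G]
    [NormedSpace ℂ G] {A : D → C →L[ℂ] G} {x : D} (h : ∀ c, ContDiffAt ℂ ω (fun e => A e c) x) :
    ContDiffAt ℂ ω A x := by
  let e₁ : C ≃L[ℂ] (Fin (Module.finrank ℂ C) → ℂ) :=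
    ContinuousLinearEquiv.ofFinrankEq (Module.finrank_fin_fun ℂ).symm
  let e₂ := (e₁.arrowCongr (1 : G ≃L[ℂ] G)).trans (ContinuousLinearEquiv.piRing (Fin _))
  have hA : A = fun e => e₂.symm (e₂ (A e)) := by ext1 e; simp
  rw [hA]
  exact e₂.symm.contDiff.contDiffAt.comp x (contDiffAt_pi.2 fun i => h _)

section Straighten

variable {E : Type v} [NormedAddCommGroup E] [NormedSpace ℂ E]
  {Z : Type u} [TopologicalSpace Z] [ChartedSpace E Z] {a : Z}

section Frame

variable {C : Type w} [NormedAddCommGroup C] [NormedSpace ℂ C] [FiniteDimensional ℂ C]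

/-- The linear family of vector fields `X`, read in the chart at `a`, as a map with values in the
linear maps from the parameter space to the model space. -/
noncomputable def chartFrame (a : Z) (X : C →ₗ[ℂ] Π p : Z, TangentSpace 𝓘(ℂ, E) p) (e : E) :
    C →L[ℂ] E :=
  LinearMap.toContinuousLinearMap
    { toFun := fun z => chartField a (X z) e
      map_add' := fun x y => by
        rw [map_add]
        exact map_add (modelDeriv ℂ E E (chartAt E a).symm e).inverse _ _
      map_smul' := fun c x => by
        rw [map_smul]
        exact map_smul (modelDeriv ℂ E E (chartAt E a).symm e).inverse c _ }

variable {X : C →ₗ[ℂ] Π p : Z, TangentSpace 𝓘(ℂ, E) p}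

theorem chartFrame_apply (e : E) (z : C) : chartFrame a X e z = chartField a (X z) e := rfl

theorem fderiv_chartField_apply {e : E} (hX : DifferentiableAt ℂ (chartFrame a X) e) (c : C)
    (v : E) : fderiv ℂ (chartField a (X c)) e v = fderiv ℂ (chartFrame a X) e v c := by
  have hderiv := (hX.hasFDerivAt.clm_apply (hasFDerivAt_const c e)).fderiv
  refine (DFunLike.congr_fun hderiv v).trans ?_
  simp

variable [IsManifold 𝓘(ℂ, E) ω Z]

theorem isInvertible_chartFrame (hbij : Function.Bijective fun z => modelValue (X z) a) :
    (chartFrame a X (chartAt E a a)).IsInvertible := by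
  have ha := mem_chart_source E a
  have hcomp : ⇑(chartFrame a X (chartAt E a a) : C →ₗ[ℂ] E) =
      chartDeriv a a ha ∘ fun z => modelValue (X z) a :=
    funext fun z => chartField_apply a (X z) ha
  have hbij' : Function.Bijective (chartFrame a X (chartAt E a a) : C →ₗ[ℂ] E) := by
    rw [hcomp]
    exact (chartDeriv a a ha).bijective.comp hbij
  exact ⟨(LinearEquiv.ofBijective _ hbij').toContinuousLinearEquiv, by ext; rfl⟩

theorem eventually_forall_contMDiffAt (X : C →ₗ[ℂ] holAt E a) :
    ∀ᶠ p in 𝓝 a, ∀ z, ContMDiffAt 𝓘(ℂ, E) 𝓘(ℂ, E).tangent ω (T% ((X z).1)) p := by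
  let S : Z → Submodule ℂ C := fun p =>
    { carrier := {z | ContMDiffAt 𝓘(ℂ, E) 𝓘(ℂ, E).tangent ω (T% ((X z).1)) p}
      add_mem' := fun {x y} hx hy => by
        have hadd : (X (x + y)).1 = (X x).1 + (X y).1 := by rw [map_add]; rfl
        rw [mem_ofPred_eq, hadd]
        exact ContMDiffAt.add_section hx hy
      zero_mem' := by
        have hzero : (X 0).1 = 0 := by rw [map_zero]; rfl
        rw [mem_ofPred_eq, hzero]
        exact (Bundle.contMDiff_zeroSection ℂ _).contMDiffAt
      smul_mem' := fun r x hx => by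
        have hsmul : (X (r • x)).1 = r • (X x).1 := by rw [map_smul]; rfl
        rw [mem_ofPred_eq, hsmul]
        exact ContMDiffAt.const_smul_section hx }
  have htop : ∀ᶠ p in 𝓝 a, S p = ⊤ := eventually_eq_top fun z => (X z).2
  filter_upwards [htop] with p hp z
  exact hp.symm.le (Submodule.mem_top (x := z))

end Frame

section PullField

variable {C : Type w} [NormedAddCommGroup C] [NormedSpace ℂ C]

/-- The pull back of a field under a straightening, as a map of the parameter space. -/
noncomputable def pullField (ψ : OpenPartialHomeomorph C Z)
    (Y : Π p : Z, TangentSpace 𝓘(ℂ, E) p) : C → C :=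
  VectorField.mpullback 𝓘(ℂ, C) 𝓘(ℂ, E) ψ Y

theorem pullField_apply (Y : Π p : Z, TangentSpace 𝓘(ℂ, E) p) (z : C) :
    pullField ψ Y z = (modelDeriv ℂ C E ψ z).inverse (modelValue Y (ψ z)) := rfl

end PullField

variable [IsManifold 𝓘(ℂ, E) ω Z]

section IsStraightening

variable {C : Type w} [NormedAddCommGroup C] [NormedSpace ℂ C]
  {X : C →ₗ[ℂ] Π p : Z, TangentSpace 𝓘(ℂ, E) p}

/-- The holomorphic chart `ψ⁻¹` at `a`, defined on `ψ.target`, turns the vector fields `X z`, which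
represent the germs `L z` there, into the constant vector fields `z`. -/
structure IsStraightening (L : C →ₗ[ℂ] HolGerm E a)
    (X : C →ₗ[ℂ] Π p : Z, TangentSpace 𝓘(ℂ, E) p) (ψ : OpenPartialHomeomorph C Z) : Prop where
  zero_mem_source : 0 ∈ ψ.source
  map_zero : ψ 0 = a
  rep_eq : ∀ z, (L z).rep =ᶠ[𝓝 a] X z
  contMDiffAt_field : ∀ p ∈ ψ.target, ∀ z,
    ContMDiffAt 𝓘(ℂ, E) 𝓘(ℂ, E).tangent ω (T% (X z)) p
  contMDiffAt : ∀ z ∈ ψ.source, ContMDiffAt 𝓘(ℂ, C) 𝓘(ℂ, E) ω ψ z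
  contMDiffAt_symm : ∀ p ∈ ψ.target, ContMDiffAt 𝓘(ℂ, E) 𝓘(ℂ, C) ω ψ.symm p
  isInvertible_modelDeriv : ∀ z ∈ ψ.source, (modelDeriv ℂ C E ψ z).IsInvertible
  modelDeriv_apply : ∀ z ∈ ψ.source, ∀ x, modelDeriv ℂ C E ψ z x = modelValue (X x) (ψ z)

namespace IsStraightening

variable {L : C →ₗ[ℂ] HolGerm E a} {ψ : OpenPartialHomeomorph C Z}

theorem mem_target (h : IsStraightening L X ψ) : a ∈ ψ.target :=
  h.map_zero ▸ ψ.map_source h.zero_mem_source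

theorem symm_apply (h : IsStraightening L X ψ) : ψ.symm a = 0 :=
  h.map_zero ▸ ψ.left_inv h.zero_mem_source

theorem tendsto (h : IsStraightening L X ψ) : Tendsto ψ (𝓝 0) (𝓝 a) :=
  h.map_zero ▸ ψ.continuousAt h.zero_mem_source

theorem tendsto_symm (h : IsStraightening L X ψ) : Tendsto ψ.symm (𝓝 a) (𝓝 0) :=
  h.symm_apply ▸ ψ.symm.continuousAt h.mem_target

theorem modelDeriv_symm_apply (h : IsStraightening L X ψ) {p : Z} (hp : p ∈ ψ.target) (x : C) :
    modelDeriv ℂ E C ψ.symm p (modelValue (X x) p) = x := by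
  have hz := ψ.map_target hp
  have hinv := modelDeriv_left_inverse (f := ψ) (g := ψ.symm) (p := ψ.symm p)
    ((h.contMDiffAt _ hz).mdifferentiableAt (by simp))
    ((h.contMDiffAt_symm _ (ψ.map_source hz)).mdifferentiableAt (by simp))
    (by filter_upwards [ψ.open_source.mem_nhds hz] with q hq using ψ.left_inv hq) x
  rwa [h.modelDeriv_apply _ hz, ψ.right_inv hp] at hinv

theorem pullField_eq (h : IsStraightening L X ψ) {z : C} (hz : z ∈ ψ.source) (x : C) :
    pullField ψ (X x) z = x := by
  rw [pullField_apply, ← h.modelDeriv_apply z hz,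
    (h.isInvertible_modelDeriv z hz).inverse_apply_self]

variable [FiniteDimensional ℂ C]

theorem contDiffAt_pullField (h : IsStraightening L X ψ) {Y : Π p : Z, TangentSpace 𝓘(ℂ, E) p}
    (hY : Y ∈ holAt E a) : ContDiffAt ℂ ω (pullField ψ Y) 0 := by
  have : CompleteSpace C := FiniteDimensional.complete ℂ C
  have : IsManifold 𝓘(ℂ, E) 1 Z := IsManifold.of_le (n := ω) le_top
  refine contMDiffAt_vectorSpace_iff_contDiffAt.1 <|
    ContMDiffAt.mpullback_vectorField_preimage (n := ω) ?_ (h.contMDiffAt 0 h.zero_mem_source)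
      (h.isInvertible_modelDeriv 0 h.zero_mem_source) le_top
  exact h.map_zero.symm ▸ hY.self_of_nhds

end IsStraightening

end IsStraightening

section Chart

variable {C : Type w} [NormedAddCommGroup C] [NormedSpace ℂ C]

theorem exists_lift_holAt (L : C →ₗ[ℂ] HolGerm E a) :
    ∃ X : C →ₗ[ℂ] holAt E a, ∀ z, germ a (X z) = L z := by
  obtain ⟨s, hs⟩ := (germ (E := E) a).exists_rightInverse_of_surjective
    (LinearMap.range_eq_top.2 (Submodule.mkQ_surjective _))
  exact ⟨s ∘ₗ L, fun z => LinearMap.congr_fun hs (L z)⟩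

theorem modelDeriv_eq_of_symm_eq_comp_chart {ψ : OpenPartialHomeomorph C Z} {w : E → C} {z : C}
    {D : C ≃L[ℂ] E} (hz : z ∈ ψ.source) (hψ : MDifferentiableAt 𝓘(ℂ, C) 𝓘(ℂ, E) ψ z)
    (hp : ψ z ∈ (chartAt E a).source) (hsymm : ∀ p, ψ.symm p = w (chartAt E a p))
    (hD : HasFDerivAt w (D.symm : E →L[ℂ] C) (chartAt E a (ψ z))) :
    modelDeriv ℂ C E ψ z = (D.trans (chartDeriv a (ψ z) hp).symm : C ≃L[ℂ] E) := by
  have hcomp : MDifferentiableAt 𝓘(ℂ, E) 𝓘(ℂ, C) w (chartAt E a (ψ z)) :=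
    hD.differentiableAt.mdifferentiableAt
  have hfun : ⇑ψ.symm = fun p => w (chartAt E a p) := funext hsymm
  have hderiv : modelDeriv ℂ E C ψ.symm (ψ z) =
      (D.symm : E →L[ℂ] C).comp (chartDeriv a (ψ z) hp : E →L[ℂ] E) := by
    rw [hfun, modelDeriv_comp (g := w) (mdifferentiableAt_chart a hp) hcomp, modelDeriv_chart a hp,
      modelDeriv_eq_fderiv, hD.fderiv]
  have hψsymm : MDifferentiableAt 𝓘(ℂ, E) 𝓘(ℂ, C) ψ.symm (ψ z) := by
    rw [hfun]
    exact MDifferentiableAt.comp (g := w) (ψ z) hcomp (mdifferentiableAt_chart a hp)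
  have hinv := modelDeriv_left_inverse hψ hψsymm
    (by filter_upwards [ψ.open_source.mem_nhds hz] with y hy using ψ.left_inv hy)
  ext x
  have hx := hinv x
  rw [hderiv] at hx
  simpa [ContinuousLinearEquiv.symm_apply_eq, ContinuousLinearEquiv.eq_symm_apply] using hx

variable [FiniteDimensional ℂ E]

theorem exists_openPartialHomeomorph_of_chart {w : E → C} (D : C ≃L[ℂ] E)
    (hw : ContDiffAt ℂ ω w (chartAt E a a)) (hw0 : w (chartAt E a a) = 0)
    (hD : HasFDerivAt w (D.symm : E →L[ℂ] C) (chartAt E a a)) :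
    ∃ ψ : OpenPartialHomeomorph C Z, 0 ∈ ψ.source ∧ ψ 0 = a ∧
      ContMDiffAt 𝓘(ℂ, C) 𝓘(ℂ, E) ω ψ 0 ∧ ContMDiffAt 𝓘(ℂ, E) 𝓘(ℂ, C) ω ψ.symm a ∧
      ψ.target ⊆ (chartAt E a).source ∧ ∀ p, ψ.symm p = w (chartAt E a p) := by
  have : CompleteSpace E := FiniteDimensional.complete ℂ E
  let W : OpenPartialHomeomorph E C := hw.toOpenPartialHomeomorph w hD (by simp)
  have hW : chartAt E a a ∈ W.source := hw.mem_toOpenPartialHomeomorph_source hD (by simp)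
  have hW0 : W.symm 0 = chartAt E a a := hw0 ▸ W.left_inv hW
  have ha : a ∈ ((chartAt E a).trans W).source := by
    rw [OpenPartialHomeomorph.trans_source]
    exact ⟨mem_chart_source E a, hW⟩
  have hWsymm : ContDiffAt ℂ ω W.symm 0 := by
    refine W.contDiffAt_symm (f₀' := D.symm) (hw0 ▸ W.map_source hW) ?_ ?_ <;> rw [hW0]
    exacts [hD, hw]
  refine ⟨((chartAt E a).trans W).symm, ?_, ?_, ?_, ?_, ?_, fun p => rfl⟩
  · exact hw0 ▸ ((chartAt E a).trans W).map_source ha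
  · exact hw0 ▸ ((chartAt E a).trans W).left_inv ha
  · refine ContMDiffAt.comp (g := (chartAt E a).symm) (I' := 𝓘(ℂ, E)) 0 ?_ hWsymm.contMDiffAt
    change ContMDiffAt 𝓘(ℂ, E) 𝓘(ℂ, E) ω (chartAt E a).symm (W.symm 0)
    rw [hW0]
    exact contMDiffAt_chart_symm a (mem_chart_target E a)
  · exact ContMDiffAt.comp (g := w) (I' := 𝓘(ℂ, E)) a hw.contMDiffAt
      (contMDiffAt_chart a (mem_chart_source E a))
  · intro p hp
    rw [OpenPartialHomeomorph.symm_target, OpenPartialHomeomorph.trans_source] at hp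
    exact hp.1

end Chart

variable [FiniteDimensional ℂ E]

/-- Evaluation of germs of holomorphic vector fields at `a`, with values in the model space
instead of the tangent space at `a`. -/
noncomputable def modelEval (a : Z) : HolGerm E a →ₗ[ℂ] E := evalAt a

theorem modelEval_apply (ξ : HolGerm E a) : modelEval a ξ = modelValue ξ.rep a := rfl

theorem eventually_mlieBracket_eq_zero {ξ η : HolGerm E a}
    {X Y : Π p : Z, TangentSpace 𝓘(ℂ, E) p} (hX : ξ.rep =ᶠ[𝓝 a] X) (hY : η.rep =ᶠ[𝓝 a] Y)
    (h : ⁅ξ, η⁆ = 0) : ∀ᶠ p in 𝓝 a, modelValue (VectorField.mlieBracket 𝓘(ℂ, E) X Y) p = 0 := by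
  have hrep := ξ.rep_bracket η
  rw [h] at hrep
  filter_upwards [hrep, hX.mlieBracket_vectorField hY, HolGerm.rep_zero (E := E) (a := a)]
    with p hbracket hXY hzero
  exact (hXY.symm.trans hbracket.symm).trans hzero

variable {C : Type w} [NormedAddCommGroup C] [NormedSpace ℂ C] [FiniteDimensional ℂ C]
  {X : C →ₗ[ℂ] Π p : Z, TangentSpace 𝓘(ℂ, E) p}

theorem contDiffAt_chartFrame (hX : ∀ z, X z ∈ holAt E a) :
    ContDiffAt ℂ ω (chartFrame a X) (chartAt E a a) :=
  contDiffAt_clm_of_apply fun z => contDiffAt_chartField (hX z)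

theorem eventually_chartFrame_commute (hX : ∀ z, X z ∈ holAt E a)
    (hcomm : ∀ c d, ∀ᶠ p in 𝓝 a,
      modelValue (VectorField.mlieBracket 𝓘(ℂ, E) (X c) (X d)) p = 0) :
    ∀ᶠ e in 𝓝 (chartAt E a a), ∀ c d,
      fderiv ℂ (chartFrame a X) e (chartFrame a X e c) d =
        fderiv ℂ (chartFrame a X) e (chartFrame a X e d) c := by
  have : CompleteSpace C := FiniteDimensional.complete ℂ C
  have : CompleteSpace E := FiniteDimensional.complete ℂ E
  have hsymm : ∀ᶠ e in 𝓝 (chartAt E a a),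
      (fderiv ℂ (chartFrame a X) e).comp (chartFrame a X e) =
        ((fderiv ℂ (chartFrame a X) e).comp (chartFrame a X e)).flip := by
    refine eventually_clm_eq fun c => eventually_clm_eq fun d => ?_
    have ht : Tendsto (chartAt E a).symm (𝓝 (chartAt E a a)) (𝓝 a) :=
      (chartAt E a).tendsto_symm (mem_chart_source E a)
    filter_upwards [eventually_chartField_mlieBracket (hX c) (hX d),
      ht.eventually (hcomm c d), (contDiffAt_chartFrame hX).eventually (by simp)]
      with e hbracket hzero hsmooth
    have hdiff := hsmooth.differentiableAt (by simp)
    have hfield : chartField a (VectorField.mlieBracket 𝓘(ℂ, E) (X c) (X d)) e = 0 :=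
      (congrArg (modelDeriv ℂ E E (chartAt E a).symm e).inverse hzero).trans (map_zero _)
    simp only [hbracket, VectorField.lieBracket_eq, fderiv_chartField_apply hdiff,
      ← chartFrame_apply] at hfield
    exact sub_eq_zero.1 hfield
  filter_upwards [hsymm] with e he c d
  exact DFunLike.congr_fun (DFunLike.congr_fun he c) d

/-- A commuting frame is the inverse of a matrix of closed one-forms; a primitive of that matrix is
the straightening coordinate. -/
theorem exists_straightening_coordinate (L : C →ₗ[ℂ] HolGerm E a) (hL : ∀ x y, ⁅L x, L y⁆ = 0)
    (hbij : Function.Bijective fun z => modelEval a (L z)) :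
    ∃ (X : C →ₗ[ℂ] Π p : Z, TangentSpace 𝓘(ℂ, E) p) (w : E → C),
      (∀ z, (L z).rep =ᶠ[𝓝 a] X z) ∧
      (∀ᶠ p in 𝓝 a, ∀ z, ContMDiffAt 𝓘(ℂ, E) 𝓘(ℂ, E).tangent ω (T% (X z)) p) ∧
      ContDiffAt ℂ ω w (chartAt E a a) ∧ w (chartAt E a a) = 0 ∧
      ∀ᶠ e in 𝓝 (chartAt E a a), ∃ D : C ≃L[ℂ] E, (D : C →L[ℂ] E) = chartFrame a X e ∧
        HasFDerivAt w (D.symm : E →L[ℂ] C) e := by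
  have : CompleteSpace C := FiniteDimensional.complete ℂ C
  obtain ⟨X₀, hX₀⟩ := exists_lift_holAt L
  let X : C →ₗ[ℂ] Π p : Z, TangentSpace 𝓘(ℂ, E) p := (holAt E a).subtype ∘ₗ X₀
  have hX : ∀ z, X z ∈ holAt E a := fun z => (X₀ z).2
  have hLX : ∀ z, (L z).rep =ᶠ[𝓝 a] X z := fun z => hX₀ z ▸ rep_germ _
  have hval : (fun z => modelEval a (L z)) = fun z => modelValue (X z) a :=
    funext fun z => (hLX z).self_of_nhds
  obtain ⟨w, hw, hw0, hwD⟩ := exists_primitive_of_commuting (contDiffAt_chartFrame hX)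
    (isInvertible_chartFrame (hval ▸ hbij)) (eventually_chartFrame_commute hX fun c d =>
      eventually_mlieBracket_eq_zero (hLX c) (hLX d) (hL c d))
  exact ⟨X, w, hLX, eventually_forall_contMDiffAt X₀, hw, hw0, hwD⟩

theorem exists_isStraightening (L : C →ₗ[ℂ] HolGerm E a) (hL : ∀ x y, ⁅L x, L y⁆ = 0)
    (hbij : Function.Bijective fun z => modelEval a (L z)) :
    ∃ X ψ, IsStraightening L X ψ ∧ ∃ r > 0, ψ.source = Metric.ball 0 r := by
  obtain ⟨X, w, hLX, hX, hw, hw0, hwD⟩ := exists_straightening_coordinate L hL hbij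
  obtain ⟨D₀, -, hD₀⟩ := hwD.self_of_nhds
  obtain ⟨ψ₀, h0, hψ0, hψ, hsymm, htarget₀, hψw⟩ :=
    exists_openPartialHomeomorph_of_chart D₀ hw hw0 hD₀
  have hψt : Tendsto ψ₀ (𝓝 0) (𝓝 a) := hψ0 ▸ ψ₀.continuousAt h0
  obtain ⟨r, hr, hball⟩ := Metric.eventually_nhds_iff_ball.1 <|
    (ψ₀.open_source.eventually_mem h0).and <| (eventually_contMDiffAt hψ).and <|
    (hψt.eventually hX).and <| (hψt.eventually (eventually_contMDiffAt hsymm)).and <|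
    hψt.eventually (((chartAt E a).continuousAt (mem_chart_source E a)).eventually hwD)
  have hderiv : ∀ z ∈ Metric.ball (0 : C) r, (modelDeriv ℂ C E ψ₀ z).IsInvertible ∧
      ∀ x, modelDeriv ℂ C E ψ₀ z x = modelValue (X x) (ψ₀ z) := fun z hz => by
    obtain ⟨hz, hψz, -, -, D, hDX, hD⟩ := hball z hz
    have hp := htarget₀ (ψ₀.map_source hz)
    rw [modelDeriv_eq_of_symm_eq_comp_chart hz (hψz.mdifferentiableAt (by simp)) hp hψw hD]
    refine ⟨⟨_, rfl⟩, fun x => (ContinuousLinearEquiv.symm_apply_eq _).2 ?_⟩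
    rw [← chartField_apply a _ hp, ← chartFrame_apply, ← hDX]
    rfl
  let ψ := ψ₀.restrOpen (Metric.ball 0 r) Metric.isOpen_ball
  have hsource : ψ.source = Metric.ball 0 r := by
    rw [OpenPartialHomeomorph.restrOpen_source]
    exact inter_eq_right.2 fun z hz => (hball z hz).1
  have htarget : ∀ p ∈ ψ.target, ∃ z ∈ Metric.ball (0 : C) r, ψ₀ z = p := fun p hp =>
    ⟨ψ.symm p, hsource.le (ψ.map_target hp), ψ.right_inv hp⟩
  refine ⟨X, ψ,
    ⟨hsource.ge (Metric.mem_ball_self hr), hψ0, hLX, ?_, ?_, ?_, ?_, ?_⟩, r, hr, hsource⟩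
  · rintro p hp z
    obtain ⟨y, hy, rfl⟩ := htarget p hp
    exact (hball y hy).2.2.1 z
  · exact fun z hz => (hball z (hsource.le hz)).2.1
  · rintro p hp
    obtain ⟨y, hy, rfl⟩ := htarget p hp
    exact (hball y hy).2.2.2.1
  · exact fun z hz => (hderiv z (hsource.le hz)).1
  · exact fun z hz => (hderiv z (hsource.le hz)).2

namespace IsStraightening

variable {L : C →ₗ[ℂ] HolGerm E a} {ψ : OpenPartialHomeomorph C Z}

theorem eventually_fderiv_pullField_eq_zero (h : IsStraightening L X ψ) {η : HolGerm E a}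
    (hη : ∀ z, ⁅L z, η⁆ = 0) : ∀ᶠ z in 𝓝 (0 : C), fderiv ℂ (pullField ψ η.rep) z = 0 := by
  have : CompleteSpace C := FiniteDimensional.complete ℂ C
  have : IsManifold 𝓘(ℂ, E) (minSmoothness ℂ 2) Z := IsManifold.of_le (n := ω) le_top
  have : IsManifold 𝓘(ℂ, E) (minSmoothness ℂ 3) Z := IsManifold.of_le (n := ω) le_top
  refine eventually_clm_eq fun x => ?_
  filter_upwards [h.tendsto.eventually
      (eventually_mlieBracket_eq_zero (h.rep_eq x) (EventuallyEq.refl _ η.rep) (hη x)),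
    ψ.open_source.mem_nhds h.zero_mem_source, h.tendsto.eventually (mdiffAt_of_mem η.rep_mem)]
    with z hzero hz hdiff
  have hpull : pullField ψ (VectorField.mlieBracket 𝓘(ℂ, E) (X x) η.rep) z =
      VectorField.lieBracket ℂ (pullField ψ (X x)) (pullField ψ η.rep) z :=
    (VectorField.mpullback_mlieBracket
      ((h.contMDiffAt_field _ (ψ.map_source hz) x).mdifferentiableAt (by simp)) hdiff
      (h.contMDiffAt z hz) le_top).trans (mlieBracket_vectorSpace _ _ z)
  have hconst : pullField ψ (X x) =ᶠ[𝓝 z] fun _ => x := by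
    filter_upwards [ψ.open_source.mem_nhds hz] with y hy using h.pullField_eq hy x
  rw [pullField_apply, hzero, _root_.map_zero, VectorField.lieBracket_eq] at hpull
  simp only [hconst.fderiv_eq, hconst.self_of_nhds] at hpull
  simpa using hpull.symm

theorem eq_zero_of_commute (h : IsStraightening L X ψ) {η : HolGerm E a}
    (hη : ∀ z, ⁅L z, η⁆ = 0) (h0 : modelEval a η = 0) : η = 0 := by
  have hconst := eventually_eq_of_fderiv_eq_zero
    (((h.contDiffAt_pullField η.rep_mem).eventually (by simp)).mono fun z hz =>
      hz.differentiableAt (by simp)) (h.eventually_fderiv_pullField_eq_zero hη)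
  have hpull0 : pullField ψ η.rep 0 = 0 := by
    rw [pullField_apply, h.map_zero, ← modelEval_apply, h0, _root_.map_zero]
  have hzero : ∀ᶠ z in 𝓝 (0 : C), modelValue η.rep (ψ z) = 0 := by
    filter_upwards [hconst, ψ.open_source.mem_nhds h.zero_mem_source] with z hpull hz
    rwa [hpull0, pullField_apply, (h.isInvertible_modelDeriv z hz).inverse_apply_eq,
      _root_.map_zero] at hpull
  refine HolGerm.ext_rep ?_
  filter_upwards [h.tendsto_symm.eventually hzero, ψ.open_target.mem_nhds h.mem_target,
    HolGerm.rep_zero (E := E) (a := a)] with p hp hpt hrep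
  rw [ψ.right_inv hpt] at hp
  exact hp.trans hrep.symm

end IsStraightening

end Straighten

/-! ### Germs of submanifolds that are invariant under `V` are tubes -/

section Graph

variable {V : Type*} [NormedAddCommGroup V] [NormedSpace ℝ V] {K : Submodule ℝ V} {π : V →L[ℝ] K}
  {G : K → V} {ρ : ℝ}

/-- The chart `y ↦ y - G (π y) + π y`, which maps the graph of `G` into `K`. -/
noncomputable def graphChart (hπ : ∀ k : K, π k = k) (hG : ContDiffOn ℝ ω G (Metric.ball 0 ρ))
    (hπG : ∀ k ∈ Metric.ball 0 ρ, π (G k) = k) : OpenPartialHomeomorph V V :=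
  have hproj : ∀ y, π y ∈ Metric.ball 0 ρ → π (y - G (π y) + π y) = π y := fun y hy => by
    rw [map_add, map_sub, hπ, hπG _ hy, sub_add_cancel]
  have hproj_symm : ∀ y, π y ∈ Metric.ball 0 ρ → π (y + G (π y) - π y) = π y := fun y hy => by
    rw [map_sub, map_add, hπ, hπG _ hy, add_sub_cancel_right]
  have hGπ : ContinuousOn (fun y => G (π y)) (π ⁻¹' Metric.ball 0 ρ) :=
    hG.continuousOn.comp π.continuous.continuousOn fun _ h => h
  { toFun := fun y => y - G (π y) + π y
    invFun := fun y => y + G (π y) - π y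
    source := π ⁻¹' Metric.ball 0 ρ
    target := π ⁻¹' Metric.ball 0 ρ
    map_source' := fun y hy => by rwa [mem_preimage, hproj y hy]
    map_target' := fun y hy => by rwa [mem_preimage, hproj_symm y hy]
    left_inv' := fun y hy => by rw [hproj y hy]; abel
    right_inv' := fun y hy => by rw [hproj_symm y hy]; abel
    open_source := Metric.isOpen_ball.preimage π.continuous
    open_target := Metric.isOpen_ball.preimage π.continuous
    continuousOn_toFun := (continuousOn_id.sub hGπ).add (by fun_prop)
    continuousOn_invFun := (continuousOn_id.add hGπ).sub (by fun_prop) }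

theorem mem_image_iff_sub_add_mem (hπ : ∀ k : K, π k = k)
    (hπG : ∀ k ∈ Metric.ball 0 ρ, π (G k) = k) {y : V} (hy : π y ∈ Metric.ball 0 ρ) :
    y ∈ G '' Metric.ball 0 ρ ↔ y - G (π y) + π y ∈ K := by
  constructor
  · rintro ⟨k, hk, rfl⟩
    rw [hπG k hk, sub_self, zero_add]
    exact k.2
  · intro h
    have hsub : y - G (π y) ∈ K := (K.add_mem_iff_left (π y).2).1 h
    have hzero := hπ ⟨_, hsub⟩
    rw [map_sub, hπG _ hy, sub_self] at hzero
    exact ⟨π y, hy, (sub_eq_zero.1 (congrArg Subtype.val hzero).symm).symm⟩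

theorem isAnalyticSubmanifold_graph (hπ : ∀ k : K, π k = k)
    (hG : ContDiffOn ℝ ω G (Metric.ball 0 ρ)) (hπG : ∀ k ∈ Metric.ball 0 ρ, π (G k) = k) :
    IsAnalyticSubmanifold V (G '' Metric.ball 0 ρ) := by
  rintro _ ⟨k, hk, rfl⟩
  have hGπ : ContDiffOn ℝ ω (fun y => G (π y)) (π ⁻¹' Metric.ball 0 ρ) :=
    hG.comp π.contDiff.contDiffOn fun _ h => h
  have hKπ : ContDiffOn ℝ ω (fun y => (π y : V)) (π ⁻¹' Metric.ball 0 ρ) :=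
    (K.subtypeL.contDiff.comp π.contDiff).contDiffOn
  refine ⟨graphChart hπ hG hπG, ?_, ?_, K, fun y hy => mem_image_iff_sub_add_mem hπ hπG hy⟩
  · exact OpenPartialHomeomorph.mem_maximalAtlas_of_contMDiffOn _
      ((contDiffOn_id.sub hGπ).add hKπ).contMDiffOn ((contDiffOn_id.add hGπ).sub hKπ).contMDiffOn
  · change π (G k) ∈ Metric.ball 0 ρ
    rwa [hπG k hk]

end Graph

section Param

variable {C : Type*} [NormedAddCommGroup C] [NormedSpace ℂ C]
  {P : Type*} [NormedAddCommGroup P] [NormedSpace ℝ P] {N : Set C} {c : C} {σ : P → C} {r : C → P}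

theorem IsParam.injective_fderiv (h : IsParam C N c σ r) :
    Function.Injective (fderiv ℝ σ 0) := by
  have hr : MDifferentiableAt 𝓘(ℝ, C) 𝓘(ℝ, P) r (σ 0) := by
    rw [h.map_zero]
    exact h.smooth_inv.mdifferentiableAt (by simp)
  rw [← modelDeriv_eq_fderiv]
  exact Function.LeftInverse.injective
    (modelDeriv_left_inverse (h.smooth.mdifferentiableAt (by simp)) hr h.left_inv)

theorem IsParam.eventually_mem_range_fderiv [CompleteSpace P] (h : IsParam C N c σ r) {x : C}
    (hx : ∀ᶠ z in 𝓝[N] c, x ∈ modelTangent C N z) :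
    ∀ᶠ p in 𝓝 0, x ∈ (fderiv ℝ σ p).range := by
  have hr : ∀ᶠ z in 𝓝[N] c, MDifferentiableAt 𝓘(ℝ, C) 𝓘(ℝ, P) r z :=
    (CRTube.eventually_mdifferentiableAt h.smooth_inv).filter_mono nhdsWithin_le_nhds
  filter_upwards [h.tendsto.eventually hx, h.left_inv,
    h.tendsto.eventually (eventually_eventually_nhdsWithin.2 h.right_inv),
    h.tendsto.eventually hr, CRTube.eventually_mdifferentiableAt h.smooth]
    with p hxp hleft hright hrp hσp
  have hinv := modelDeriv_left_inverse_of_mem_modelTangent hrp (by rwa [hleft]) hright hxp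
  rw [hleft, modelDeriv_eq_fderiv] at hinv
  exact ⟨_, hinv⟩

end Param

section Tube

variable {C : Type*} [NormedAddCommGroup C] [NormedSpace ℂ C] [FiniteDimensional ℂ C]
  {V : Submodule ℝ C} {K : Submodule ℝ V} {π : V →L[ℝ] K}

/-- The map `x + iy ↦ (x, π y)`, a coordinate system on a submanifold that is the graph of a
map from `V × K` to `iV`. -/
noncomputable def graphProj (hV : IsRealForm V) (π : V →L[ℝ] K) : C →L[ℝ] V × K :=
  ((ContinuousLinearMap.id ℝ V).prodMap π).comp (reIm hV : C →L[ℝ] V × V)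

theorem graphProj_apply (hV : IsRealForm V) (π : V →L[ℝ] K) (z : C) :
    graphProj hV π z = ((reIm hV z).1, π (reIm hV z).2) := rfl

variable {P : Type*} [NormedAddCommGroup P] [NormedSpace ℝ P]

theorem exists_bijective_graphProj_comp (hV : IsRealForm V) {D : P →L[ℝ] C}
    (hD : Function.Injective D) (hVD : V ≤ D.range) :
    ∃ (K : Submodule ℝ V) (π : V →L[ℝ] K), (∀ k : K, π k = k) ∧
      Function.Bijective ((graphProj hV π).comp D) := by
  let imEmb : V →ₗ[ℝ] C := (reIm hV).symm.toLinearMap ∘ₗ LinearMap.inr ℝ V V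
  have himEmb (y : V) : imEmb y = Complex.I • (y : C) := by simp [imEmb, reIm_symm_apply]
  let K : Submodule ℝ V := D.range.comap imEmb
  obtain ⟨π, hπ⟩ := K.subtype.exists_leftInverse_of_injective K.ker_subtype
  have hπK (k : K) : π k = k := LinearMap.congr_fun hπ k
  refine ⟨K, π.toContinuousLinearMap, hπK, (injective_iff_map_eq_zero _).2 fun u hu => ?_, ?_⟩
  · obtain ⟨hre, him⟩ := Prod.ext_iff.1 hu
    change (reIm hV (D u)).1 = 0 at hre
    change π (reIm hV (D u)).2 = 0 at him
    have hDu := re_add_im hV (D u)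
    rw [hre, ZeroMemClass.coe_zero, zero_add] at hDu
    have himK : (reIm hV (D u)).2 ∈ K := ⟨u, by rw [himEmb]; exact hDu.symm⟩
    have him0 : (reIm hV (D u)).2 = 0 := (congrArg Subtype.val ((hπK ⟨_, himK⟩).symm.trans him) :)
    rw [him0, ZeroMemClass.coe_zero, smul_zero] at hDu
    exact hD (hDu.symm.trans (map_zero D).symm)
  · rintro ⟨x, k⟩
    obtain ⟨u, hu⟩ := hVD x.2
    obtain ⟨v, hv⟩ := k.2
    rw [himEmb] at hv
    refine ⟨u + v, ?_⟩
    have hDuv : D (u + v) = x + Complex.I • (k : C) :=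
      (map_add D u v).trans (congrArg₂ (· + ·) hu hv)
    rw [ContinuousLinearMap.comp_apply, hDuv, graphProj_apply, reIm_add]
    exact congrArg (Prod.mk x) (hπK k)

variable [FiniteDimensional ℝ P]

theorem eventually_injective_graphProj_comp_fderiv (hV : IsRealForm V) {σ : P → C}
    (hσ : ContDiffAt ℝ ω σ 0) (hbij : Function.Bijective ((graphProj hV π).comp (fderiv ℝ σ 0))) :
    ∀ᶠ p in 𝓝 0, Function.Injective ((graphProj hV π).comp (fderiv ℝ σ p)) := by
  have : CompleteSpace P := FiniteDimensional.complete ℝ P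
  let B : P ≃L[ℝ] V × K := (LinearEquiv.ofBijective
    ((graphProj hV π).comp (fderiv ℝ σ 0) : P →ₗ[ℝ] V × K) hbij).toContinuousLinearEquiv
  have hcont : ContinuousAt (fun p => (graphProj hV π).comp (fderiv ℝ σ p)) 0 :=
    continuousAt_const.clm_comp (hσ.fderiv_right (m := ω) le_top).continuousAt
  filter_upwards [hcont.eventually (B.nhds)] with p hp
  obtain ⟨A, hA⟩ := hp
  rw [← hA]
  exact A.injective

/-- A tangent vector with real part `x` and `π (Im) = 0` differs from the tangent vector `x` by one
that `graphProj` annihilates, so the imaginary part of a point is a function of its projection. -/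
theorem exists_eventually_im_eq (hV : IsRealForm V) {σ : P → C} (hσ : ContDiffAt ℝ ω σ 0)
    (hVσ : ∀ᶠ p in 𝓝 0, V ≤ (fderiv ℝ σ p).range)
    (hbij : Function.Bijective ((graphProj hV π).comp (fderiv ℝ σ 0))) :
    ∃ G : K → V, ContDiffAt ℝ ω G (π (reIm hV (σ 0)).2) ∧
      ∀ᶠ p in 𝓝 0, G (π (reIm hV (σ p)).2) = (reIm hV (σ p)).2 := by
  let im : C →L[ℝ] V := (ContinuousLinearMap.snd ℝ V V).comp (reIm hV : C →L[ℝ] V × V)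
  have hcomp (D : Type _) [NormedAddCommGroup D] [NormedSpace ℝ D] (l : C →L[ℝ] D) :
      ∀ᶠ p in 𝓝 0, fderiv ℝ (fun p => l (σ p)) p = l.comp (fderiv ℝ σ p) := by
    filter_upwards [hσ.eventually (by simp)] with p hp
    exact (l.hasFDerivAt.comp p (hp.differentiableAt (by simp)).hasFDerivAt).fderiv
  refine exists_factorization_of_ker_le (S := fun p => π.comp im (σ p)) (H := fun p => im (σ p))
    ((π.comp im).contDiff.contDiffAt.comp 0 hσ) ?_ (im.contDiff.contDiffAt.comp 0 hσ) ?_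
  · rw [(hcomp K (π.comp im)).self_of_nhds]
    refine LinearMap.range_eq_top.2 fun k => ?_
    obtain ⟨u, hu⟩ := hbij.2 (0, k)
    exact ⟨u, congrArg Prod.snd hu⟩
  · filter_upwards [hcomp K (π.comp im), hcomp V im, hVσ,
      eventually_injective_graphProj_comp_fderiv hV hσ hbij] with p hS hH hVp hinj u hu
    rw [hS] at hu
    rw [hH]
    obtain ⟨v, hv⟩ := hVp (reIm hV (fderiv ℝ σ p u)).1.2
    have hv' : reIm hV (fderiv ℝ σ p v) = ((reIm hV (fderiv ℝ σ p u)).1, 0) :=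
      (congrArg (reIm hV) hv).trans (reIm_coe hV _)
    have huv : u = v := hinj <| by
      simp only [ContinuousLinearMap.comp_apply, graphProj_apply, hv', map_zero]
      exact congrArg (Prod.mk _) hu
    exact (congrArg (fun w => (reIm hV (fderiv ℝ σ p w)).2) huv).trans (congrArg Prod.snd hv')

theorem eventually_exists_graphProj_eq (hV : IsRealForm V) {σ : P → C} (hσ : ContDiffAt ℝ ω σ 0)
    (hsurj : Function.Surjective ((graphProj hV π).comp (fderiv ℝ σ 0))) {A : P → Prop}
    (hA : ∀ᶠ p in 𝓝 0, A p) :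
    ∀ᶠ q in 𝓝 (graphProj hV π (σ 0)), ∃ p, A p ∧ graphProj hV π (σ p) = q := by
  have : CompleteSpace P := FiniteDimensional.complete ℝ P
  have hderiv : HasStrictFDerivAt (fun p => graphProj hV π (σ p))
      ((graphProj hV π).comp (fderiv ℝ σ 0)) 0 :=
    (graphProj hV π).hasStrictFDerivAt.comp 0 (hσ.hasStrictFDerivAt (by simp))
  exact hderiv.map_nhds_eq_of_surj (LinearMap.range_eq_top.2 hsurj) ▸ image_mem_map hA

theorem exists_graph_of_isParam (hV : IsRealForm V) {N : Set C} {σ : P → C} {r : C → P}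
    (h : IsParam C N 0 σ r) (hN : ∀ x ∈ V, ∀ᶠ z in 𝓝[N] 0, x ∈ modelTangent C N z) :
    ∃ (K : Submodule ℝ V) (π : V →L[ℝ] K) (G : K → V), (∀ k : K, π k = k) ∧ G 0 = 0 ∧
      ContDiffAt ℝ ω G 0 ∧ (∀ᶠ k in 𝓝 0, π (G k) = k) ∧
      ∀ᶠ z in 𝓝 0, z ∈ N ↔ (reIm hV z).2 = G (π (reIm hV z).2) := by
  have : CompleteSpace P := FiniteDimensional.complete ℝ P
  have hσ : ContDiffAt ℝ ω σ 0 := h.smooth.contDiffAt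
  have hVσ : ∀ᶠ p in 𝓝 0, V ≤ (fderiv ℝ σ p).range :=
    (eventually_eq_top fun x : V => h.eventually_mem_range_fderiv (hN x x.2)).mono
      fun p hp => Submodule.comap_subtype_eq_top.1 hp
  obtain ⟨K, π, hπ, hbij⟩ :=
    exists_bijective_graphProj_comp hV h.injective_fderiv hVσ.self_of_nhds
  obtain ⟨G, hG, hGσ⟩ := exists_eventually_im_eq hV hσ hVσ hbij
  have hzero : π (reIm hV (σ 0)).2 = 0 := by rw [h.map_zero, map_zero, Prod.snd_zero, map_zero]
  have hG0 : G 0 = 0 := by simpa [h.map_zero] using hGσ.self_of_nhds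
  have hopen {A : P → Prop} (hA : ∀ᶠ p in 𝓝 0, A p) :
      ∀ᶠ q in 𝓝 0, ∃ p, A p ∧ graphProj hV π (σ p) = q := by
    simpa only [h.map_zero, map_zero] using eventually_exists_graphProj_eq hV hσ hbij.2 hA
  refine ⟨K, π, G, hπ, hG0, hzero ▸ hG, ?_, ?_⟩
  · have hinr : Tendsto (fun k : K => ((0 : V), k)) (𝓝 0) (𝓝 0) :=
      (Continuous.prodMk_right (0 : V)).tendsto 0
    filter_upwards [hinr.eventually (hopen hGσ)] with k ⟨p, hp, hpk⟩
    have hpk' : π (reIm hV (σ p)).2 = k := congrArg Prod.snd hpk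
    rw [← hpk', hp]
  · have hr : Tendsto r (𝓝 0) (𝓝 0) := by
      simpa only [ContinuousAt, h.inv_base] using h.smooth_inv.continuousAt
    have hproj : Tendsto (graphProj hV π) (𝓝 0) (𝓝 0) := by
      simpa using (graphProj hV π).continuous.tendsto 0
    filter_upwards [hr.eventually hGσ, eventually_nhdsWithin_iff.1 h.right_inv,
      hproj.eventually (hopen (hGσ.and h.mem))] with z hGz hrz ⟨p, ⟨hGp, hp⟩, hpz⟩
    refine ⟨fun hz => ?_, fun hz => ?_⟩
    · rw [hrz hz] at hGz
      exact hGz.symm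
    · obtain ⟨hre, him⟩ := Prod.ext_iff.1 hpz
      have hσp : σ p = z := (reIm hV).injective <|
        Prod.ext hre (hGp.symm.trans ((congrArg G him).trans hz.symm))
      exact hσp ▸ hp

theorem exists_tube_of_isParam (hV : IsRealForm V) {N : Set C} {σ : P → C} {r : C → P}
    (h : IsParam C N 0 σ r) (hN : ∀ x ∈ V, ∀ᶠ z in 𝓝[N] 0, x ∈ modelTangent C N z) :
    ∃ F : Set V, IsAnalyticSubmanifold V F ∧ IsConnected F ∧ (0 : C) ∈ tube V F ∧
      ∀ᶠ z in 𝓝 0, z ∈ N ↔ z ∈ tube V F := by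
  obtain ⟨K, π, G, hπ, hG0, hG, hπG, hgraph⟩ := exists_graph_of_isParam hV h hN
  obtain ⟨ρ, hρ, hball⟩ := Metric.eventually_nhds_iff_ball.1 (hπG.and (hG.eventually (by simp)))
  have hGon : ContDiffOn ℝ ω G (Metric.ball 0 ρ) := fun k hk => (hball k hk).2.contDiffWithinAt
  have h0 := Metric.mem_ball_self (x := (0 : K)) hρ
  refine ⟨G '' Metric.ball 0 ρ, isAnalyticSubmanifold_graph hπ hGon fun k hk => (hball k hk).1,
    ((convex_ball (0 : K) ρ).isConnected ⟨0, h0⟩).image G hGon.continuousOn, ?_, ?_⟩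
  · rw [mem_tube_iff hV, map_zero]
    exact ⟨0, h0, hG0⟩
  · have hπim : Tendsto (fun z => π (reIm hV z).2) (𝓝 0) (𝓝 0) := by
      have hcont : Continuous fun z => π (reIm hV z).2 := by fun_prop
      simpa using hcont.tendsto 0
    filter_upwards [hgraph, hπim.eventually (Metric.ball_mem_nhds 0 hρ)] with z hz hπz
    rw [hz, mem_tube_iff hV]
    refine ⟨fun him => ⟨_, hπz, him.symm⟩, ?_⟩
    rintro ⟨k, hk, hkz⟩
    rw [← hkz, (hball k hk).1]

end Tube

/-! ### Realizations from admissible subalgebras -/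

theorem lie_eq_zero_of_mem_span {R H : Type*} [CommRing R] [LieRing H] [LieAlgebra R H] {S : Set H}
    (hS : ∀ x ∈ S, ∀ y ∈ S, ⁅x, y⁆ = 0) {x y : H} (hx : x ∈ Submodule.span R S)
    (hy : y ∈ Submodule.span R S) : ⁅x, y⁆ = 0 := by
  induction hx, hy using Submodule.span_induction₂ with
  | mem_mem x y hx hy => exact hS x hx y hy
  | zero_left y _ => exact zero_lie y
  | zero_right x _ => exact lie_zero x
  | add_left x y z _ _ _ hx hy => rw [add_lie, hx, hy, add_zero]
  | add_right x y z _ _ _ hy hz => rw [lie_add, hy, hz, add_zero]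
  | smul_left r x y _ _ h => rw [smul_lie, h, smul_zero]
  | smul_right r x y _ _ h => rw [lie_smul, h, smul_zero]

section RealForm

variable {H : Type*} [AddCommGroup H] [Module ℂ H] {W : Submodule ℝ H}

theorem exists_add_I_smul_eq_of_mem_span {ζ : H} (hζ : ζ ∈ Submodule.span ℂ (W : Set H)) :
    ∃ ξ ∈ W, ∃ η ∈ W, ξ + Complex.I • η = ζ := by
  induction hζ using Submodule.span_induction with
  | mem ξ hξ => exact ⟨ξ, hξ, 0, zero_mem _, by simp⟩
  | zero => exact ⟨0, zero_mem _, 0, zero_mem _, by simp⟩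
  | add x y _ _ hx hy =>
    obtain ⟨ξ, hξ, η, hη, rfl⟩ := hx
    obtain ⟨ξ', hξ', η', hη', rfl⟩ := hy
    exact ⟨ξ + ξ', add_mem hξ hξ', η + η', add_mem hη hη', by module⟩
  | smul r x _ hx =>
    obtain ⟨ξ, hξ, η, hη, rfl⟩ := hx
    refine ⟨r.re • ξ - r.im • η, sub_mem (W.smul_mem _ hξ) (W.smul_mem _ hη),
      r.im • ξ + r.re • η, add_mem (W.smul_mem _ hξ) (W.smul_mem _ hη), ?_⟩
    have hr : r = (r.re : ℂ) + (r.im : ℂ) * Complex.I := (Complex.re_add_im r).symm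
    simp only [← Complex.coe_smul]
    generalize (r.re : ℂ) = s, (r.im : ℂ) = t at hr ⊢
    subst hr
    match_scalars
    · ring
    · linear_combination (-t) * Complex.I_mul_I

theorem isRealForm_comap {C : Type*} [NormedAddCommGroup C] [NormedSpace ℂ C]
    (hW : ∀ ξ ∈ W, Complex.I • ξ ∈ W → ξ = 0) {f : C →ₗ[ℂ] H} (hf : Function.Injective f)
    (hrange : LinearMap.range f = Submodule.span ℂ (W : Set H)) :
    IsRealForm (W.comap (f.restrictScalars ℝ)) := by
  have hmem : ∀ ξ ∈ W, ∃ x, f x = ξ := fun ξ hξ =>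
    LinearMap.mem_range.1 (hrange ▸ Submodule.subset_span hξ)
  intro z
  obtain ⟨ξ, hξ, η, hη, hz⟩ :=
    exists_add_I_smul_eq_of_mem_span (hrange ▸ LinearMap.mem_range_self f z)
  obtain ⟨x, rfl⟩ := hmem ξ hξ
  obtain ⟨y, rfl⟩ := hmem η hη
  rw [← map_smul, ← map_add] at hz
  refine ⟨(⟨x, hξ⟩, ⟨y, hη⟩), hf hz, ?_⟩
  rintro ⟨⟨x', hx'⟩, ⟨y', hy'⟩⟩ hxy
  have hsub : x' - x = Complex.I • (y - y') := by
    rw [smul_sub, sub_eq_sub_iff_add_eq_add, add_comm _ x, hf hz, ← hxy]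
  have hy : f (y - y') = 0 := by
    refine hW _ ?_ ?_
    · rw [map_sub]
      exact sub_mem hη hy'
    · rw [← map_smul, ← hsub, map_sub]
      exact sub_mem hx' hξ
  have hy0 : y - y' = 0 := hf (hy.trans (map_zero f).symm)
  rw [hy0, smul_zero] at hsub
  exact Prod.ext (Subtype.ext (sub_eq_zero.1 hsub)) (Subtype.ext (sub_eq_zero.1 hy0).symm)

end RealForm

theorem IsParam.preimage {W W' : Type*} [NormedAddCommGroup W] [NormedSpace ℝ W]
    [NormedAddCommGroup W'] [NormedSpace ℝ W'] {X Y : Type*} [TopologicalSpace X]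
    [ChartedSpace W X] [TopologicalSpace Y] [ChartedSpace W' Y] {S : Set X} {a : X} {P : Type*}
    [NormedAddCommGroup P] [NormedSpace ℝ P] {σ : P → X} {c : X → P} (h : IsParam W S a σ c)
    {ψ : OpenPartialHomeomorph Y X} {b : Y} (hb : b ∈ ψ.source) (hψb : ψ b = a)
    (hψ : ContMDiffAt 𝓘(ℝ, W') 𝓘(ℝ, W) ω ψ b)
    (hψsymm : ContMDiffAt 𝓘(ℝ, W) 𝓘(ℝ, W') ω ψ.symm a) :
    IsParam W' (ψ.source ∩ ψ ⁻¹' S) b (fun x => ψ.symm (σ x)) (fun q => c (ψ q)) := by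
  subst hψb
  have hσ : ∀ᶠ x in 𝓝 0, σ x ∈ ψ.target :=
    h.tendsto.eventually
      (mem_nhdsWithin_of_mem_nhds (ψ.open_target.mem_nhds (ψ.map_source hb)))
  have hlim : Tendsto ψ (𝓝[ψ.source ∩ ψ ⁻¹' S] b) (𝓝[S] (ψ b)) :=
    tendsto_nhdsWithin_iff.2 ⟨(ψ.continuousAt hb).mono_left nhdsWithin_le_nhds,
      eventually_nhdsWithin_of_forall fun q hq => hq.2⟩
  refine ⟨.comp _ (by rwa [h.map_zero]) h.smooth, by rw [h.map_zero, ψ.left_inv hb], ?_,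
    h.smooth_inv.comp b hψ, h.inv_base, ?_, ?_⟩
  · filter_upwards [hσ, h.mem] with x hx hxS
    exact ⟨ψ.map_target hx, by rwa [mem_preimage, ψ.right_inv hx]⟩
  · filter_upwards [hlim.eventually h.right_inv, self_mem_nhdsWithin] with q hq hqS
    rw [hq, ψ.left_inv hqS.1]
  · filter_upwards [hσ, h.left_inv] with x hx hleft
    rw [ψ.right_inv hx, hleft]

section Realize

variable {E : Type v} [NormedAddCommGroup E] [NormedSpace ℂ E]
  {Z : Type u} [TopologicalSpace Z] [ChartedSpace E Z] [IsManifold 𝓘(ℂ, E) ω Z]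
  {M : Set Z} {a : Z}

namespace IsStraightening

variable {C : Type w} [NormedAddCommGroup C] [NormedSpace ℂ C] {L : C →ₗ[ℂ] HolGerm E a}
  {X : C →ₗ[ℂ] Π p : Z, TangentSpace 𝓘(ℂ, E) p} {ψ : OpenPartialHomeomorph C Z}

theorem isMIntegralCurveOn (h : IsStraightening L X ψ) {z : C} {s : Set ℝ}
    (hs : ∀ t ∈ s, t • z ∈ ψ.source) :
    IsMIntegralCurveOn (I := 𝓘(ℝ, E)) (fun t : ℝ => ψ (t • z)) (fun p => (X z p : E)) s := by
  intro t ht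
  have hψ := (h.contMDiffAt _ (hs t ht)).mdifferentiableAt (by simp)
  have hline : HasDerivAt (fun t : ℝ => t • z) z t := by
    simpa using (hasDerivAt_id t).smul_const z
  have hcurve := hasMFDerivAt_comp_curve (mdifferentiableAt_real hψ) rfl
    (hasMFDerivAt_curve_iff.2 hline)
  rw [modelDeriv_real_apply hψ, h.modelDeriv_apply _ (hs t ht)] at hcurve
  exact hcurve.hasMFDerivWithinAt

theorem eventually_modelDeriv_symm_rep (h : IsStraightening L X ψ) (x : C) :
    ∀ᶠ p in 𝓝 a, modelDeriv ℝ E C ψ.symm p (modelValue (L x).rep p) = x := by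
  filter_upwards [h.rep_eq x, ψ.open_target.mem_nhds h.mem_target] with p hp hpψ
  have hval : modelValue (L x).rep p = modelValue (X x) p := hp
  rw [hval, modelDeriv_real_apply ((h.contMDiffAt_symm p hpψ).mdifferentiableAt (by simp)),
    h.modelDeriv_symm_apply hpψ]

theorem eventually_mem_modelTangent_preimage (h : IsStraightening L X ψ) {x : C}
    (hx : ∀ᶠ p in 𝓝[M] a, modelValue (L x).rep p ∈ modelTangent E M p) :
    ∀ᶠ z in 𝓝[ψ.source ∩ ψ ⁻¹' M] 0, x ∈ modelTangent C (ψ.source ∩ ψ ⁻¹' M) z := by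
  have hlim : Tendsto ψ (𝓝[ψ.source ∩ ψ ⁻¹' M] 0) (𝓝[M] a) :=
    tendsto_nhdsWithin_iff.2 ⟨h.tendsto.mono_left nhdsWithin_le_nhds,
      eventually_nhdsWithin_of_forall fun z hz => hz.2⟩
  filter_upwards [hlim.eventually hx, self_mem_nhdsWithin,
    (h.tendsto.eventually (h.eventually_modelDeriv_symm_rep x)).filter_mono nhdsWithin_le_nhds]
    with z hzx hz hderiv
  have hp := ψ.map_source hz.1
  have hmaps : ∀ᶠ q in 𝓝[M] (ψ z), ψ.symm q ∈ ψ.source ∩ ψ ⁻¹' M := by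
    filter_upwards [mem_nhdsWithin_of_mem_nhds (ψ.open_target.mem_nhds hp),
      self_mem_nhdsWithin] with q hq hqM
    exact ⟨ψ.map_target hq, by rwa [mem_preimage, ψ.right_inv hq]⟩
  have htangent := modelDeriv_mem_modelTangent (mdifferentiableAt_real
    ((h.contMDiffAt_symm _ hp).mdifferentiableAt (by simp))) hmaps hzx
  rwa [hderiv, ψ.left_inv hz.1] at htangent

theorem isCRIsoGerm_symm (h : IsStraightening L X ψ) {T : Set C}
    (hT : ∀ᶠ z in 𝓝 0, z ∈ ψ.source ∩ ψ ⁻¹' M ↔ z ∈ T) : IsCRIsoGerm E C M a T 0 ψ.symm := by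
  have htarget : ∀ᶠ p in 𝓝[M] a, p ∈ ψ.target :=
    mem_nhdsWithin_of_mem_nhds (ψ.open_target.mem_nhds h.mem_target)
  have hsource : ∀ᶠ z in 𝓝[T] 0, z ∈ ψ.source :=
    mem_nhdsWithin_of_mem_nhds (ψ.open_source.mem_nhds h.zero_mem_source)
  have hMT : ∀ᶠ p in 𝓝[M] a, ψ.symm p ∈ T := by
    filter_upwards [(h.tendsto_symm.eventually hT).filter_mono nhdsWithin_le_nhds,
      self_mem_nhdsWithin, htarget] with p hpT hpM hp
    exact hpT.1 ⟨ψ.map_target hp, by rwa [mem_preimage, ψ.right_inv hp]⟩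
  have hTM : ∀ᶠ z in 𝓝[T] 0, ψ z ∈ M := by
    filter_upwards [hT.filter_mono nhdsWithin_le_nhds, self_mem_nhdsWithin] with z hzT hz
    exact (hzT.2 hz).2
  exact ⟨h.symm_apply, isCRMapGerm_of_holomorphic (h.contMDiffAt_symm a h.mem_target) hMT, ψ,
    isCRMapGerm_of_holomorphic (h.contMDiffAt 0 h.zero_mem_source) hTM,
    htarget.mono fun p => ψ.right_inv, hsource.mono fun z => ψ.left_inv⟩

end IsStraightening

variable [FiniteDimensional ℂ E]

theorem IsAdmissible.lie_eq_zero {𝔳 : LieSubalgebra ℝ (HolGerm E a)} (h : IsAdmissible M a 𝔳)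
    {ξ η : HolGerm E a} (hξ : ξ ∈ Submodule.span ℂ (𝔳 : Set (HolGerm E a)))
    (hη : η ∈ Submodule.span ℂ (𝔳 : Set (HolGerm E a))) : ⁅ξ, η⁆ = 0 :=
  lie_eq_zero_of_mem_span
    (fun ξ hξ η hη => congrArg Subtype.val (h.abelian.trivial ⟨ξ, hξ⟩ ⟨η, hη⟩)) hξ hη

theorem IsAdmissible.bijective_modelEval {𝔳 : LieSubalgebra ℝ (HolGerm E a)}
    (h : IsAdmissible M a 𝔳) :
    Function.Bijective
      (modelEval a ∘ₗ (Submodule.span ℂ (𝔳 : Set (HolGerm E a))).subtype) := by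
  set 𝔢 := Submodule.span ℂ (𝔳 : Set (HolGerm E a))
  have hrange : LinearMap.range (modelEval a ∘ₗ 𝔢.subtype) = ⊤ := by
    rw [LinearMap.range_comp, Submodule.range_subtype]
    exact h.spans
  refine ⟨(injective_iff_map_eq_zero _).2 fun ξ hξ => ?_, LinearMap.range_eq_top.1 hrange⟩
  obtain ⟨s, hs⟩ := (modelEval a ∘ₗ 𝔢.subtype).exists_rightInverse_of_surjective hrange
  have hbij : Function.Bijective fun e => modelEval a ((𝔢.subtype ∘ₗ s) e) := by
    convert Function.bijective_id with e
    exact LinearMap.congr_fun hs e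
  obtain ⟨X, ψ, hψ, -⟩ := exists_isStraightening (𝔢.subtype ∘ₗ s)
    (fun x y => h.lie_eq_zero (s x).2 (s y).2) hbij
  exact Subtype.ext (hψ.eq_zero_of_commute (fun e => h.lie_eq_zero (s e).2 ξ.2) hξ)

theorem IsStraightening.exists_realization {C : Type w} [NormedAddCommGroup C] [NormedSpace ℂ C]
    [FiniteDimensional ℂ C] (hM : IsGenericAt E M a) (𝔳 : Admissible E M a)
    {L : C ≃ₗ[ℂ] Submodule.span ℂ (𝔳.1 : Set (HolGerm E a))}
    {X : C →ₗ[ℂ] Π p : Z, TangentSpace 𝓘(ℂ, E) p} {ψ : OpenPartialHomeomorph C Z} {r : ℝ}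
    (h : IsStraightening (Submodule.subtype _ ∘ₗ L.toLinearMap) X ψ)
    (hsource : ψ.source = Metric.ball 0 r) :
    ∃ R : TubeRealization.{u, v, w} E M a, R.Induces 𝔳 ∧ R.IsExp 𝔳 := by
  set f : C →ₗ[ℂ] HolGerm E a := Submodule.subtype _ ∘ₗ L.toLinearMap
  have hrange : LinearMap.range f = Submodule.span ℂ (𝔳.1 : Set (HolGerm E a)) := by
    simp [f, LinearMap.range_comp]
  let V : Submodule ℝ C := 𝔳.1.toSubmodule.comap (f.restrictScalars ℝ)
  have hV : IsRealForm V := isRealForm_comap 𝔳.2.totallyReal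
    (Subtype.val_injective.comp L.injective) hrange
  obtain ⟨m, σ, c, hσ⟩ := hM.param
  have hparam := hσ.preimage h.zero_mem_source h.map_zero
    (contMDiffAt_real (h.contMDiffAt 0 h.zero_mem_source))
    (contMDiffAt_real (h.contMDiffAt_symm a h.mem_target))
  obtain ⟨F, hF, hFconn, h0F, hMF⟩ := exists_tube_of_isParam hV hparam fun x hx =>
    h.eventually_mem_modelTangent_preimage (𝔳.2.mem_modelTangent hx)
  have hconst : ∀ x, ∀ᶠ p in 𝓝[M] a, modelDeriv ℝ E C ψ.symm p (modelValue (f x).rep p) = x :=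
    fun x => (h.eventually_modelDeriv_symm_rep x).filter_mono nhdsWithin_le_nhds
  refine ⟨⟨C, V, hV, F, hF, hFconn, 0, h0F, ψ.symm, h.isCRIsoGerm_symm hMF⟩,
    TubeRealization.induces_iff.2 ⟨fun ξ hξ => ?_, fun x hx => ⟨f x, hx, hconst x⟩⟩,
    rfl, L, X, ψ, fun z => Iff.rfl, h.rep_eq, fun z p hp => h.contMDiffAt_field p hp z,
    h.zero_mem_source, h.map_zero, fun z hz => (h.contMDiffAt z hz).contMDiffWithinAt,
    fun p hp => (h.contMDiffAt_symm p hp).contMDiffWithinAt, fun z hz => ?_,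
    Eventually.of_forall fun _ => rfl⟩
  · obtain ⟨x, hx⟩ := L.surjective ⟨ξ, Submodule.subset_span hξ⟩
    have hfx : f x = ξ := congrArg Subtype.val hx
    subst hfx
    exact ⟨x, hξ, hconst x⟩
  · have hsegment : ∀ t ∈ Icc (0 : ℝ) 1, t • z ∈ ψ.source := fun t ht => by
      rw [hsource] at hz ⊢
      exact (convex_ball 0 r).smul_mem_of_zero_mem
        (Metric.mem_ball_self (Metric.pos_of_mem_ball hz)) hz ht
    exact ⟨fun t => ψ (t • z), by simp [h.map_zero], by simp,
      fun t ht => ψ.map_source (hsegment t ht), h.isMIntegralCurveOn hsegment⟩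

theorem Admissible.exists_realization (hM : IsGenericAt E M a) (𝔳 : Admissible E M a) :
    ∃ R : TubeRealization.{u, v, w} E M a, R.Induces 𝔳 ∧ R.IsExp 𝔳 := by
  let ev := LinearEquiv.ofBijective _ 𝔳.2.bijective_modelEval
  let C : Type w := ULift.{w} (Fin (Module.finrank ℂ E) → ℂ)
  have : FiniteDimensional ℂ C := Module.Finite.equiv ULift.moduleEquiv.symm
  have hCE : Module.finrank ℂ C = Module.finrank ℂ E := by
    rw [ULift.moduleEquiv.finrank_eq, Module.finrank_fin_fun]
  let L := (LinearEquiv.ofFinrankEq C E hCE).trans ev.symm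
  obtain ⟨X, ψ, hψ, r, -, hsource⟩ := exists_isStraightening
    (Submodule.subtype _ ∘ₗ L.toLinearMap) (fun x y => 𝔳.2.lie_eq_zero (L x).2 (L y).2)
    (𝔳.2.bijective_modelEval.comp L.bijective)
  exact hψ.exists_realization hM 𝔳 hsource

theorem exists_equiv_quot (hM : IsGenericAt E M a) :
    ∃ Θ : Quot (AffEquiv.{u, v, w} E M a) ≃ Quot (Conjugate (E := E) M a),
      ∀ (R : TubeRealization.{u, v, w} E M a) (𝔳 : Admissible E M a),
        R.Induces 𝔳 → Θ (Quot.mk _ R) = Quot.mk _ 𝔳 := by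
  choose f hf hunique using fun R : TubeRealization.{u, v, w} E M a => R.existsUnique_induces hM
  let θ : Quot (AffEquiv.{u, v, w} E M a) → Quot (Conjugate (E := E) M a) :=
    Quot.map f fun R R' h => h.conjugate hM.mem (hf R) (hf R')
  have hθ : ∀ R 𝔳, R.Induces 𝔳 → θ (Quot.mk _ R) = Quot.mk _ 𝔳 := fun R 𝔳 h =>
    congrArg (Quot.mk _) (hunique R 𝔳 h).symm
  have hinj : Function.Injective θ := by
    rintro ⟨R⟩ ⟨R'⟩ h
    have hconj : Conjugate M a (f R) (f R') :=
      (equivalence_conjugate hM.mem).eqvGen_iff.1 (Quot.eqvGen_exact h)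
    exact Quot.sound (hconj.affEquiv hM.mem (hf R) (hf R'))
  have hsurj : Function.Surjective θ := by
    rintro ⟨𝔳⟩
    obtain ⟨R, hR, -⟩ := Admissible.exists_realization.{u, v, w} hM 𝔳
    exact ⟨Quot.mk _ R, hθ R 𝔳 hR⟩
  exact ⟨Equiv.ofBijective θ ⟨hinj, hsurj⟩, hθ⟩

end Realize

end CRTube

theorem mainTheorem2_general
    {E : Type v} [NormedAddCommGroup E] [NormedSpace ℂ E] [FiniteDimensional ℂ E]
    {Z : Type u} [TopologicalSpace Z] [ChartedSpace E Z] [IsManifold 𝓘(ℂ, E) ω Z]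
    {M : Set Z} {a : Z} (hM : CRTube.IsGenericAt E M a) :
    Equivalence (CRTube.AffEquiv.{u, v, w} E M a) ∧
    Equivalence (CRTube.Conjugate (E := E) M a) ∧
    (∀ R : CRTube.TubeRealization.{u, v, w} E M a,
      ∃! 𝔳 : CRTube.Admissible E M a, R.Induces 𝔳) ∧
    (∃ Θ : Quot (CRTube.AffEquiv.{u, v, w} E M a) ≃ Quot (CRTube.Conjugate (E := E) M a),
      ∀ (R : CRTube.TubeRealization.{u, v, w} E M a) (𝔳 : CRTube.Admissible E M a),
        R.Induces 𝔳 → Θ (Quot.mk _ R) = Quot.mk _ 𝔳) ∧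
    ∀ 𝔳 : CRTube.Admissible E M a, ∃ R : CRTube.TubeRealization.{u, v, w} E M a,
      R.Induces 𝔳 ∧ R.IsExp 𝔳 :=
  ⟨CRTube.equivalence_affEquiv, CRTube.equivalence_conjugate hM.mem,
    fun R => R.existsUnique_induces hM, CRTube.exists_equiv_quot hM,
    CRTube.Admissible.exists_realization hM⟩

theorem mainTheorem2
    {E : Type v} [NormedAddCommGroup E] [NormedSpace ℂ E] [FiniteDimensional ℂ E]
    {Z : Type u} [TopologicalSpace Z] [T2Space Z] [ChartedSpace E Z] [IsManifold 𝓘(ℂ, E) ω Z]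
    (M : Set Z) (hM : CRTube.IsGenericSubmanifold E M) (a : Z) (ha : a ∈ M) :
    Equivalence (CRTube.AffEquiv.{u, v, w} E M a) ∧
    Equivalence (CRTube.Conjugate (E := E) M a) ∧
    (∀ R : CRTube.TubeRealization.{u, v, w} E M a,
      ∃! 𝔳 : CRTube.Admissible E M a, R.Induces 𝔳) ∧
    (∃ Θ : Quot (CRTube.AffEquiv.{u, v, w} E M a) ≃ Quot (CRTube.Conjugate (E := E) M a),
      ∀ (R : CRTube.TubeRealization.{u, v, w} E M a) (𝔳 : CRTube.Admissible E M a),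
        R.Induces 𝔳 → Θ (Quot.mk _ R) = Quot.mk _ 𝔳) ∧
    ∀ 𝔳 : CRTube.Admissible E M a, ∃ R : CRTube.TubeRealization.{u, v, w} E M a,
      R.Induces 𝔳 ∧ R.IsExp 𝔳 :=
  mainTheorem2_general (hM.isGenericAt ha)
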